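/- **Conventions.** $\lambda$ is the security parameter. A function $\mu:\mathbb N\to\mathbb R_{\ge 0}$ is negligible if $p(\lambda)\mu(\lambda)\to 0$ for every polynomial $p$. "Efficient" means polynomial time in $\lambda$, i.e. given by a uniform, polynomial-time generated family of circuits: classical reversible circuits for deterministic algorithms, the same with uniform random coins for probabilistic ones, and quantum circuits over NOT, CNOT, Toffoli and a fixed alphabet $(U_j)_{j\in\mathbb N}$ of one-qubit unitaries and their inverses for quantum ones. All string lengths, and the number $n=n(\lambda)$ of qubits, are polynomially bounded and efficiently computable. For a density $p$, $\mathrm{Supp}(p)=\{p>0\}$; $\mathrm{TV}(p,p')=\frac12\sum_a|p(a)-p'(a)|$; $H^2(p,p')=1-\sum_a\sqrt{p(a)p'(a)}$; $d\cdot e$ is the inner product modulo 2. **Trapdoor families.** Let $\mathcal X$ be a finite set of bit strings and $\mathcal Y=\{0,1\}^{\ell}$ (depending on $\lambda$). A *noisy trapdoor claw-free family* $\mathcal F$ consists of a finite key set $\mathcal K_{\mathcal F}$ and, for $k\in\mathcal K_{\mathcal F}$, $b\in\{0,1\}$, $x\in\mathcal X$, densities $f_{k,b}(x)$ on $\mathcal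 Y$ such that: (1) an efficient probabilistic algorithm $\mathrm{GEN}_{\mathcal F}$ produces a key $k\in\mathcal K_{\mathcal F}$ and a trapdoor $t_k$; (2) for all $k,b$ the supports of $f_{k,b}(x)$, $x\in\mathcal X$, are pairwise disjoint, an efficient deterministic algorithm satisfies $\mathrm{INV}_{\mathcal F}(t_k,b,y)=x$ for $y\in\mathrm{Supp}(f_{k,b}(x))$, and $\mathcal R_k=\{(x_0,x_1): f_{k,0}(x_0)=f_{k,1}(x_1)\}$ is a perfect matching on $\mathcal X\times\mathcal X$; (3) there are densities $f'_{k,b}(x)$ on $\mathcal Y$ with $\mathrm{INV}_{\mathcal F}(t_k,b,y)=x_b$ and $\mathrm{INV}_{\mathcal F}(t_k,b\oplus1,y)=x_{b\oplus 1}$ for $(x_0,x_1)\in\mathcal R_k$, $y\in\mathrm{Supp}(f'_{k,b}(x_b))$; an efficient deterministic $\mathrm{CHK}_{\mathcal F}(k,b,x,y)$, which does not use $t_k$, outputs $1$ iff $x\in\mathcal X$ and $y\in\mathrm{Supp}(f'_{k,b}(x))$; $|\mathcal X|^{-1}\sum_{x\in\mathcal X} H^2(f_{k,b}(x),f'_{k,b}(x))$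 is at most a negligible function; and an efficient quantum procedure $\mathrm{SAMP}_{\mathcal F}$ on input $k,b$ prepares $|\mathcal X|^{-1/2}\sum_{x,y}\sqrt{f'_{k,b}(x)(y)}\,|x\rangle|y\rangle$; (4) for some length $w$ there are sets $G_{k,b,x}\subseteq\{0,1\}^w$ of density at least $1$ minus a negligible function, with membership efficiently decidable from $k,b,x,t_k$, and an efficiently computable injection $J:\mathcal X\to\{0,1\}^w$, efficiently invertible on its range, such that for every efficient quantum $\mathcal A$ the probabilities, over $(k,t_k)\leftarrow\mathrm{GEN}_{\mathcal F}$, of $\mathcal A(k)\in H_k$ and $\mathcal A(k)\in\overline H_k$ differ by at most a negligible function, where $H_k=\{(b,x_b,d,d\cdot(J(x_0)\oplus J(x_1))): (x_0,x_1)\in\mathcal R_k,\ d\in G_{k,0,x_0}\cap G_{k,1,x_1}\}$ and $\overline H_k=\{(b,x,d,c): (b,x,d,c\oplus1)\in H_k\}$. A *trapdoor injective family* $\mathcal G$ consists of a finite key set $\mathcal K_{\mathcal G}$ and densities $g_{k,b}(x)$ on $\mathcal Y$, with an efficient $\mathrm{GEN}_{\mathcal G}$ as in (1); with the supports of $g_{k,b}(x)$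 pairwise disjoint over all $(b,x)$ and an efficient deterministic $\mathrm{INV}_{\mathcal G}(t_k,y)=(b,x)$ for $y\in\mathrm{Supp}(g_{k,b}(x))$; and with efficient $\mathrm{CHK}_{\mathcal G}$, $\mathrm{SAMP}_{\mathcal G}$ as in (3), for $g$ in place of $f'$. An *extended trapdoor claw-free family* is a noisy trapdoor claw-free family $\mathcal F$ together with a trapdoor injective family $\mathcal G$ for the same $\mathcal X,\mathcal Y$ such that $\mathrm{CHK}_{\mathcal F}=\mathrm{CHK}_{\mathcal G}$ and $\mathrm{SAMP}_{\mathcal F}=\mathrm{SAMP}_{\mathcal G}$ (as algorithms on keys of either kind); for every efficient quantum $\mathcal A$, $\Pr[\mathcal A(k)=0]$ for $k\leftarrow\mathrm{GEN}_{\mathcal F}$ and for $k\leftarrow\mathrm{GEN}_{\mathcal G}$ differ by at most a negligible function; and for every efficient quantum $\mathcal A$ there are strings $d\in\{0,1\}^w$ such that $\big|\Pr_{k\leftarrow\mathrm{GEN}_{\mathcal F}}[\mathcal A(k)\in\{d\cdot(J(x_0)\oplus J(x_1)):(x_0,x_1)\in\mathcal R_k\}]-\frac12\big|$ is at most a negligible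 function. **Measurement protocol** for a basis choice $h\in\{0,1\}^n$. For each $i\le n$ the verifier independently samples $(k_i,t_{k_i})$ from $\mathrm{GEN}_{\mathcal G}$ if $h_i=0$ and from $\mathrm{GEN}_{\mathcal F}$ if $h_i=1$, and sends $(k_1,\dots,k_n)$ to the prover, who returns $y_1,\dots,y_n\in\mathcal Y$. In a *test round* the prover then answers with $b'_i\in\{0,1\}$ and a string $x'_i$ for each $i$; the verifier accepts iff $\mathrm{CHK}(k_i,b'_i,x'_i,y_i)=1$ for all $i$. In a *Hadamard round* the prover answers with $b'_i\in\{0,1\}$ and $d_i\in\{0,1\}^w$ for each $i$. If $h_i=0$, the verifier computes $(m_i,\cdot)=\mathrm{INV}_{\mathcal G}(t_{k_i},y_i)$ and stores $m_i$. If $h_i=1$, it computes $x_{b,i}=\mathrm{INV}_{\mathcal F}(t_{k_i},b,y_i)$ for $b=0,1$, checks that $d_i\in G_{k_i,0,x_{0,i}}\cap G_{k_i,1,x_{1,i}}$, and stores $m_i=b'_i\oplus d_i\cdot(J(x_{0,i})\oplus J(x_{1,i}))$. If an inversion or the check fails for some $i$, it stores a uniformly random bit $m_i$ for this $i$ and rejects.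 A prover is an efficient quantum machine: a commitment circuit, applied to the keys and ancillas in state $0$, followed by measurement of the $y_i$, followed by a circuit for the round in question and measurement of the answers. For a prover $\mathbb P$ and each $\lambda$ and $h$, let $1-p_{h,T}$ and $1-p_{h,H}$ be the probabilities that the verifier accepts in the test round and in the Hadamard round; let $D_{\mathbb P,h}$ be the distribution of $m\in\{0,1\}^n$ stored in the Hadamard round and $D^C_{\mathbb P,h}$ the same distribution conditioned on acceptance (if $p_{h,H}=1$ the bound below is void). A prover is *perfect* if it is accepted in the test round with probability $1$, for all $\lambda$ and $h$. **Claim.** Let an extended trapdoor claw-free family be given and let $\mathbb P$ be a prover in the measurement protocol. Fix a polynomial $q$ and a negligible function $\nu$. Then there exist a perfect (efficient) prover $\mathbb P'$ and a negligible function $\mu$ such that $$\mathrm{TV}\big(D^C_{\mathbb P,h},D_{\mathbb P',h}\big)\le p_{h,H}+\sqrt{p_{h,T}}+\mu(\lambda)$$ for all $\lambda$ and all $h\in\{0,1\}^{n(\lambda)}$ for which the test-round acceptance probability $1-p_{h,T}$ is either negligible, in the sense $1-p_{h,T}\le\nu(\lambda)$, or non-negligible, in the sense $q(\lambda)\,(1-p_{h,T})\ge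 1$. (In particular the bound holds for all $h$ if every $1-p_{h,T}$ is negligible or inverse-polynomially large in this sense.) -/

import Mathlib

open scoped BigOperators Classical

noncomputable section

namespace MeasurementProtocol

/-! ### Asymptotics, bit strings, densities -/

/-- Negligible: nonnegative, and `p(l) * μ(l) → 0` for every polynomial `p`. -/
def Negligible (μ : ℕ → ℝ) : Prop :=
  (∀ l, 0 ≤ μ l) ∧
    Asymptotics.SuperpolynomialDecay Filter.atTop (fun l : ℕ => (l : ℝ)) μ

/-- Bit strings of length `m`. -/
abbrev Bits (m : ℕ) : Type := Fin m → Bool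

/-- Inner product modulo 2. -/
def dot {m : ℕ} (d e : Bits m) : Bool :=
  decide (Odd (Finset.univ.filter fun i => d i = true ∧ e i = true).card)

/-- Bitwise exclusive or. -/
def bxor {m : ℕ} (d e : Bits m) : Bits m := fun i => xor (d i) (e i)

def IsDensity {α : Type} [Fintype α] (p : α → ℝ) : Prop :=
  (∀ a, 0 ≤ p a) ∧ ∑ a, p a = 1

def supp {α : Type} (p : α → ℝ) : Set α := {a | 0 < p a}

/-- Squared Hellinger distance. -/
def hellingerSq {α : Type} [Fintype α] (p q : α → ℝ) : ℝ := 1 - ∑ a, √(p a * q a)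

/-- Total variation distance. -/
def tv {α : Type} [Fintype α] (p q : α → ℝ) : ℝ := (1 / 2) * ∑ a, |p a - q a|

/-- Expectation of `φ` over a uniformly random element. -/
def avg {α : Type} [Fintype α] (φ : α → ℝ) : ℝ := (∑ a, φ a) / Fintype.card α

/-! ### Wires and gates -/

/-- A wire (qubit) is addressed by a register number, an index inside the register, and a bit
position. Only finitely many wires are touched by a circuit. -/
abbrev Wire : Type := ℕ × ℕ × ℕ

/-- Gates: NOT, CNOT, Toffoli, and the one-qubit gates of a gate alphabet `U 0, U 1, …`
(`u false j a` applies `U j` to wire `a`, and `u true j a` applies its inverse). -/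
inductive Gate : Type
  | not (a : Wire)
  | cnot (a b : Wire)
  | toffoli (a b c : Wire)
  | u (inv : Bool) (j : ℕ) (a : Wire)

/-- Replace each number occurring in a gate by its image under `f`. -/
def Gate.map (f : ℕ → ℕ) : Gate → Gate
  | .not a => .not (f a.1, f a.2.1, f a.2.2)
  | .cnot a b => .cnot (f a.1, f a.2.1, f a.2.2) (f b.1, f b.2.1, f b.2.2)
  | .toffoli a b c =>
      .toffoli (f a.1, f a.2.1, f a.2.2) (f b.1, f b.2.1, f b.2.2) (f c.1, f c.2.1, f c.2.2)
  | .u inv j a => .u inv (f j) (f a.1, f a.2.1, f a.2.2)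

def Gate.IsClassical : Gate → Prop
  | .u _ _ _ => False
  | _ => True

/-! ### Uniformity: a random access machine that issues gates, with a step count -/

/-- Programs of a random access machine with integer variables and integer arrays (both named by
natural numbers). The command `emit g` issues the gate obtained from `g` by reading each number
in `g` as the name of a variable and replacing it by the value of that variable. -/
inductive Program : Type
  /-- `x := c` -/
  | const (x c : ℕ)
  /-- `x := y + z` -/
  | plus (x y z : ℕ)
  /-- `x := y - z` (truncated) -/
  | minus (x y z : ℕ)
  /-- `x := a[y]` -/
  | load (x a y : ℕ)
  /-- `a[x] := y` -/
  | store (a x y : ℕ)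
  /-- issue a gate -/
  | emit (g : Gate)
  /-- sequential composition -/
  | seq (c d : Program)
  /-- `while x ≠ 0 do c` -/
  | loop (x : ℕ) (c : Program)

/-- Memory contents: variables and arrays. -/
structure Memory : Type where
  var : ℕ → ℕ
  arr : ℕ → ℕ → ℕ

def Memory.setVar (m : Memory) (x v : ℕ) : Memory := ⟨Function.update m.var x v, m.arr⟩

def Memory.setArr (m : Memory) (a i v : ℕ) : Memory :=
  ⟨m.var, Function.update m.arr a (Function.update (m.arr a) i v)⟩

/-- Initially variable `0` holds the security parameter and everything else is `0`. -/
def Memory.start (l : ℕ) : Memory := ⟨fun x => if x = 0 then l else 0, fun _ _ => 0⟩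

/-- `Exec c m gs t m'`: started in memory `m`, the program `c` halts after `t` steps in memory
`m'`, having issued the list of gates `gs`. -/
inductive Exec : Program → Memory → List Gate → ℕ → Memory → Prop
  | const (m : Memory) (x c : ℕ) : Exec (.const x c) m [] 1 (m.setVar x c)
  | plus (m : Memory) (x y z : ℕ) :
      Exec (.plus x y z) m [] 1 (m.setVar x (m.var y + m.var z))
  | minus (m : Memory) (x y z : ℕ) :
      Exec (.minus x y z) m [] 1 (m.setVar x (m.var y - m.var z))
  | load (m : Memory) (x a y : ℕ) :
      Exec (.load x a y) m [] 1 (m.setVar x (m.arr a (m.var y)))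
  | store (m : Memory) (a x y : ℕ) :
      Exec (.store a x y) m [] 1 (m.setArr a (m.var x) (m.var y))
  | emit (m : Memory) (g : Gate) : Exec (.emit g) m [g.map m.var] 1 m
  | seq {c d : Program} {m m₁ m₂ : Memory} {gs gs₁ : List Gate} {t t₁ : ℕ} :
      Exec c m gs t m₁ → Exec d m₁ gs₁ t₁ m₂ → Exec (.seq c d) m (gs ++ gs₁) (t + t₁) m₂
  | loop_done {x : ℕ} {c : Program} {m : Memory} :
      m.var x = 0 → Exec (.loop x c) m [] 1 m
  | loop_step {x : ℕ} {c : Program} {m m₁ m₂ : Memory} {gs gs₁ : List Gate} {t t₁ : ℕ} :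
      m.var x ≠ 0 → Exec c m gs t m₁ → Exec (.loop x c) m₁ gs₁ t₁ m₂ →
        Exec (.loop x c) m (gs ++ gs₁) (t + t₁ + 1) m₂

/-- The circuit family `C` is generated in polynomial time from the security parameter. -/
def PolyTimeCircuits (C : ℕ → List Gate) : Prop :=
  ∃ (c : Program) (p : Polynomial ℕ), ∀ l, ∃ t m,
    Exec c (Memory.start l) (C l) t m ∧ t ≤ p.eval l

/-- `n` is a polynomially bounded function of the security parameter that is computable in
polynomial time. -/
def PolyTimeNat (n : ℕ → ℕ) : Prop :=
  ∃ (c : Program) (p : Polynomial ℕ), ∀ l, ∃ gs t m,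
    Exec c (Memory.start l) gs t m ∧ t ≤ p.eval l ∧ m.var 0 = n l ∧ n l ≤ p.eval l

/-! ### Semantics of circuits -/

/-- A computational basis state: one bit for each wire. -/
abbrev Basis : Type := Wire → Bool

/-- (Possibly unnormalized) quantum states: finite superpositions of basis states. -/
abbrev State : Type := Basis →₀ ℂ

/-- A gate alphabet: a sequence of one-qubit unitaries, for example one that contains the Hadamard
gate and the phase gates. -/
abbrev Alphabet : Type := ℕ → Matrix.unitaryGroup Bool ℂ

/-- Action of the classical gates on basis states. A gate whose target is also one of its controls
does nothing. -/
def Gate.act : Gate → Basis → Basis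
  | .not a, z => Function.update z a (!z a)
  | .cnot a b, z => if a ≠ b then Function.update z b (xor (z b) (z a)) else z
  | .toffoli a b c, z =>
      if a ≠ c ∧ b ≠ c then Function.update z c (xor (z c) (z a && z b)) else z
  | .u _ _ _, z => z

/-- Action of a gate on a basis state. -/
def Gate.onBasis (U : Alphabet) : Gate → Basis → State
  | .u inv j a, z =>
      ∑ b : Bool, Finsupp.single (Function.update z a b)
        ((if inv then (U j)⁻¹ else U j : Matrix.unitaryGroup Bool ℂ).1 b (z a))
  | g, z => Finsupp.single (g.act z) 1

/-- Action of a gate on a state, by linearity. -/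
def Gate.apply (U : Alphabet) (g : Gate) : State →ₗ[ℂ] State :=
  Finsupp.linearCombination ℂ (g.onBasis U)

/-- Run a circuit on a quantum state. -/
def run (U : Alphabet) (C : List Gate) (ψ : State) : State :=
  C.foldl (fun φ g => g.apply U φ) ψ

/-- Run a classical circuit on a basis state. -/
def runClassical (C : List Gate) (z : Basis) : Basis := C.foldl (fun y g => g.act y) z

/-- The basis state `z` as a quantum state. -/
def ket (z : Basis) : State := Finsupp.single z 1

/-- Measure every wire of `ψ` in the standard basis and take the expectation of `φ` of the
result (for unnormalized `ψ`, weighted with the squared norm of `ψ`). -/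
def State.expect (ψ : State) (φ : Basis → ℝ) : ℝ := ψ.sum fun z c => ‖c‖ ^ 2 * φ z

/-- The probability that the result of that measurement satisfies `E`. -/
def State.prob (ψ : State) (E : Basis → Prop) : ℝ := ψ.expect fun z => if E z then 1 else 0

/-- The basis state in which the wires `(r, 0, 0), (r, 0, 1), …` hold the `r`-th of the given
strings, all other wires being `0`. -/
def inputs (rows : List (List Bool)) : Basis :=
  fun w => decide (w.2.1 = 0) && (rows.getD w.1 []).getD w.2.2 false

/-- The `m`-bit string in register `r` at index `i`. -/
def Basis.read (z : Basis) (r i m : ℕ) : Bits m := fun j => z (r, i, j)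

/-! ### Efficient procedures -/

/-- The map that sends the strings `inp l a` to the strings `out l a` is computed by an efficient
deterministic classical algorithm. The `r`-th output is read from the wires `(r, 1, ·)`. -/
def PolyTimeFun {ι : ℕ → Type} (inp out : ∀ l, ι l → List (List Bool)) : Prop :=
  ∃ C : ℕ → List Gate, PolyTimeCircuits C ∧ (∀ l, ∀ g ∈ C l, g.IsClassical) ∧
    ∀ l a r row, (out l a)[r]? = some row → ∀ (s : ℕ) (b : Bool), row[s]? = some b →
      runClassical (C l) (inputs (inp l a)) (r, 1, s) = b

/-- The final state of a quantum procedure, given by a family of circuits, on input `k`. Its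
outputs are read from the wires `(r, 1, ·)`. -/
def finalState (U : Alphabet) (A : ℕ → List Gate) (l : ℕ) {m : ℕ} (k : Bits m) : State :=
  run U (A l) (ket (inputs [List.ofFn k]))

/-! ### Trapdoor families -/

/-- The finite sets `X ⊆ {0,1}^xLen` and `Y = {0,1}^yLen`, and the key length. -/
structure Domain : Type where
  xLen : ℕ → ℕ
  yLen : ℕ → ℕ
  keyLen : ℕ → ℕ
  xLen_poly : PolyTimeNat xLen
  yLen_poly : PolyTimeNat yLen
  keyLen_poly : PolyTimeNat keyLen
  X : ∀ l, Finset (Bits (xLen l))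

/-- The state `|X|^(-1/2) ∑ x y, √(f x y) |k⟩|b⟩|x⟩|y⟩`. -/
def Domain.rangeState (S : Domain) (l : ℕ) (k : Bits (S.keyLen l)) (b : Bool)
    (f : Bits (S.xLen l) → Bits (S.yLen l) → ℝ) : State :=
  ∑ x ∈ S.X l, ∑ y : Bits (S.yLen l),
    Finsupp.single (inputs [List.ofFn k, [b], List.ofFn x, List.ofFn y])
      ((√(f x y) / √((S.X l).card : ℝ) : ℝ) : ℂ)

/-- Noisy trapdoor claw-free families. -/
structure NTCF (U : Alphabet) (S : Domain) : Type where
  /-- the key set -/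
  keys : ∀ l, Finset (Bits (S.keyLen l))
  f : ∀ l, Bits (S.keyLen l) → Bool → Bits (S.xLen l) → Bits (S.yLen l) → ℝ
  f_density : ∀ l, ∀ k ∈ keys l, ∀ b, ∀ x ∈ S.X l, IsDensity (f l k b x)
  /-- number of random coins of the key generation -/
  coins : ℕ → ℕ
  trapLen : ℕ → ℕ
  coins_poly : PolyTimeNat coins
  trapLen_poly : PolyTimeNat trapLen
  /-- key generation: a key and a trapdoor from random coins -/
  gen : ∀ l, Bits (coins l) → Bits (S.keyLen l) × Bits (trapLen l)
  gen_mem : ∀ l r, (gen l r).1 ∈ keys l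
  gen_poly : PolyTimeFun (fun _ r => [List.ofFn r])
    (fun l (r : Bits (coins l)) => [List.ofFn (gen l r).1, List.ofFn (gen l r).2])
  /-- trapdoor inversion; `none` means that no inverse was found -/
  inv : ∀ l, Bits (trapLen l) → Bool → Bits (S.yLen l) → Option (Bits (S.xLen l))
  inv_poly : PolyTimeFun
    (fun _ a => [List.ofFn a.1, [a.2.1], List.ofFn a.2.2])
    (fun l (a : Bits (trapLen l) × Bool × Bits (S.yLen l)) =>
      match inv l a.1 a.2.1 a.2.2 with
      | none => [[false]]
      | some x => [[true], List.ofFn x])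
  disjoint : ∀ l, ∀ k ∈ keys l, ∀ b, ∀ x ∈ S.X l, ∀ x' ∈ S.X l, x ≠ x' →
    supp (f l k b x) ∩ supp (f l k b x') = ∅
  inv_correct : ∀ l r b, ∀ x ∈ S.X l, ∀ y ∈ supp (f l (gen l r).1 b x),
    inv l (gen l r).2 b y = some x
  /-- the pairs `(x₀, x₁)` with `f k 0 x₀ = f k 1 x₁` form a perfect matching -/
  matching : ∀ l, ∀ k ∈ keys l,
    (∀ x₀ ∈ S.X l, ∃! x₁, x₁ ∈ S.X l ∧ f l k false x₀ = f l k true x₁) ∧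
    (∀ x₁ ∈ S.X l, ∃! x₀, x₀ ∈ S.X l ∧ f l k false x₀ = f l k true x₁)
  /-- the modified functions whose range superposition can be prepared -/
  fMod : ∀ l, Bits (S.keyLen l) → Bool → Bits (S.xLen l) → Bits (S.yLen l) → ℝ
  fMod_density : ∀ l, ∀ k ∈ keys l, ∀ b, ∀ x ∈ S.X l, IsDensity (fMod l k b x)
  inv_fMod : ∀ l r (b : Bool), ∀ x₀ ∈ S.X l, ∀ x₁ ∈ S.X l,
    f l (gen l r).1 false x₀ = f l (gen l r).1 true x₁ →
    ∀ y ∈ supp (fMod l (gen l r).1 b (if b then x₁ else x₀)),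
      inv l (gen l r).2 b y = some (if b then x₁ else x₀) ∧
      inv l (gen l r).2 (!b) y = some (if b then x₀ else x₁)
  /-- the check, which does not use the trapdoor -/
  chk : ∀ l, Bits (S.keyLen l) → Bool → Bits (S.xLen l) → Bits (S.yLen l) → Bool
  chk_poly : PolyTimeFun
    (fun _ a => [List.ofFn a.1, [a.2.1], List.ofFn a.2.2.1, List.ofFn a.2.2.2])
    (fun l (a : Bits (S.keyLen l) × Bool × Bits (S.xLen l) × Bits (S.yLen l)) =>
      [[chk l a.1 a.2.1 a.2.2.1 a.2.2.2]])
  chk_spec : ∀ l, ∀ k ∈ keys l, ∀ b x y,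
    chk l k b x y = true ↔ x ∈ S.X l ∧ y ∈ supp (fMod l k b x)
  hellinger : ∃ μ, Negligible μ ∧ ∀ l, ∀ k ∈ keys l, ∀ b,
    (∑ x ∈ S.X l, hellingerSq (f l k b x) (fMod l k b x)) / (S.X l).card ≤ μ l
  /-- preparation of the range superposition -/
  samp : ℕ → List Gate
  samp_poly : PolyTimeCircuits samp
  samp_spec : ∀ l, ∀ k ∈ keys l, ∀ b,
    run U (samp l) (ket (inputs [List.ofFn k, [b]])) = S.rangeState l k b (fMod l k b)
  w : ℕ → ℕ
  w_poly : PolyTimeNat w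
  /-- the sets of admissible strings `d` -/
  G : ∀ l, Bits (S.keyLen l) → Bool → Bits (S.xLen l) → Set (Bits (w l))
  G_dense : ∃ μ, Negligible μ ∧ ∀ l, ∀ k ∈ keys l, ∀ b, ∀ x ∈ S.X l,
    avg (fun d => if d ∈ G l k b x then (0 : ℝ) else 1) ≤ μ l
  /-- membership test for `G`, given the trapdoor -/
  gMem : ∀ l, Bits (S.keyLen l) → Bits (trapLen l) → Bool → Bits (S.xLen l) → Bits (w l) → Bool
  gMem_poly : PolyTimeFun
    (fun _ a => [List.ofFn a.1, List.ofFn a.2.1, [a.2.2.1], List.ofFn a.2.2.2.1,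
      List.ofFn a.2.2.2.2])
    (fun l (a : Bits (S.keyLen l) × Bits (trapLen l) × Bool × Bits (S.xLen l) × Bits (w l)) =>
      [[gMem l a.1 a.2.1 a.2.2.1 a.2.2.2.1 a.2.2.2.2]])
  gMem_spec : ∀ l r b, ∀ x ∈ S.X l, ∀ d,
    gMem l (gen l r).1 (gen l r).2 b x d = true ↔ d ∈ G l (gen l r).1 b x
  J : ∀ l, Bits (S.xLen l) → Bits (w l)
  J_inj : ∀ l, Set.InjOn (J l) (S.X l : Set (Bits (S.xLen l)))
  J_poly : PolyTimeFun (fun _ x => [List.ofFn x.1])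
    (fun l (x : {x : Bits (S.xLen l) // x ∈ S.X l}) => [List.ofFn (J l x.1)])
  J_inv_poly : PolyTimeFun (fun l x => [List.ofFn (J l x.1)])
    (fun l (x : {x : Bits (S.xLen l) // x ∈ S.X l}) => [List.ofFn x.1])
  /-- adaptive hardcore bit: an efficient quantum procedure that outputs `(b, x, d, c)` in the
  registers `0, 1, 2, 3` is (up to a negligible amount) as often right as wrong about `c` -/
  hardcore : ∀ A : ℕ → List Gate, PolyTimeCircuits A → ∃ μ, Negligible μ ∧ ∀ l,
    let inH : Bits (S.keyLen l) → Bool → Bits (S.xLen l) → Bits (w l) → Bool → Prop :=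
      fun k b x d c => ∃ x₀ ∈ S.X l, ∃ x₁ ∈ S.X l, f l k false x₀ = f l k true x₁ ∧
        x = (if b then x₁ else x₀) ∧ d ∈ G l k false x₀ ∧ d ∈ G l k true x₁ ∧
        c = dot d (bxor (J l x₀) (J l x₁))
    |avg (fun r => (finalState U A l (gen l r).1).prob fun z =>
        inH (gen l r).1 (z (0, 1, 0)) (z.read 1 1 _) (z.read 2 1 _) (z (3, 1, 0)))
      - avg (fun r => (finalState U A l (gen l r).1).prob fun z =>
        inH (gen l r).1 (z (0, 1, 0)) (z.read 1 1 _) (z.read 2 1 _) (!z (3, 1, 0)))| ≤ μ l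

/-- Trapdoor injective families. -/
structure TrapdoorInjective (U : Alphabet) (S : Domain) : Type where
  /-- the key set -/
  keys : ∀ l, Finset (Bits (S.keyLen l))
  g : ∀ l, Bits (S.keyLen l) → Bool → Bits (S.xLen l) → Bits (S.yLen l) → ℝ
  g_density : ∀ l, ∀ k ∈ keys l, ∀ b, ∀ x ∈ S.X l, IsDensity (g l k b x)
  coins : ℕ → ℕ
  trapLen : ℕ → ℕ
  coins_poly : PolyTimeNat coins
  trapLen_poly : PolyTimeNat trapLen
  gen : ∀ l, Bits (coins l) → Bits (S.keyLen l) × Bits (trapLen l)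
  gen_mem : ∀ l r, (gen l r).1 ∈ keys l
  gen_poly : PolyTimeFun (fun _ r => [List.ofFn r])
    (fun l (r : Bits (coins l)) => [List.ofFn (gen l r).1, List.ofFn (gen l r).2])
  inv : ∀ l, Bits (trapLen l) → Bits (S.yLen l) → Option (Bool × Bits (S.xLen l))
  inv_poly : PolyTimeFun
    (fun _ a => [List.ofFn a.1, List.ofFn a.2])
    (fun l (a : Bits (trapLen l) × Bits (S.yLen l)) =>
      match inv l a.1 a.2 with
      | none => [[false]]
      | some (b, x) => [[true], [b], List.ofFn x])
  disjoint : ∀ l, ∀ k ∈ keys l, ∀ (b b' : Bool), ∀ x ∈ S.X l, ∀ x' ∈ S.X l,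
    (b, x) ≠ (b', x') → supp (g l k b x) ∩ supp (g l k b' x') = ∅
  inv_correct : ∀ l r b, ∀ x ∈ S.X l, ∀ y ∈ supp (g l (gen l r).1 b x),
    inv l (gen l r).2 y = some (b, x)
  chk : ∀ l, Bits (S.keyLen l) → Bool → Bits (S.xLen l) → Bits (S.yLen l) → Bool
  chk_poly : PolyTimeFun
    (fun _ a => [List.ofFn a.1, [a.2.1], List.ofFn a.2.2.1, List.ofFn a.2.2.2])
    (fun l (a : Bits (S.keyLen l) × Bool × Bits (S.xLen l) × Bits (S.yLen l)) =>
      [[chk l a.1 a.2.1 a.2.2.1 a.2.2.2]])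
  chk_spec : ∀ l, ∀ k ∈ keys l, ∀ b x y,
    chk l k b x y = true ↔ x ∈ S.X l ∧ y ∈ supp (g l k b x)
  samp : ℕ → List Gate
  samp_poly : PolyTimeCircuits samp
  samp_spec : ∀ l, ∀ k ∈ keys l, ∀ b,
    run U (samp l) (ket (inputs [List.ofFn k, [b]])) = S.rangeState l k b (g l k b)

/-- Extended trapdoor claw-free families: a noisy trapdoor claw-free family `F`, made injective
invariant by the trapdoor injective family `G`, with the additional hardcore bit property. -/
structure ETCF (U : Alphabet) extends Domain where
  F : NTCF U toDomain
  G : TrapdoorInjective U toDomain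
  /-- the two families use the same algorithms for the check and for the range superposition -/
  chk_eq : F.chk = G.chk
  samp_eq : F.samp = G.samp
  /-- keys of the two families are computationally indistinguishable -/
  invariance : ∀ A : ℕ → List Gate, PolyTimeCircuits A → ∃ μ, Negligible μ ∧ ∀ l,
    |avg (fun r => (finalState U A l (F.gen l r).1).prob fun z => z (0, 1, 0) = false)
      - avg (fun r => (finalState U A l (G.gen l r).1).prob fun z => z (0, 1, 0) = false)| ≤ μ l
  /-- hardcore bit for a fixed string `d` -/
  hardcore_fixed : ∀ A : ℕ → List Gate, PolyTimeCircuits A →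
    ∃ μ, Negligible μ ∧ ∃ d : ∀ l, Bits (F.w l), ∀ l,
    |avg (fun r => (finalState U A l (F.gen l r).1).prob fun z =>
        ∃ x₀ ∈ X l, ∃ x₁ ∈ X l,
          F.f l (F.gen l r).1 false x₀ = F.f l (F.gen l r).1 true x₁ ∧
          z (0, 1, 0) = dot (d l) (bxor (F.J l x₀) (F.J l x₁))) - 1 / 2| ≤ μ l

/-! ### The measurement protocol -/

/-- Efficient (BQP) provers. The keys `k₁, …, kₙ` arrive on the wires `(0, i, ·)`. After the
circuit `commit` the commitment strings `yᵢ` are measured on the wires `(1, i, ·)` and sent. Then,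
in a test round (respectively a Hadamard round) the prover runs the circuit `test` (respectively
`hadamard`) and the answers are measured on the wires `(2, i, 0)` (the bits `b'ᵢ`) and
`(3, i, ·)` (the strings `x'ᵢ`, respectively `dᵢ`). All wires not holding the keys start in `0`. -/
structure Prover : Type where
  commit : ℕ → List Gate
  test : ℕ → List Gate
  hadamard : ℕ → List Gate
  commit_poly : PolyTimeCircuits commit
  test_poly : PolyTimeCircuits test
  hadamard_poly : PolyTimeCircuits hadamard

/-- The prover receives the keys `k`. -/
def receive {n m : ℕ} (k : Fin n → Bits m) : Basis := fun w =>
  decide (w.1 = 0) &&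
    (if hi : w.2.1 < n then (if hj : w.2.2 < m then k ⟨w.2.1, hi⟩ ⟨w.2.2, hj⟩ else false)
      else false)

/-- The (unnormalized) state of the prover after having received the keys `k` and having reported
the commitment strings `y`; its squared norm is the probability of reporting `y`. -/
def Prover.committed (P : Prover) (U : Alphabet) (l : ℕ) {n m m' : ℕ} (k : Fin n → Bits m)
    (y : Fin n → Bits m') : State :=
  (run U (P.commit l) (ket (receive k))).filter fun z => ∀ i : Fin n, z.read 1 i m' = y i

namespace ETCF

variable {U : Alphabet} (E : ETCF U)

/-- Random coins of the verifier for the generation of `n` keys (of either kind). -/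
abbrev Coins (l n : ℕ) : Type := (Fin n → Bits (E.F.coins l)) × (Fin n → Bits (E.G.coins l))

/-- The function choice for the basis choice `h`: a key of the trapdoor injective family for a
standard basis index (`h i = false`), and of the claw-free family for a Hadamard basis index. -/
def key {l n : ℕ} (h : Bits n) (r : E.Coins l n) (i : Fin n) : Bits (E.keyLen l) :=
  if h i then (E.F.gen l (r.1 i)).1 else (E.G.gen l (r.2 i)).1

/-- Verifier's check of index `i` in a test round. -/
def testOk {l n : ℕ} (h : Bits n) (r : E.Coins l n) (y : Fin n → Bits (E.yLen l))
    (z : Basis) (i : Fin n) : Prop :=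
  (if h i then E.F.chk l (E.key h r i) (z (2, i, 0)) (z.read 3 i _) (y i)
    else E.G.chk l (E.key h r i) (z (2, i, 0)) (z.read 3 i _) (y i)) = true

/-- Verifier's decoding of index `i` in a Hadamard round; `none` means that the verifier rejects
and stores a random bit. -/
def decode {l n : ℕ} (h : Bits n) (r : E.Coins l n) (y : Fin n → Bits (E.yLen l))
    (z : Basis) (i : Fin n) : Option Bool :=
  if h i then
    let k := (E.F.gen l (r.1 i)).1
    let t := (E.F.gen l (r.1 i)).2
    let d : Bits (E.F.w l) := z.read 3 i _
    match E.F.inv l t false (y i), E.F.inv l t true (y i) with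
    | some x₀, some x₁ =>
        if E.F.gMem l k t false x₀ d = true ∧ E.F.gMem l k t true x₁ d = true then
          some (xor (z (2, i, 0)) (dot d (bxor (E.F.J l x₀) (E.F.J l x₁))))
        else none
    | _, _ => none
  else
    (E.G.inv l (E.G.gen l (r.2 i)).2 (y i)).map Prod.fst

variable (P : Prover)

/-- Probability that the verifier accepts in the test round, for basis choice `h`. -/
def testAccept {n : ℕ} (l : ℕ) (h : Bits n) : ℝ :=
  avg fun r : E.Coins l n => ∑ y : Fin n → Bits (E.yLen l),
    (run U (P.test l) (P.committed U l (E.key h r) y)).prob fun z => ∀ i, E.testOk h r y z i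

/-- Expectation, in a Hadamard round for basis choice `h`, of a function `φ` of the results
decoded by the verifier. -/
def hadamardExpect {n : ℕ} (l : ℕ) (h : Bits n) (φ : (Fin n → Option Bool) → ℝ) : ℝ :=
  avg fun r : E.Coins l n => ∑ y : Fin n → Bits (E.yLen l),
    (run U (P.hadamard l) (P.committed U l (E.key h r) y)).expect fun z => φ (E.decode h r y z)

/-- Probability that the verifier accepts in the Hadamard round, for basis choice `h`. -/
def hadamardAccept {n : ℕ} (l : ℕ) (h : Bits n) : ℝ :=
  E.hadamardExpect P l h fun o => if ∀ i, o i ≠ none then 1 else 0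

/-- The distribution of the measurement results stored by the verifier in the Hadamard round. -/
def dist {n : ℕ} (l : ℕ) (h : Bits n) (m : Bits n) : ℝ :=
  E.hadamardExpect P l h fun o =>
    ∏ i, if o i = none then (1 / 2 : ℝ) else if o i = some (m i) then 1 else 0

/-- The same distribution, conditioned on acceptance. -/
def distCond {n : ℕ} (l : ℕ) (h : Bits n) (m : Bits n) : ℝ :=
  (E.hadamardExpect P l h fun o => if ∀ i, o i = some (m i) then 1 else 0) /
    E.hadamardAccept P l h

/-- Perfect provers (for the protocol on `n` qubits): always accepted in the test round. -/
def Perfect (n : ℕ → ℕ) : Prop := ∀ l (h : Bits (n l)), E.testAccept P l h = 1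

end ETCF

end MeasurementProtocol

end

noncomputable section

namespace MeasurementProtocol

/-! The test needs no trapdoor, and since the two families share one check it does not need `h`
either, so a prover can test itself and gain perfection by repetition. On the received keys, `R`
independent blocks each run the commitment and the test of `P` coherently, keep copies of keys and
commitments, and write on a flag whether all answers pass. The commitments of the first flagged
block are reported. If no flag is on, the commitments come from range superpositions prepared by the
sampler with `b = 0`, and these always pass. In a test round the recorded answers are given. In a
Hadamard round every block undoes its test and runs the Hadamard circuit of `P`, and the selected
block supplies the answers. The result is `newProver`; `perfect_newProver` shows that it is perfect.

Fix the keys and let `a` be the probability that `P` passes. Let `E` be the outcome distribution, of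
total mass `a`, of passing the test, undoing it and playing the Hadamard round. Block `c` is the
first to succeed after `c` independent failures, so the new distribution dominates `∑ c < R, (1 - a)
^ c` times `E` (`le_expect_newHadamard`). Passing the test projects the state, so the undone state
has inner product `a` with the committed state; by Cauchy–Schwarz, `E / a` is within `√(1 - a)` of
the distribution of `P` (`sum_abs_keyExpect_sub_le`). Only mass `(1 - a) ^ R` is left uncontrolled,
and the distance for these keys is at most `√(1 - a) + (1 - a) ^ R * (1 - √(1 - a))`
(`tv_le_of_mixture`).

It remains to average over the keys; let `A` be the mean of `a`. Concavity gives `√(1 - A)` for the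
first term. The second is exponentially small when `a ≥ A / 4`, but for smaller `a` it is only known
to be at most `1 / R`, which is not negligible. For such keys, however, the concavity inequality is
strict with a gap of order `A ^ 2`, and a polynomial `R` makes `1 / R` smaller than that gap
(`sqrt_add_le`, `avg_sqrt_add_le`). When `A` is negligible, `√(1 - A)` is already almost `1` and
nothing is to be shown. Conditioning on acceptance in the Hadamard round costs the rejection
probability (`tv_distCond_le`).

Much of the file shows that the new circuits are uniformly generated. Inverting or interleaving a
circuit requires storing the gates issued by an arbitrary program in memory and replaying them; the
remaining classical parts are nested loops over gate templates. -/

/-! ### Relabelled and inverted circuits -/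

/-- Move the gate to the wires given by `f`. -/
def Gate.relabel (f : Wire → Wire) : Gate → Gate
  | .not a => .not (f a)
  | .cnot a b => .cnot (f a) (f b)
  | .toffoli a b c => .toffoli (f a) (f b) (f c)
  | .u inv j a => .u inv j (f a)

/-- The inverse gate. -/
def Gate.dagger : Gate → Gate
  | .u inv j a => .u (!inv) j a
  | g => g

/-- The inverse circuit. -/
def dagger (C : List Gate) : List Gate := (C.map Gate.dagger).reverse

/-- The circuit moved to the wires given by `f`. -/
def relabel (f : Wire → Wire) (C : List Gate) : List Gate := C.map (Gate.relabel f)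

/-- Position of a wire in the `c`-th of `M` interleaved copies of a circuit. -/
def place (a b M c : ℕ) (w : Wire) : Wire := (w.1 * a + b, w.2.1 * M + c, w.2.2)

/-! ### Renaming the memory of a program -/

/-- Rename variables and arrays by `f` and replace each `emit g` by `h g`. -/
def Program.subst (f : ℕ → ℕ) (h : Gate → Program) : Program → Program
  | .const x c => .const (f x) c
  | .plus x y z => .plus (f x) (f y) (f z)
  | .minus x y z => .minus (f x) (f y) (f z)
  | .load x a y => .load (f x) (f a) (f y)
  | .store a x y => .store (f a) (f x) (f y)
  | .emit g => h g
  | .seq c d => .seq (c.subst f h) (d.subst f h)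
  | .loop x c => .loop (f x) (c.subst f h)

/-- The part of the memory addressed by names of the form `f x`. -/
def Memory.pull (f : ℕ → ℕ) (m : Memory) : Memory := ⟨fun x => m.var (f x), fun a => m.arr (f a)⟩

/-- `m'` agrees with `m` on the variables and arrays with names satisfying `p`. -/
def Memory.AgreeOn (p : ℕ → Prop) (m m' : Memory) : Prop :=
  ∀ x, p x → m'.var x = m.var x ∧ m'.arr x = m.arr x

theorem Memory.pull_setVar {f : ℕ → ℕ} (hf : Function.Injective f) (m : Memory) (x v : ℕ) :
    (m.setVar (f x) v).pull f = (m.pull f).setVar x v := by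
  simp only [Memory.pull, Memory.setVar, Memory.mk.injEq, and_true]
  funext y
  by_cases h : y = x
  · simp [h]
  · simp [h, hf.eq_iff]

theorem Memory.pull_setArr {f : ℕ → ℕ} (hf : Function.Injective f) (m : Memory) (a i v : ℕ) :
    (m.setArr (f a) i v).pull f = (m.pull f).setArr a i v := by
  simp only [Memory.pull, Memory.setArr, Memory.mk.injEq, true_and]
  funext y
  by_cases h : y = a
  · subst h; simp
  · simp [h, hf.eq_iff]

theorem Memory.agreeOn_setVar {p : ℕ → Prop} (m : Memory) {x v : ℕ} (hx : ¬ p x) :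
    Memory.AgreeOn p m (m.setVar x v) := by
  intro y hy
  have : y ≠ x := fun h => hx (h ▸ hy)
  simp [Memory.setVar, this]

theorem Memory.agreeOn_setArr {p : ℕ → Prop} (m : Memory) {a i v : ℕ} (hx : ¬ p a) :
    Memory.AgreeOn p m (m.setArr a i v) := by
  intro y hy
  have : y ≠ a := fun h => hx (h ▸ hy)
  simp [Memory.setArr, this]

/-- Simulation inside the region of names `f x`. The invariant `I` sees the gates issued so far and
must be blind to changes inside the region, while the handlers `h g` must leave the region
unchanged. Recording gates, suppressing them and re-issuing them are all instances. -/
theorem Exec.subst {f : ℕ → ℕ} (hf : Function.Injective f) (h : Gate → Program)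
    (out : Gate → List Gate) (I : List Gate → Memory → Prop) (B : ℕ)
    (hI : ∀ gs m m', Memory.AgreeOn (fun x => x ∉ Set.range f) m m' → I gs m → I gs m')
    (hh : ∀ g m gs, I gs m → ∃ t m', Exec (h g) m (out (g.map (m.pull f).var)) t m' ∧ t ≤ B ∧
      m'.pull f = m.pull f ∧ I (gs ++ [g.map (m.pull f).var]) m')
    {c : Program} {m₀ m₁ : Memory} {gs : List Gate} {t : ℕ} (e : Exec c m₀ gs t m₁) :
    ∀ m prev, m.pull f = m₀ → I prev m → ∃ t' m', Exec (c.subst f h) m (gs.flatMap out) t' m' ∧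
      t' ≤ (B + 1) * t ∧ m'.pull f = m₁ ∧ I (prev ++ gs) m' := by
  have nr : ∀ x, ¬ (f x ∉ Set.range f) := fun x hx => hx ⟨x, rfl⟩
  induction e with
  | const m₀ x c =>
    rintro m prev rfl hi
    refine ⟨1, _, .const _ _ _, by omega, m.pull_setVar hf _ _, ?_⟩
    simpa using hI _ _ _ (m.agreeOn_setVar (nr x)) hi
  | plus m₀ x y z =>
    rintro m prev rfl hi
    refine ⟨1, _, .plus _ _ _ _, by omega, m.pull_setVar hf _ _, ?_⟩
    simpa using hI _ _ _ (m.agreeOn_setVar (nr x)) hi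
  | minus m₀ x y z =>
    rintro m prev rfl hi
    refine ⟨1, _, .minus _ _ _ _, by omega, m.pull_setVar hf _ _, ?_⟩
    simpa using hI _ _ _ (m.agreeOn_setVar (nr x)) hi
  | load m₀ x y z =>
    rintro m prev rfl hi
    refine ⟨1, _, .load _ _ _ _, by omega, m.pull_setVar hf _ _, ?_⟩
    simpa using hI _ _ _ (m.agreeOn_setVar (nr x)) hi
  | store m₀ x y z =>
    rintro m prev rfl hi
    refine ⟨1, _, .store _ _ _ _, by omega, m.pull_setArr hf _ _ _, ?_⟩
    simpa using hI _ _ _ (m.agreeOn_setArr (nr x)) hi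
  | emit m₀ g =>
    rintro m prev rfl hi
    obtain ⟨t, m', e, ht, hp, hi'⟩ := hh g m prev hi
    exact ⟨t, m', by simpa [Program.subst] using e, by omega, hp, hi'⟩
  | seq _ _ ih₁ ih₂ =>
    rintro m prev rfl hi
    obtain ⟨t₁, m₁, e₁, h₁, p₁, i₁⟩ := ih₁ m prev rfl hi
    obtain ⟨t₂, m₂, e₂, h₂, p₂, i₂⟩ := ih₂ m₁ _ p₁ i₁
    refine ⟨_, m₂, by simpa [Program.subst] using Exec.seq e₁ e₂, ?_, p₂, by simpa using i₂⟩
    rw [Nat.mul_add]; omega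
  | loop_done h0 =>
    rintro m prev rfl hi
    exact ⟨1, m, .loop_done h0, by omega, rfl, by simpa using hi⟩
  | loop_step h0 _ _ ih₁ ih₂ =>
    rintro m prev rfl hi
    obtain ⟨t₁, m₁, e₁, h₁, p₁, i₁⟩ := ih₁ m prev rfl hi
    obtain ⟨t₂, m₂, e₂, h₂, p₂, i₂⟩ := ih₂ m₁ _ p₁ i₁
    refine ⟨_, m₂, by
      simpa only [Program.subst, List.flatMap_append] using
        Exec.loop_step (x := f _) (m := m) h0 e₁ e₂, ?_, p₂, by simpa using i₂⟩
    rw [Nat.mul_add, Nat.mul_add]; omega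

/-- Bounds the length of a stored circuit by a polynomial, hence the number of rounds when it is
replayed. -/
theorem Exec.length_le {c : Program} {m m' : Memory} {gs : List Gate} {t : ℕ}
    (e : Exec c m gs t m') : gs.length ≤ t := by
  induction e with
  | seq => simp; omega
  | loop_step => simp; omega
  | _ => simp

/-- A loop whose counter `x` is decreased by one in each round. -/
theorem Exec.count_loop {c : Program} {x N T : ℕ} (Inv : ℕ → Memory → Prop) (G : ℕ → List Gate)
    (hx : ∀ i m, i ≤ N → Inv i m → m.var x = N - i)
    (hc : ∀ i m, i < N → Inv i m → ∃ t m', Exec c m (G i) t m' ∧ t ≤ T ∧ Inv (i + 1) m')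
    (m : Memory) (hm : Inv 0 m) :
    ∃ t m', Exec (.loop x c) m ((List.range N).flatMap G) t m' ∧ t ≤ N * (T + 1) + 1 ∧
      Inv N m' := by
  have key : ∀ j i m, i + j = N → Inv i m →
      ∃ t m', Exec (.loop x c) m ((List.range' i j).flatMap G) t m' ∧ t ≤ j * (T + 1) + 1 ∧
        Inv N m' := by
    intro j
    induction j with
    | zero =>
      intro i m hi hm
      exact ⟨1, m, .loop_done (by rw [hx i m (by omega) hm]; omega), by omega,
        by simpa [← hi] using hm⟩
    | succ j ih =>
      intro i m hi hm
      obtain ⟨t₁, m₁, e₁, h₁, i₁⟩ := hc i m (by omega) hm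
      obtain ⟨t₂, m₂, e₂, h₂, i₂⟩ := ih (i + 1) m₁ (by omega) i₁
      refine ⟨_, m₂, by
        simpa only [List.range'_succ, List.flatMap_cons] using
          Exec.loop_step (by rw [hx i m (by omega) hm]; omega) e₁ e₂, ?_, i₂⟩
      rw [Nat.succ_mul]; omega
  rw [List.range_eq_range']
  exact key N 0 m (by omega) hm

/-! ### Loading numbers and circuits into a region of the memory

Memory names are divided into eight regions modulo `8`. -/

/-- The `s`-th region is all zero. -/
def Memory.Clean (s : ℕ) (m : Memory) : Prop := ∀ x, m.var (8 * x + s) = 0 ∧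
  m.arr (8 * x + s) = fun _ => 0

theorem region_injective (s : ℕ) : Function.Injective fun x : ℕ => 8 * x + s := by
  intro x y h; simp at h; omega

theorem notMem_region {s x : ℕ} (hs : s < 8) (hx : x % 8 ≠ s) :
    x ∉ Set.range (fun x : ℕ => 8 * x + s) := by
  rintro ⟨y, rfl⟩
  simp at hx
  omega

theorem flatMap_nil_const {α β : Type*} (L : List α) : L.flatMap (fun _ => ([] : List β)) = [] :=
  List.flatMap_eq_nil_iff.2 fun _ _ => rfl

/-- Copy the security parameter to the input variable of a region. -/
theorem Memory.pull_input {s l : ℕ} {m : Memory} (h0 : m.var 0 = l)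
    (hc : m.Clean s) :
    (m.setVar s (m.var 0 + m.var (8 + s))).pull (fun x => 8 * x + s) = Memory.start l := by
  have h8 := (hc 1).1
  simp only [mul_one] at h8
  simp only [Memory.pull, Memory.setVar, Memory.start, Memory.mk.injEq]
  constructor
  · funext x
    by_cases hx : x = 0
    · simp [hx, h0, h8]
    · simp [hx, (hc x).1]
  · funext x; exact (hc x).2

/-- The program part computes `N l` into variable `s`, using region `s` only. -/
def LoadsNat (c : Program) (s : ℕ) (N : ℕ → ℕ) (p : Polynomial ℕ) : Prop :=
  ∀ l m, m.var 0 = l → m.var 7 = 0 → m.Clean s → ∃ t m', Exec c m [] t m' ∧ t ≤ p.eval l ∧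
    m'.var s = N l ∧ Memory.AgreeOn (fun x => x % 8 ≠ s) m m'

/-- A program computing a number may also issue gates; these are suppressed by replacing each
emission with an assignment of `0` to variable `7`, which lies outside the region and already holds
`0`. -/
theorem PolyTimeNat.loads {N : ℕ → ℕ} (hN : PolyTimeNat N) {s : ℕ} (hs : s < 7) :
    ∃ c p, LoadsNat c s N p := by
  obtain ⟨c, p, hc⟩ := hN
  refine ⟨.seq (.plus s 0 (8 + s)) (c.subst (fun x => 8 * x + s) fun _ => .const 7 0),
    2 * p + 1, ?_⟩
  intro l m hl h7 hcl
  obtain ⟨gs, t, m₁, e, ht, hv, -⟩ := hc l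
  obtain ⟨t', m', e', ht', hp', hi'⟩ := e.subst (region_injective s) (fun _ => .const 7 0)
    (fun _ => []) (fun _ m' => Memory.AgreeOn (fun x => x % 8 ≠ s) m m') 1
    (by
      intro _ m₁ m₂ h12 h1 x hx
      have := h12 x (notMem_region (by omega) hx)
      rw [this.1, this.2]; exact h1 x hx)
    (by
      intro g m₁ gs hi
      refine ⟨1, _, .const _ _ _, le_rfl, ?_, ?_⟩
      all_goals
        have : m₁.setVar 7 0 = m₁ := by
          have : m₁.var 7 = 0 := by rw [(hi 7 (by omega)).1, h7]
          simp only [Memory.setVar]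
          rw [← this, Function.update_eq_self]
        rw [this]
      exact hi)
    (m.setVar s (m.var 0 + m.var (8 + s))) [] (Memory.pull_input hl hcl)
    (m.agreeOn_setVar (by simp; omega))
  refine ⟨_, m', by
    simpa [flatMap_nil_const] using Exec.seq (.plus _ _ _ _) e', ?_, ?_, hi'⟩
  · simp; omega
  · rw [← hv, ← hp']; simp [Memory.pull]

theorem Memory.AgreeOn.trans {p p' : ℕ → Prop} {m m' m'' : Memory} (h : m.AgreeOn p m')
    (h' : m'.AgreeOn p' m'') : m.AgreeOn (fun x => p x ∧ p' x) m'' := by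
  intro x hx
  rw [(h' x hx.2).1, (h' x hx.2).2]
  exact h x hx.1

theorem Memory.AgreeOn.mono {p p' : ℕ → Prop} {m m' : Memory} (h : m.AgreeOn p m')
    (hp : ∀ x, p' x → p x) : m.AgreeOn p' m' := fun x hx => h x (hp x hx)

theorem Memory.AgreeOn.clean {p : ℕ → Prop} {m m' : Memory} {s : ℕ} (h : m.AgreeOn p m')
    (hc : m.Clean s) (hp : ∀ x, p (8 * x + s)) : m'.Clean s := by
  intro x
  rw [(h _ (hp x)).1, (h _ (hp x)).2]
  exact hc x

theorem Memory.start_clean {l s : ℕ} (h0 : s ≠ 0) : (Memory.start l).Clean s := by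
  intro x
  simp [Memory.start, h0]

/-! ### Gates as lists of numbers -/

/-- A gate as a list of numbers: its kind in unary, wires, and place in the alphabet. The numbers
`0`, `1` are represented by `z`, `o`, and other numbers are mapped by `e`. -/
def Gate.code (z o : ℕ) (e : ℕ → ℕ) : Gate → List ℕ
  | .not a => [o, z, z, z, z, e a.1, e a.2.1, e a.2.2, z, z, z, z, z, z, z]
  | .cnot a b => [z, o, z, z, z, e a.1, e a.2.1, e a.2.2, e b.1, e b.2.1, e b.2.2, z, z, z, z]
  | .toffoli a b c => [z, z, o, z, z, e a.1, e a.2.1, e a.2.2, e b.1, e b.2.1, e b.2.2,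
      e c.1, e c.2.1, e c.2.2, z]
  | .u false j a => [z, z, z, o, z, e a.1, e a.2.1, e a.2.2, z, z, z, z, z, z, e j]
  | .u true j a => [z, z, z, z, o, e a.1, e a.2.1, e a.2.2, z, z, z, z, z, z, e j]

theorem Gate.code_length (z o : ℕ) (e : ℕ → ℕ) (g : Gate) : (g.code z o e).length = 15 := by
  rcases g with _ | _ | _ | ⟨_ | _, _, _⟩ <;> rfl

theorem Gate.map_code (f : ℕ → ℕ) (z o : ℕ) (e : ℕ → ℕ) (g : Gate) :
    (g.code z o e).map f = g.code (f z) (f o) (f ∘ e) := by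
  rcases g with _ | _ | _ | ⟨_ | _, _, _⟩ <;> rfl

theorem Gate.code_map (f : ℕ → ℕ) (z o : ℕ) (e : ℕ → ℕ) (g : Gate) :
    (g.map f).code z o e = g.code z o (e ∘ f) := by
  rcases g with _ | _ | _ | ⟨_ | _, _, _⟩ <;> rfl

/-- Store the values of the variables in `L` at place `pos` of the arrays `8 * k, 8 * (k + 1), …`. -/
def storeAll (pos : ℕ) : ℕ → List ℕ → Program
  | _, [] => .const 7 0
  | k, v :: L => .seq (.store (8 * k) pos v) (storeAll pos (k + 1) L)

/-- Throughout, variable `7` holds `0`, so that assigning `0` to it serves as the empty program. -/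
theorem exec_storeAll (pos : ℕ) (L : List ℕ) : ∀ (k : ℕ) (m : Memory), m.var 7 = 0 →
    ∃ m', Exec (storeAll pos k L) m [] (L.length + 1) m' ∧ m'.var = m.var ∧
      (∀ i v, L[i]? = some v → m'.arr (8 * (k + i)) =
        Function.update (m.arr (8 * (k + i))) (m.var pos) (m.var v)) ∧
      ∀ a, (∀ i < L.length, a ≠ 8 * (k + i)) → m'.arr a = m.arr a := by
  induction L with
  | nil =>
    intro k m h7
    refine ⟨m, ?_, rfl, by simp, by simp⟩
    have : m.setVar 7 0 = m := by
      simp only [Memory.setVar]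
      rw [← h7, Function.update_eq_self]
    simpa [this, storeAll] using Exec.const m 7 0
  | cons v L ih =>
    intro k m h7
    obtain ⟨m', e, hv, ha, hb⟩ := ih (k + 1) (m.setArr (8 * k) (m.var pos) (m.var v)) h7
    refine ⟨m', ?_, hv, ?_, ?_⟩
    · have := Exec.seq (.store m (8 * k) pos v) e
      rw [add_comm 1] at this
      simpa [storeAll] using this
    · rintro (_ | i) x h
      · rw [hb _ (by intros; omega)]
        simp at h
        simp [Memory.setArr, h]
      · have := ha i x (by simpa using h)
        rw [show k + 1 + i = k + (i + 1) by ring] at this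
        rw [this]
        have : 8 * (k + (i + 1)) ≠ 8 * k := by omega
        simp [Memory.setArr]
    · intro a h
      rw [hb a (fun i hi => by
        have := h (i + 1) (by simpa using hi); rwa [show k + 1 + i = k + (i + 1) by ring])]
      have := h 0 (by simp)
      simp at this
      simp [Memory.setArr, this]

/-- The circuit `gs` is stored in the arrays `0, 8, …, 112`. -/
def Memory.Holds (gs : List Gate) (m : Memory) : Prop :=
  ∀ j g, gs[j]? = some g → ∀ i v, (g.code 0 1 id)[i]? = some v → m.arr (8 * i) j = v

/-- The program part stores the circuit `C l`, and its length in variable `8`. -/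
def LoadsCircuit (c : Program) (C : ℕ → List Gate) (p : Polynomial ℕ) : Prop :=
  ∀ l m, m.var 0 = l → m.var 7 = 0 → m.Clean 4 → m.var 8 = 0 → ∃ t m', Exec c m [] t m' ∧
    t ≤ p.eval l ∧ m'.Holds (C l) ∧ m'.var 8 = (C l).length ∧ (C l).length ≤ p.eval l ∧
    Memory.AgreeOn (fun x => x % 8 ≠ 4 ∧ x % 8 ≠ 0) m m' ∧ m'.var 0 = l

/-- The generator of `C` runs in region `4`, and every emission is replaced by writing the code of
the gate at the next free place. The invariant passed to `Exec.subst` says that the gates issued so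
far are stored. -/
theorem PolyTimeCircuits.loads {C : ℕ → List Gate} (hC : PolyTimeCircuits C) :
    ∃ c p, LoadsCircuit c C p := by
  obtain ⟨c, p, hc⟩ := hC
  let hnd : Gate → Program := fun g =>
    .seq (storeAll 8 0 (g.code 7 16 fun x => 8 * x + 4)) (.plus 8 8 16)
  refine ⟨.seq (.const 16 1) (.seq (.plus 4 0 (8 + 4)) (c.subst (fun x => 8 * x + 4) hnd)),
    -- Storing one gate takes sixteen steps (fifteen numbers and the empty program) and one
    -- increment, so the simulation factor is `17 + 1`; two steps prepare the memory.
    18 * p + 2, ?_⟩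
  intro l m hl h7 hcl h8
  obtain ⟨t, m₁, e, ht⟩ := hc l
  have hcl' : (m.setVar 16 1).Clean 4 := by
    refine (m.agreeOn_setVar (p := fun x => x % 8 = 4) (by simp)).clean hcl (by omega)
  obtain ⟨t', m', e', ht', hp', hi'⟩ := e.subst (region_injective 4) hnd
    (fun _ => []) (fun gs m' => Memory.AgreeOn (fun x => x % 8 ≠ 4 ∧ x % 8 ≠ 0) m m' ∧
      m'.Holds gs ∧ m'.var 8 = gs.length ∧ m'.var 0 = l ∧ m'.var 16 = 1) 17
    (by
      intro gs m₁ m₂ h12 h1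
      refine ⟨?_, ?_, ?_, ?_, ?_⟩
      · intro x hx
        have := h12 x (notMem_region (by omega) (by omega))
        rw [this.1, this.2]; exact h1.1 x hx
      · intro j g hj i v hi
        rw [(h12 (8 * i) (notMem_region (by omega) (by omega))).2]
        exact h1.2.1 j g hj i v hi
      all_goals
        rw [(h12 _ (notMem_region (by omega) (by omega))).1]
      exacts [h1.2.2.1, h1.2.2.2.1, h1.2.2.2.2])
    (by
      rintro g m₁ gs ⟨ha, hh, hv8, hv0, hv16⟩
      have h7' : m₁.var 7 = 0 := by rw [(ha 7 (by omega)).1, h7]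
      obtain ⟨m₂, e₂, hv, hs, ho⟩ :=
        exec_storeAll 8 (g.code 7 16 fun x => 8 * x + 4) 0 m₁ h7'
      simp only [Gate.code_length, zero_add] at e₂ hs ho
      refine ⟨_, _, Exec.seq e₂ (.plus _ _ _ _), le_rfl, ?_, ?_, ?_, ?_, ?_, ?_⟩
      · simp only [Memory.pull, Memory.setVar, Memory.mk.injEq]
        constructor
        · funext x
          have : 8 * x + 4 ≠ 8 := by omega
          simp [this, hv]
        · funext x
          exact ho _ (by omega)
      · intro x hx
        have : x ≠ 8 := by omega
        rw [← (ha x hx).1, ← (ha x hx).2]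
        refine ⟨by simp [Memory.setVar, this, hv], ho _ (by omega)⟩
      · intro j g' hj i v hi
        have e1 := Gate.map_code m₁.var 7 16 (fun x => 8 * x + 4) g
        rw [h7', hv16, show (m₁.var ∘ fun x => 8 * x + 4) =
          id ∘ (m₁.pull fun x => 8 * x + 4).var from rfl, ← Gate.code_map] at e1
        simp only [Memory.setVar]
        have hi15 : i < 15 := by
          rw [← Gate.code_length 0 1 id g']; exact (List.getElem?_eq_some_iff.1 hi).1
        obtain ⟨x, hx⟩ : ∃ x, (g.code 7 16 fun x => 8 * x + 4)[i]? = some x :=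
          ⟨_, List.getElem?_eq_getElem (by rw [Gate.code_length]; exact hi15)⟩
        rw [hs i x hx]
        rcases lt_or_ge j gs.length with hj' | hj'
        · rw [Function.update_of_ne (by omega)]
          exact hh j g' (by rwa [List.getElem?_append_left hj'] at hj) i v hi
        · rw [List.getElem?_append_right hj'] at hj
          have h0 : j = gs.length := by
            by_contra hne
            rw [List.getElem?_eq_none (by simp; omega)] at hj
            simp at hj
          rw [h0] at hj ⊢
          simp at hj
          rw [← hv8, Function.update_self]
          rw [← hj, ← e1, List.getElem?_map, hx] at hi
          simpa using hi
      · simp [Memory.setVar, hv, hv8, hv16]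
      · simp [Memory.setVar, hv, hv0]
      · simp [Memory.setVar, hv, hv16])
    ((m.setVar 16 1).setVar 4 ((m.setVar 16 1).var 0 + (m.setVar 16 1).var (8 + 4))) []
    (Memory.pull_input (by simp [Memory.setVar, hl]) hcl')
    ⟨by
      refine ((m.agreeOn_setVar (p := fun x => x % 8 ≠ 4 ∧ x % 8 ≠ 0) (by simp)).trans
        (Memory.agreeOn_setVar _ (p := fun x => x % 8 ≠ 4 ∧ x % 8 ≠ 0) (by simp))).mono
        (by intro x hx; exact ⟨hx, hx⟩),
      by intro j g hj; simp at hj, by simp [Memory.setVar, h8], by simp [Memory.setVar, hl],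
      by simp [Memory.setVar]⟩
  refine ⟨_, m', by
    simpa [flatMap_nil_const] using Exec.seq (.const _ _ _) (Exec.seq (.plus _ _ _ _) e'), ?_,
    hi'.2.1, hi'.2.2.1, ?_, hi'.1, hi'.2.2.2.1⟩
  · simp; omega
  · have := e.length_le
    simp; omega

/-! ### Closure properties of uniform circuit families -/

theorem Gate.map_map (f e : ℕ → ℕ) (g : Gate) : (g.map f).map e = g.map (e ∘ f) := by
  cases g <;> rfl

/-- Renaming the variables in an emitted gate compensates the renaming of the memory, so the same
gates are issued. Disjoint regions then allow several generators to run one after the other. -/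
theorem PolyTimeCircuits.runs {C : ℕ → List Gate} (hC : PolyTimeCircuits C) {s : ℕ} (hs : s < 8) :
    ∃ (c : Program) (p : Polynomial ℕ), ∀ l m, m.var 0 = l → m.Clean s → ∃ t m',
      Exec c m (C l) t m' ∧ t ≤ p.eval l ∧ Memory.AgreeOn (fun x => x % 8 ≠ s) m m' := by
  obtain ⟨c, p, hc⟩ := hC
  refine ⟨.seq (.plus s 0 (8 + s)) (c.subst (fun x => 8 * x + s) fun g =>
    .emit (g.map fun x => 8 * x + s)), 2 * p + 1, ?_⟩
  intro l m hl hcl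
  obtain ⟨t, m₁, e, ht⟩ := hc l
  obtain ⟨t', m', e', ht', hp', hi'⟩ := e.subst (region_injective s)
    (fun g => .emit (g.map fun x => 8 * x + s))
    (fun g => [g]) (fun _ m' => Memory.AgreeOn (fun x => x % 8 ≠ s) m m') 1
    (by
      intro _ m₁ m₂ h12 h1 x hx
      have := h12 x (notMem_region hs hx)
      rw [this.1, this.2]; exact h1 x hx)
    (by
      intro g m₁ gs hi
      refine ⟨1, _, ?_, le_rfl, rfl, hi⟩
      have := Exec.emit m₁ (g.map fun x => 8 * x + s)
      rwa [Gate.map_map] at this)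
    (m.setVar s (m.var 0 + m.var (8 + s))) [] (Memory.pull_input hl hcl)
    (m.agreeOn_setVar (by simp; omega))
  refine ⟨_, m', by simpa using Exec.seq (.plus _ _ _ _) e', ?_, hi'⟩
  simp; omega

theorem PolyTimeCircuits.append {C D : ℕ → List Gate} (hC : PolyTimeCircuits C)
    (hD : PolyTimeCircuits D) : PolyTimeCircuits fun l => C l ++ D l := by
  obtain ⟨c, p, hc⟩ := hC.runs (s := 1) (by omega)
  obtain ⟨d, q, hd⟩ := hD.runs (s := 2) (by omega)
  refine ⟨.seq c d, p + q, fun l => ?_⟩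
  obtain ⟨t, m, e, ht, ha⟩ := hc l (.start l) (by simp [Memory.start])
    (Memory.start_clean (by omega))
  obtain ⟨t', m', e', ht', -⟩ := hd l m (by rw [(ha 0 (by omega)).1]; simp [Memory.start])
    (ha.clean (Memory.start_clean (by omega)) (by omega))
  exact ⟨_, m', .seq e e', by simp; omega⟩

/-- `x := x * y + z` -/
def mulAdd (x y z : ℕ) : Program :=
  .seq (.const 32 0) (.seq (.plus 40 y 7)
    (.seq (.loop 40 (.seq (.plus 32 32 x) (.minus 40 40 16))) (.plus x 32 z)))

/-- Multiplication by repeated addition, with variable `32` as accumulator and `40` as counter. The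
time is linear in the multiplier, which is always polynomially bounded here. -/
theorem exec_mulAdd {x y z : ℕ} (hx : 160 ≤ x) (hy : y ≠ 32 ∧ y ≠ 40) (hz : z ≠ 32 ∧ z ≠ 40)
    (m : Memory) (h7 : m.var 7 = 0) (h16 : m.var 16 = 1) :
    ∃ t m', Exec (mulAdd x y z) m [] t m' ∧ t ≤ 3 * m.var y + 4 ∧ m'.arr = m.arr ∧
      m'.var x = m.var x * m.var y + m.var z ∧
      ∀ v, v ≠ x → v ≠ 32 → v ≠ 40 → m'.var v = m.var v := by
  obtain ⟨t, m', e, ht, h⟩ := Exec.count_loop (c := .seq (.plus 32 32 x) (.minus 40 40 16))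
    (x := 40) (N := m.var y) (T := 2)
    (fun i m' => m'.arr = m.arr ∧ m'.var 32 = m.var x * i ∧ m'.var 40 = m.var y - i ∧
      ∀ v, v ≠ 32 → v ≠ 40 → m'.var v = m.var v) (fun _ => [])
    (fun i m' _ h => h.2.2.1)
    (by
      rintro i m' hi ⟨h1, h2, h3, h4⟩
      refine ⟨_, _, Exec.seq (.plus _ _ _ _) (.minus _ _ _ _), le_rfl, h1, ?_, ?_, ?_⟩
      · have : m'.var x = m.var x := h4 x (by omega) (by omega)
        simp [Memory.setVar, this, h2]; ring
      · simp [Memory.setVar, h3, h4 16, h16]; omega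
      · intro v hv hv'
        simp [Memory.setVar, hv, hv', h4])
    ((m.setVar 32 0).setVar 40 ((m.setVar 32 0).var y + (m.setVar 32 0).var 7))
    (by
      refine ⟨rfl, by simp [Memory.setVar], by simp [Memory.setVar, hy.1, h7], ?_⟩
      intro v hv hv'
      simp [Memory.setVar, hv, hv'])
  obtain ⟨h1, h2, h3, h4⟩ := h
  rw [flatMap_nil_const] at e
  refine ⟨_, _, Exec.seq (.const _ _ _) (Exec.seq (.plus _ _ _ _) (Exec.seq e (.plus _ _ _ _))),
    by omega, h1, ?_, ?_⟩
  · simp [Memory.setVar, h2, h4 z hz.1 hz.2]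
  · intro v hv hv1 hv2
    simp [Memory.setVar, hv, h4 v hv1 hv2]

/-- Issue the gate `g` if variable `x` is not zero. -/
def emitIf (x : ℕ) (g : Gate) : Program := .loop x (.seq (.emit g) (.const x 0))

/-- A loop that clears its own condition runs at most once and so acts as a conditional. -/
theorem exec_emitIf (x : ℕ) (g : Gate) (m : Memory) :
    ∃ t m', Exec (emitIf x g) m (if m.var x = 0 then [] else [g.map m.var]) t m' ∧ t ≤ 4 ∧
      m'.arr = m.arr ∧ ∀ v, v ≠ x → m'.var v = m.var v := by
  by_cases h : m.var x = 0
  · rw [if_pos h]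
    exact ⟨1, m, .loop_done h, by omega, rfl, fun _ _ => rfl⟩
  · rw [if_neg h]
    refine ⟨_, m.setVar x 0, Exec.loop_step h (.seq (.emit _ _) (.const _ _ _))
      (.loop_done (by simp [Memory.setVar])), by omega, rfl, ?_⟩
    intro v hv
    simp [Memory.setVar, hv]

/-- Load place `pos` of the arrays `8 * i`, `i < k`, into the variables `160 + 8 * i`. -/
def fetch (pos : ℕ) : ℕ → Program
  | 0 => .const 7 0
  | k + 1 => .seq (fetch pos k) (.load (160 + 8 * k) (8 * k) pos)

theorem exec_fetch {pos : ℕ} (hpos : pos < 160) (m : Memory) (h7 : m.var 7 = 0) (k : ℕ) :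
    ∃ m', Exec (fetch pos k) m [] (k + 1) m' ∧ m'.arr = m.arr ∧
      (∀ i < k, m'.var (160 + 8 * i) = m.arr (8 * i) (m.var pos)) ∧
      ∀ v < 160, m'.var v = m.var v := by
  induction k with
  | zero =>
    refine ⟨m, ?_, rfl, by simp, by simp⟩
    have : m.setVar 7 0 = m := by
      simp only [Memory.setVar]
      rw [← h7, Function.update_eq_self]
    simpa [this, fetch] using Exec.const m 7 0
  | succ k ih =>
    obtain ⟨m', e, ha, hv, hf⟩ := ih
    refine ⟨_, Exec.seq e (.load _ _ _ _), ha, ?_, ?_⟩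
    · intro i hi
      by_cases h : i = k
      · subst h
        simp [Memory.setVar, ha, hf pos hpos]
      · simp [Memory.setVar, h, hv i (by omega)]
    · intro v hv
      have : v ≠ 160 + 8 * k := by omega
      simp [Memory.setVar, this, hf v hv]

/-- Issue the gate stored at the place given by variable `24`, relabelled by `place`. -/
def emitStored (rev : Bool) : Program :=
  .seq (fetch 24 15) <|
  .seq (mulAdd 200 48 56) <| .seq (mulAdd 208 1 64) <|
  .seq (mulAdd 224 48 56) <| .seq (mulAdd 232 1 64) <|
  .seq (mulAdd 248 48 56) <| .seq (mulAdd 256 1 64) <|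
  .seq (emitIf 160 (.not (200, 208, 216))) <|
  .seq (emitIf 168 (.cnot (200, 208, 216) (224, 232, 240))) <|
  .seq (emitIf 176 (.toffoli (200, 208, 216) (224, 232, 240) (248, 256, 264))) <|
  .seq (emitIf 184 (.u rev 272 (200, 208, 216))) <|
  emitIf 192 (.u (!rev) 272 (200, 208, 216))

/-- Variables `160` to `192` receive the unary kind, `200` to `264` the wires, and `272` the place
in the alphabet. The registers are multiplied by variable `48` and shifted by `56`, and the indices
by `1` and `64`. Exactly one of the five conditional emissions fires; inversion amounts to
exchanging the last two kinds. -/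
theorem exec_emitStored (rev : Bool) {m : Memory} {gs : List Gate} {g : Gate} (hh : m.Holds gs)
    (hg : gs[m.var 24]? = some g) (h7 : m.var 7 = 0) (h16 : m.var 16 = 1) :
    ∃ t m', Exec (emitStored rev) m [(if rev then g.dagger else g).relabel
        (place (m.var 48) (m.var 56) (m.var 1) (m.var 64))] t m' ∧
      t ≤ 60 + 9 * m.var 48 + 9 * m.var 1 ∧ m'.arr = m.arr ∧
      ∀ v < 160, v ≠ 32 → v ≠ 40 → m'.var v = m.var v := by
  obtain ⟨m₁, e₁, a₁, v₁, f₁⟩ := exec_fetch (pos := 24) (by omega) m h7 15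
  obtain ⟨t₂, m₂, e₂, h₂, a₂, v₂, f₂⟩ := exec_mulAdd (x := 200) (y := 48) (z := 56) (by omega)
    (by omega) (by omega) m₁ (by simp [f₁, h7]) (by simp [f₁, h16])
  obtain ⟨t₃, m₃, e₃, h₃, a₃, v₃, f₃⟩ := exec_mulAdd (x := 208) (y := 1) (z := 64) (by omega)
    (by omega) (by omega) m₂ (by simp [f₂, f₁, h7]) (by simp [f₂, f₁, h16])
  obtain ⟨t₄, m₄, e₄, h₄, a₄, v₄, f₄⟩ := exec_mulAdd (x := 224) (y := 48) (z := 56) (by omega)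
    (by omega) (by omega) m₃ (by simp [f₃, f₂, f₁, h7]) (by simp [f₃, f₂, f₁, h16])
  obtain ⟨t₅, m₅, e₅, h₅, a₅, v₅, f₅⟩ := exec_mulAdd (x := 232) (y := 1) (z := 64) (by omega)
    (by omega) (by omega) m₄ (by simp [f₄, f₃, f₂, f₁, h7]) (by simp [f₄, f₃, f₂, f₁, h16])
  obtain ⟨t₆, m₆, e₆, h₆, a₆, v₆, f₆⟩ := exec_mulAdd (x := 248) (y := 48) (z := 56) (by omega)
    (by omega) (by omega) m₅ (by simp [f₅, f₄, f₃, f₂, f₁, h7])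
    (by simp [f₅, f₄, f₃, f₂, f₁, h16])
  obtain ⟨t₇, m₇, e₇, h₇, a₇, v₇, f₇⟩ := exec_mulAdd (x := 256) (y := 1) (z := 64) (by omega)
    (by omega) (by omega) m₆ (by simp [f₆, f₅, f₄, f₃, f₂, f₁, h7])
    (by simp [f₆, f₅, f₄, f₃, f₂, f₁, h16])
  obtain ⟨t₈, m₈, e₈, h₈, a₈, f₈⟩ := exec_emitIf 160 (.not (200, 208, 216)) m₇
  obtain ⟨t₉, m₉, e₉, h₉, a₉, f₉⟩ := exec_emitIf 168 (.cnot (200, 208, 216) (224, 232, 240)) m₈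
  obtain ⟨tA, mA, eA, hA, aA, fA⟩ :=
    exec_emitIf 176 (.toffoli (200, 208, 216) (224, 232, 240) (248, 256, 264)) m₉
  obtain ⟨tB, mB, eB, hB, aB, fB⟩ := exec_emitIf 184 (.u rev 272 (200, 208, 216)) mA
  obtain ⟨tC, mC, eC, hC, aC, fC⟩ := exec_emitIf 192 (.u (!rev) 272 (200, 208, 216)) mB
  have E := e₁.seq <| e₂.seq <| e₃.seq <| e₄.seq <| e₅.seq <| e₆.seq <| e₇.seq <| e₈.seq <|
    e₉.seq <| eA.seq <| eB.seq eC
  refine ⟨16 + (t₂ + (t₃ + (t₄ + (t₅ + (t₆ + (t₇ + (t₈ + (t₉ + (tA + (tB + tC)))))))))), mC,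
    ?_, ?_, ?_, ?_⟩
  · refine (congrArg (fun L => Exec (emitStored rev) m L _ mC) ?_).mpr E
    have K : ∀ i v, (g.code 0 1 id)[i]? = some v → m₁.var (160 + 8 * i) = v := by
      intro i v hi
      rw [v₁ i (by rw [← Gate.code_length 0 1 id g]; exact (List.getElem?_eq_some_iff.1 hi).1)]
      exact hh _ g hg i v hi
    have k0 := K 0 _ (List.getElem?_eq_getElem (by rw [Gate.code_length]; omega))
    have k1 := K 1 _ (List.getElem?_eq_getElem (by rw [Gate.code_length]; omega))
    have k2 := K 2 _ (List.getElem?_eq_getElem (by rw [Gate.code_length]; omega))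
    have k3 := K 3 _ (List.getElem?_eq_getElem (by rw [Gate.code_length]; omega))
    have k4 := K 4 _ (List.getElem?_eq_getElem (by rw [Gate.code_length]; omega))
    have k5 := K 5 _ (List.getElem?_eq_getElem (by rw [Gate.code_length]; omega))
    have k6 := K 6 _ (List.getElem?_eq_getElem (by rw [Gate.code_length]; omega))
    have k7 := K 7 _ (List.getElem?_eq_getElem (by rw [Gate.code_length]; omega))
    have k8 := K 8 _ (List.getElem?_eq_getElem (by rw [Gate.code_length]; omega))
    have k9 := K 9 _ (List.getElem?_eq_getElem (by rw [Gate.code_length]; omega))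
    have k10 := K 10 _ (List.getElem?_eq_getElem (by rw [Gate.code_length]; omega))
    have k11 := K 11 _ (List.getElem?_eq_getElem (by rw [Gate.code_length]; omega))
    have k12 := K 12 _ (List.getElem?_eq_getElem (by rw [Gate.code_length]; omega))
    have k13 := K 13 _ (List.getElem?_eq_getElem (by rw [Gate.code_length]; omega))
    have k14 := K 14 _ (List.getElem?_eq_getElem (by rw [Gate.code_length]; omega))
    simp only [Nat.reduceMul, Nat.reduceAdd] at k0 k1 k2 k3 k4 k5 k6 k7 k8 k9 k10 k11 k12 k13 k14
    clear hh hg K E e₁ e₂ e₃ e₄ e₅ e₆ e₇ e₈ e₉ eA eB eC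
    simp [Gate.map, fB, fA, f₉, f₈, f₇, f₆, f₅, f₄, f₃, f₂, f₁, v₇, v₆, v₅, v₄, v₃, v₂, k0, k1,
      k2, k3, k4, k5, k6, k7, k8, k9, k10, k11, k12, k13, k14]
    rcases g with _ | _ | _ | ⟨_ | _, _, _⟩ <;> cases rev <;>
      simp [Gate.code, Gate.dagger, Gate.relabel, place]
  · have q48 : ∀ m', m' = m₁ ∨ m' = m₃ ∨ m' = m₅ → m'.var 48 = m.var 48 := by
      rintro m' (rfl | rfl | rfl) <;> simp [f₁, f₂, f₃, f₄, f₅]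
    have q1 : ∀ m', m' = m₂ ∨ m' = m₄ ∨ m' = m₆ → m'.var 1 = m.var 1 := by
      rintro m' (rfl | rfl | rfl) <;> simp [f₁, f₂, f₃, f₄, f₅, f₆]
    rw [q48 _ (by simp)] at h₂ h₄ h₆
    rw [q1 _ (by simp)] at h₃ h₅ h₇
    omega
  · rw [aC, aB, aA, a₉, a₈, a₇, a₆, a₅, a₄, a₃, a₂, a₁]
  · intro v hv h32 h40
    rw [fC v (by omega), fB v (by omega), fA v (by omega), f₉ v (by omega), f₈ v (by omega),
      f₇ v (by omega) h32 h40, f₆ v (by omega) h32 h40, f₅ v (by omega) h32 h40,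
      f₄ v (by omega) h32 h40, f₃ v (by omega) h32 h40, f₂ v (by omega) h32 h40, f₁ v hv]

theorem PolyTimeNat.const (k : ℕ) : PolyTimeNat fun _ => k :=
  -- One polynomial must bound both the single step and the value `k`.
  ⟨.const 0 k, Polynomial.C (k + 1), fun _ =>
    ⟨[], 1, _, .const _ _ _, by simp, by simp [Memory.setVar], by simp⟩⟩

theorem PolyTimeNat.id : PolyTimeNat fun l => l :=
  ⟨.plus 0 0 1, Polynomial.X + 1, fun l =>
    ⟨[], 1, _, .plus _ _ _ _, by simp, by simp [Memory.setVar, Memory.start], by simp⟩⟩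

theorem PolyTimeNat.le_poly {N : ℕ → ℕ} (hN : PolyTimeNat N) :
    ∃ p : Polynomial ℕ, ∀ l, N l ≤ p.eval l := by
  obtain ⟨c, p, h⟩ := hN
  exact ⟨p, fun l => by obtain ⟨_, _, _, _, _, _, h⟩ := h l; exact h⟩

/-- Load two numbers. -/
theorem LoadsNat.seq {c d : Program} {s s' : ℕ} {N M : ℕ → ℕ} {p q : Polynomial ℕ}
    (hc : LoadsNat c s N p) (hd : LoadsNat d s' M q) (hs : s ≠ 0 ∧ s < 7) (hs' : s' ≠ 0 ∧ s' < 7)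
    (hss : s ≠ s') (l : ℕ) (m : Memory) (hl : m.var 0 = l) (h7 : m.var 7 = 0) (h1 : m.Clean s)
    (h2 : m.Clean s') : ∃ t m', Exec (.seq c d) m [] t m' ∧ t ≤ (p + q).eval l ∧
      m'.var s = N l ∧ m'.var s' = M l ∧ Memory.AgreeOn (fun x => x % 8 ≠ s ∧ x % 8 ≠ s') m m' := by
  obtain ⟨t, m₁, e, ht, hv, ha⟩ := hc l m hl h7 h1
  obtain ⟨t', m₂, e', ht', hv', ha'⟩ := hd l m₁ (by rw [(ha 0 (by omega)).1, hl])
    (by rw [(ha 7 (by omega)).1, h7]) (ha.clean h2 (by omega))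
  refine ⟨_, m₂, .seq e e', by simp; omega, ?_, hv', (ha.trans ha').mono (by simp)⟩
  rw [(ha' s (by omega)).1, hv]

theorem PolyTimeNat.add {N M : ℕ → ℕ} (hN : PolyTimeNat N) (hM : PolyTimeNat M) :
    PolyTimeNat fun l => N l + M l := by
  obtain ⟨c, p, hc⟩ := hN.loads (s := 1) (by omega)
  obtain ⟨d, q, hd⟩ := hM.loads (s := 2) (by omega)
  obtain ⟨p', hp⟩ := hN.le_poly
  obtain ⟨q', hq⟩ := hM.le_poly
  refine ⟨.seq (.seq c d) (.plus 0 1 2), p + q + 1 + p' + q', fun l => ?_⟩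
  obtain ⟨t, m, e, ht, h1, h2, -⟩ := hc.seq hd (by omega) (by omega) (by omega) l (.start l)
    (by simp [Memory.start]) (by simp [Memory.start]) (Memory.start_clean (by omega))
    (Memory.start_clean (by omega))
  have := hp l
  have := hq l
  refine ⟨_, _, _, .seq e (.plus _ _ _ _), ?_, by simp [Memory.setVar, h1, h2], ?_⟩ <;>
    simp at ht ⊢ <;> omega

theorem PolyTimeNat.mul {N M : ℕ → ℕ} (hN : PolyTimeNat N) (hM : PolyTimeNat M) :
    PolyTimeNat fun l => N l * M l := by
  obtain ⟨c, p, hc⟩ := hN.loads (s := 1) (by omega)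
  obtain ⟨d, q, hd⟩ := hM.loads (s := 2) (by omega)
  obtain ⟨p', hp⟩ := hN.le_poly
  obtain ⟨q', hq⟩ := hM.le_poly
  refine ⟨.seq (.seq c d) (.seq (.const 16 1) (.seq (.plus 160 1 7)
    (.seq (mulAdd 160 2 7) (.plus 0 160 7)))), p + q + 3 * q' + 7 + p' * q', fun l => ?_⟩
  obtain ⟨t, m, e, ht, h1, h2, ha⟩ := hc.seq hd (by omega) (by omega) (by omega) l (.start l)
    (by simp [Memory.start]) (by simp [Memory.start]) (Memory.start_clean (by omega))
    (Memory.start_clean (by omega))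
  have h7 : m.var 7 = 0 := by rw [(ha 7 (by omega)).1]; simp [Memory.start]
  obtain ⟨t', m', e', ht', -, hv, hf⟩ := exec_mulAdd (x := 160) (y := 2) (z := 7) (by omega)
    (by omega) (by omega) ((m.setVar 16 1).setVar 160 ((m.setVar 16 1).var 1 +
      (m.setVar 16 1).var 7)) (by simp [Memory.setVar, h7]) (by simp [Memory.setVar])
  have := hp l
  have := hq l
  have := Nat.mul_le_mul (hp l) (hq l)
  have h7' : m'.var 7 = 0 := by rw [hf 7 (by omega) (by omega) (by omega)]; simp [Memory.setVar, h7]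
  simp [Memory.setVar, h1, h2, h7] at hv ht'
  refine ⟨_, _, _, .seq e (.seq (.const _ _ _) (.seq (.plus _ _ _ _) (.seq e' (.plus _ _ _ _)))),
    ?_, by simp [Memory.setVar, hv, h7'], ?_⟩ <;>
    simp at ht ⊢ <;> omega

/-- Needed for the number of blocks, which is chosen as a polynomial. -/
theorem PolyTimeNat.eval (p : Polynomial ℕ) : PolyTimeNat fun l => p.eval l := by
  induction p using Polynomial.induction_on with
  | C a => simpa using PolyTimeNat.const a
  | add p q hp hq => simpa using hp.add hq
  | monomial n a ih => simpa [pow_succ, ← mul_assoc] using ih.mul .id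

theorem flatMap_range_getElem? {α : Type*} (L : List α) :
    (List.range L.length).flatMap (fun j => L[j]?.toList) = L := by
  induction L with
  | nil => rfl
  | cons a L ih =>
    rw [List.length_cons, List.range_succ_eq_map, List.flatMap_cons, List.flatMap_map]
    simpa using ih

/-- Interleaved copies of a circuit or its inverse. -/
theorem PolyTimeCircuits.copies_aux {C : ℕ → List Gate} (hC : PolyTimeCircuits C) {N : ℕ → ℕ}
    (hN : PolyTimeNat N) (a b : ℕ) (rev : Bool) :
    PolyTimeCircuits fun l => (List.range (N l)).flatMap fun c =>
      relabel (place a b (N l) c) (if rev then dagger (C l) else C l) := by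
  obtain ⟨c, p, hc⟩ := hN.loads (s := 1) (by omega)
  obtain ⟨d, q, hd⟩ := hC.loads
  obtain ⟨p', hp'⟩ := hN.le_poly
  refine ⟨.seq c <| .seq d <| .seq (.const 16 1) <| .seq (.const 48 a) <| .seq (.const 56 b) <|
    .seq (.const 64 0) <| .seq (.plus 72 1 7) <| .loop 72 <| .seq (.plus 80 8 7) <|
    -- Variable `80` counts down from the length of the circuit. Its value minus one runs through
    -- the places backwards, as inversion requires; the length minus its value runs through them
    -- forwards.
    .seq (.loop 80 <| .seq (if rev then .minus 24 80 16 else .minus 24 8 80) <|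
      .seq (emitStored rev) (.minus 80 80 16)) <|
    .seq (.plus 64 64 16) (.minus 72 72 16),
    -- One stored gate costs at most `60 + 9 * a + 9 * N`, two subtractions and one loop test; the
    -- last is bounded through `p'`. The `5` and the `6` count the bookkeeping of one copy and of
    -- the whole program.
    p + q + 6 + p' * (q * (Polynomial.C (63 + 9 * a) + 9 * p') + 5), fun l => ?_⟩
  obtain ⟨t₁, m₁, e₁, ht₁, hv₁, ha₁⟩ := hc l (.start l) (by simp [Memory.start])
    (by simp [Memory.start]) (Memory.start_clean (by omega))
  obtain ⟨t₂, m₂, e₂, ht₂, hh, hv₂, hlen, ha₂, -⟩ := hd l m₁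
    (by rw [(ha₁ _ (by omega)).1]; simp [Memory.start])
    (by rw [(ha₁ _ (by omega)).1]; simp [Memory.start])
    (ha₁.clean (Memory.start_clean (by omega)) (by omega))
    (by rw [(ha₁ _ (by omega)).1]; simp [Memory.start])
  have hN₂ : m₂.var 1 = N l := by rw [(ha₂ _ (by omega)).1, hv₁]
  have h7₂ : m₂.var 7 = 0 := by
    rw [(ha₂ _ (by omega)).1, (ha₁ _ (by omega)).1]; simp [Memory.start]
  set D : List Gate := if rev then dagger (C l) else C l with hD
  have hDl : D.length = (C l).length := by
    rw [hD]; split <;> simp [dagger]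
  let Base : Memory → Prop := fun m => m.arr = m₂.arr ∧ m.var 1 = N l ∧ m.var 7 = 0 ∧
    m.var 8 = (C l).length ∧ m.var 16 = 1 ∧ m.var 48 = a ∧ m.var 56 = b
  obtain ⟨t₃, m₃, e₃, ht₃, -⟩ := Exec.count_loop (x := 72) (N := N l)
    (T := q.eval l * (63 + 9 * a + 9 * p'.eval l) + 4)
    (c := .seq (.plus 80 8 7) <|
      .seq (.loop 80 <| .seq (if rev then .minus 24 80 16 else .minus 24 8 80) <|
        .seq (emitStored rev) (.minus 80 80 16)) <|
      .seq (.plus 64 64 16) (.minus 72 72 16))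
    (fun i m => Base m ∧ m.var 64 = i ∧ m.var 72 = N l - i)
    (fun i => relabel (place a b (N l) i) D)
    (fun i m _ h => h.2.2)
    (by
      rintro i m hi ⟨⟨b0, b1, b2, b3, b4, b5, b6⟩, h64, h72⟩
      obtain ⟨t, m', e, ht, ⟨c0, c1, c2, c3, c4, c5, c6⟩, k64, k72, k80⟩ :=
        Exec.count_loop (x := 80) (N := (C l).length)
        (T := 62 + 9 * a + 9 * N l)
        (c := .seq (if rev then .minus 24 80 16 else .minus 24 8 80) <|
          .seq (emitStored rev) (.minus 80 80 16))
        (fun j m => Base m ∧ m.var 64 = i ∧ m.var 72 = N l - i ∧ m.var 80 = (C l).length - j)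
        (fun j => relabel (place a b (N l) i) D[j]?.toList)
        (fun j m _ h => h.2.2.2)
        (by
          rintro j m hj ⟨⟨b0, b1, b2, b3, b4, b5, b6⟩, h64, h72, h80⟩
          have step : ∃ m' : Memory, Exec (if rev then .minus 24 80 16 else .minus 24 8 80) m [] 1 m' ∧
              m'.arr = m.arr ∧ (∀ v, v ≠ 24 → m'.var v = m.var v) ∧
              m'.var 24 = if rev then (C l).length - 1 - j else j := by
            cases rev
            · refine ⟨_, .minus _ _ _ _, rfl, fun v hv => by simp [Memory.setVar, hv], ?_⟩
              simp [Memory.setVar, b3, h80]; omega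
            · refine ⟨_, .minus _ _ _ _, rfl, fun v hv => by simp [Memory.setVar, hv], ?_⟩
              simp [Memory.setVar, b4, h80]; omega
          obtain ⟨m', e, ha, hf, h24⟩ := step
          have hidx : (if rev then (C l).length - 1 - j else j) < (C l).length := by
            split <;> omega
          have hg : (C l)[m'.var 24]? = some ((C l)[if rev then (C l).length - 1 - j else j]) := by
            rw [h24]; exact List.getElem?_eq_getElem hidx
          obtain ⟨t'', m'', e', ht', ha', hf'⟩ := exec_emitStored rev (m := m') (gs := C l)
            (by
              intro j g hj i v hi
              rw [ha, b0]; exact hh j g hj i v hi)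
            hg (by rw [hf _ (by omega), b2]) (by rw [hf _ (by omega), b4])
          have hf'' : ∀ v < 160, v ≠ 32 → v ≠ 40 → v ≠ 24 → m''.var v = m.var v := by
            intro v h1 h2 h3 h4
            rw [hf' v h1 h2 h3, hf v h4]
          have hDj : D[j]?.toList = [if rev then Gate.dagger
              ((C l)[if rev then (C l).length - 1 - j else j]) else
              ((C l)[if rev then (C l).length - 1 - j else j])] := by
            cases rev
            · simp [hD, hj]
            · simp [hD, dagger, hj]
          refine ⟨_, _, by
            simpa [hDj, relabel, hf _, b5, b6, b1, h64] using e.seq (e'.seq (.minus _ _ _ _)),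
            ?_, ⟨?_, ?_, ?_, ?_, ?_, ?_, ?_⟩, ?_, ?_, ?_⟩
          · simp [hf, b5, b1] at ht'
            omega
          all_goals simp [Memory.setVar, *]
          omega)
        (m.setVar 80 (m.var 8 + m.var 7))
        (by
          refine ⟨⟨b0, ?_, ?_, ?_, ?_, ?_, ?_⟩, ?_, ?_, ?_⟩ <;> simp [Memory.setVar, *])
      have hE : (List.range (C l).length).flatMap
          (fun j => relabel (place a b (N l) i) D[j]?.toList) = relabel (place a b (N l) i) D := by
        conv_rhs => rw [← flatMap_range_getElem? D, hDl]
        simp only [relabel, List.map_flatMap]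
      rw [hE] at e
      have E := (Exec.plus m 80 8 7).seq (e.seq ((Exec.plus m' 64 64 16).seq
        (.minus _ 72 72 16)))
      rw [List.nil_append, List.append_nil, List.append_nil] at E
      refine ⟨_, _, E, ?_, ⟨c0, ?_, ?_, ?_, ?_, ?_, ?_⟩, ?_, ?_⟩
      · have h1 : (C l).length * (62 + 9 * a + 9 * N l + 1) ≤
            q.eval l * (63 + 9 * a + 9 * p'.eval l) := by
          refine Nat.mul_le_mul hlen ?_
          have := hp' l
          omega
        omega
      all_goals simp [Memory.setVar, *]
      omega)
    (((((m₂.setVar 16 1).setVar 48 a).setVar 56 b).setVar 64 0).setVar 72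
      ((((m₂.setVar 16 1).setVar 48 a).setVar 56 b).setVar 64 0 |>.var 1 |>.add
      ((((m₂.setVar 16 1).setVar 48 a).setVar 56 b).setVar 64 0 |>.var 7)))
    (by
      refine ⟨⟨rfl, ?_, ?_, ?_, ?_, ?_, ?_⟩, ?_, ?_⟩ <;> simp [Memory.setVar, *])
  refine ⟨_, _, by simpa using e₁.seq <| e₂.seq <| (Exec.const _ _ _).seq <|
    (Exec.const _ _ _).seq <| (Exec.const _ _ _).seq <| (Exec.const _ _ _).seq <|
    (Exec.plus _ _ _ _).seq e₃, ?_⟩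
  simp only [Polynomial.eval_add, Polynomial.eval_mul, Polynomial.eval_C, Polynomial.eval_ofNat]
  have : N l * (q.eval l * (63 + 9 * a + 9 * p'.eval l) + 4 + 1) ≤
    p'.eval l * (q.eval l * (63 + 9 * a + 9 * p'.eval l) + 5) := Nat.mul_le_mul_right _ (hp' l)
  omega

theorem place_one_zero (w : Wire) : place 1 0 1 0 w = w := by
  simp [place]

theorem relabel_id (f : Wire → Wire) (hf : ∀ w, f w = w) (C : List Gate) : relabel f C = C := by
  have : ∀ g : Gate, g.relabel f = g := by
    intro g; cases g <;> simp [Gate.relabel, hf]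
  rw [relabel, funext this, List.map_id']

theorem PolyTimeCircuits.copies {C : ℕ → List Gate} (hC : PolyTimeCircuits C) {N : ℕ → ℕ}
    (hN : PolyTimeNat N) (a b : ℕ) :
    PolyTimeCircuits fun l => (List.range (N l)).flatMap fun c =>
      relabel (place a b (N l) c) (C l) := by
  simpa using hC.copies_aux hN a b false

theorem PolyTimeCircuits.relabel {C : ℕ → List Gate} (hC : PolyTimeCircuits C) (a b : ℕ) :
    PolyTimeCircuits fun l => relabel (place a b 1 0) (C l) := by
  simpa using hC.copies (.const 1) a b

theorem PolyTimeCircuits.dagger {C : ℕ → List Gate} (hC : PolyTimeCircuits C) :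
    PolyTimeCircuits fun l => dagger (C l) := by
  have := hC.copies_aux (.const 1) 1 0 true
  simpa [relabel_id _ place_one_zero] using this

/-- Only finitely many numbers occur in a gate template, so a fixed program can set up all the
constants it needs. -/
theorem Gate.exists_map_congr (g : Gate) :
    ∃ K, ∀ f f' : ℕ → ℕ, (∀ v < K, f v = f' v) → g.map f = g.map f' := by
  have key : ∀ a : Wire, ∃ K, ∀ f f' : ℕ → ℕ, (∀ v < K, f v = f' v) →
      f a.1 = f' a.1 ∧ f a.2.1 = f' a.2.1 ∧ f a.2.2 = f' a.2.2 := fun a =>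
    ⟨a.1 + a.2.1 + a.2.2 + 1, fun f f' h =>
      ⟨h _ (by omega), h _ (by omega), h _ (by omega)⟩⟩
  rcases g with a | ⟨a, b⟩ | ⟨a, b, c⟩ | ⟨i, j, a⟩
  · obtain ⟨K, h⟩ := key a
    exact ⟨K, fun f f' hf => by simp [Gate.map, h f f' hf]⟩
  · obtain ⟨K, h⟩ := key a
    obtain ⟨K', h'⟩ := key b
    exact ⟨K + K', fun f f' hf => by
      simp [Gate.map, h f f' fun v hv => hf v (by omega), h' f f' fun v hv => hf v (by omega)]⟩
  · obtain ⟨K, h⟩ := key a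
    obtain ⟨K', h'⟩ := key b
    obtain ⟨K'', h''⟩ := key c
    exact ⟨K + K' + K'', fun f f' hf => by
      simp [Gate.map, h f f' fun v hv => hf v (by omega), h' f f' fun v hv => hf v (by omega),
        h'' f f' fun v hv => hf v (by omega)]⟩
  · obtain ⟨K, h⟩ := key a
    exact ⟨K + j + 1, fun f f' hf => by
      simp [Gate.map, h f f' fun v hv => hf v (by omega), hf j (by omega)]⟩

theorem exists_map_congr (gs : List Gate) :
    ∃ K, ∀ f f' : ℕ → ℕ, (∀ v < K, f v = f' v) → gs.map (Gate.map f) = gs.map (Gate.map f') := by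
  induction gs with
  | nil => exact ⟨0, fun _ _ _ => rfl⟩
  | cons g gs ih =>
    obtain ⟨K, h⟩ := ih
    obtain ⟨K', h'⟩ := g.exists_map_congr
    exact ⟨K + K', fun f f' hf => by
      rw [List.map_cons, List.map_cons, h f f' fun v hv => hf v (by omega),
        h' f f' fun v hv => hf v (by omega)]⟩

/-- Issue a list of gates. -/
def emitAll : List Gate → Program
  | [] => .const 7 0
  | g :: gs => .seq (.emit g) (emitAll gs)

theorem exec_emitAll (gs : List Gate) (m : Memory) (h7 : m.var 7 = 0) :
    Exec (emitAll gs) m (gs.map (Gate.map m.var)) (gs.length + 1) m := by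
  induction gs with
  | nil =>
    have : m.setVar 7 0 = m := by
      simp only [Memory.setVar]
      rw [← h7, Function.update_eq_self]
    simpa [this, emitAll] using Exec.const m 7 0
  | cons g gs ih =>
    have := Exec.seq (Exec.emit m g) ih
    rw [add_comm 1] at this
    simpa [emitAll] using this

/-- Set the variables `200 + 8 * v` to `v`, for `v < k`. -/
def setConsts : ℕ → Program
  | 0 => .const 7 0
  | k + 1 => .seq (setConsts k) (.const (200 + 8 * k) k)

theorem exec_setConsts (k : ℕ) (m : Memory) (h7 : m.var 7 = 0) :
    ∃ m', Exec (setConsts k) m [] (k + 1) m' ∧ (∀ v < k, m'.var (200 + 8 * v) = v) ∧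
      ∀ v < 200, m'.var v = m.var v := by
  induction k with
  | zero =>
    refine ⟨m, ?_, by simp, by simp⟩
    have : m.setVar 7 0 = m := by
      simp only [Memory.setVar]
      rw [← h7, Function.update_eq_self]
    simpa [this, setConsts] using Exec.const m 7 0
  | succ k ih =>
    obtain ⟨m', e, h1, h2⟩ := ih
    refine ⟨_, e.seq (.const _ _ _), ?_, ?_⟩
    · intro v hv
      by_cases h : v = k
      · simp [Memory.setVar, h]
      · simp [Memory.setVar, h, h1 v (by omega)]
    · intro v hv
      have : v ≠ 200 + 8 * k := by omega
      simp [Memory.setVar, this, h2 v hv]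

/-- Interpretation of the numbers in a gate template inside three nested loops with indices
`i`, `c`, `j`: the numbers `0, 1, 2, 3, 4` stand for `i`, `c`, `j`, `i * N + c`, `N + c`, and
`v + 5` stands for `v`. -/
def loopEnv (N i c j : ℕ) : ℕ → ℕ
  | 0 => i
  | 1 => c
  | 2 => j
  | 3 => i * N + c
  | 4 => N + c
  | v + 5 => v

/-- The gates obtained from the templates `gs` in three nested loops. -/
def loops (N₁ N₂ N₃ : ℕ) (gs : List Gate) : List Gate :=
  (List.range N₁).flatMap fun i => (List.range N₂).flatMap fun c => (List.range N₃).flatMap fun j =>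
    gs.map (Gate.map (loopEnv N₂ i c j))

/-- The value that a template assigns to the number `v` is kept in variable `160 + 8 * v`: the first
five such variables follow the loops, the others hold constants set once at the start. Every
classical circuit of the construction other than the given check is assembled from such loops. -/
theorem PolyTimeCircuits.loops {N₁ N₂ N₃ : ℕ → ℕ} (h₁ : PolyTimeNat N₁) (h₂ : PolyTimeNat N₂)
    (h₃ : PolyTimeNat N₃) (gs : List Gate) :
    PolyTimeCircuits fun l => loops (N₁ l) (N₂ l) (N₃ l) gs := by
  obtain ⟨c₁, p₁, hc₁⟩ := h₁.loads (s := 1) (by omega)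
  obtain ⟨c₂, p₂, hc₂⟩ := h₂.loads (s := 2) (by omega)
  obtain ⟨c₃, p₃, hc₃⟩ := h₃.loads (s := 3) (by omega)
  obtain ⟨q₁, hq₁⟩ := h₁.le_poly
  obtain ⟨q₂, hq₂⟩ := h₂.le_poly
  obtain ⟨q₃, hq₃⟩ := h₃.le_poly
  obtain ⟨K, hK⟩ := exists_map_congr gs
  let gs' := gs.map (Gate.map fun v => 160 + 8 * v)
  let in₃ : Program := .seq (emitAll gs') (.seq (.plus 176 176 16) (.minus 88 88 16))
  let in₂ : Program := .seq (.plus 184 160 7) <| .seq (mulAdd 184 2 168) <| .seq (.plus 192 2 168) <|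
    .seq (.const 176 0) <| .seq (.plus 88 3 7) <| .seq (.loop 88 in₃) <|
    .seq (.plus 168 168 16) (.minus 80 80 16)
  let in₁ : Program := .seq (.const 168 0) <| .seq (.plus 80 2 7) <| .seq (.loop 80 in₂) <|
    .seq (.plus 160 160 16) (.minus 72 72 16)
  refine ⟨.seq (.seq c₁ c₂) <| .seq c₃ <| .seq (.const 16 1) <| .seq (setConsts K) <|
    .seq (.const 160 0) <| .seq (.plus 72 1 7) (.loop 72 in₁),
    p₁ + p₂ + p₃ + Polynomial.C (K + 5) + q₁ * (q₂ * (q₃ * Polynomial.C (gs.length + 4) + 3 * q₂ + 12) +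
      6), fun l => ?_⟩
  obtain ⟨t, m, e, ht, v₁, v₂, ha⟩ := hc₁.seq hc₂ (by omega) (by omega) (by omega) l (.start l)
    (by simp [Memory.start]) (by simp [Memory.start]) (Memory.start_clean (by omega))
    (Memory.start_clean (by omega))
  have h7 : m.var 7 = 0 := by rw [(ha 7 (by omega)).1]; simp [Memory.start]
  obtain ⟨t', m', e', ht', v₃, ha'⟩ := hc₃ l m (by rw [(ha _ (by omega)).1]; simp [Memory.start]) h7
    (ha.clean (Memory.start_clean (by omega)) (by omega))
  have w7 : m'.var 7 = 0 := by rw [(ha' _ (by omega)).1, h7]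
  have w1 : m'.var 1 = N₁ l := by rw [(ha' _ (by omega)).1, v₁]
  have w2 : m'.var 2 = N₂ l := by rw [(ha' _ (by omega)).1, v₂]
  obtain ⟨m'', e'', hcon, hf⟩ := exec_setConsts K (m'.setVar 16 1) (by simp [Memory.setVar, w7])
  let Base : Memory → Prop := fun m => m.var 2 = N₂ l ∧ m.var 3 = N₃ l ∧ m.var 7 = 0 ∧
    m.var 16 = 1 ∧ ∀ v < K, m.var (200 + 8 * v) = v
  have run₃ : ∀ i c m, Base m → m.var 72 = N₁ l - i → m.var 80 = N₂ l - c → m.var 88 = N₃ l →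
      m.var 160 = i → m.var 168 = c → m.var 176 = 0 → m.var 184 = i * N₂ l + c →
      m.var 192 = N₂ l + c → ∃ t m', Exec (.loop 88 in₃) m ((List.range (N₃ l)).flatMap fun j =>
        gs.map (Gate.map (loopEnv (N₂ l) i c j))) t m' ∧ t ≤ N₃ l * (gs.length + 4) + 1 ∧ Base m' ∧
        m'.var 72 = N₁ l - i ∧ m'.var 80 = N₂ l - c ∧ m'.var 160 = i ∧ m'.var 168 = c := by
    intro i c m hB h72 h80 h88 h160 h168 h176 h184 h192
    obtain ⟨t, m', e, ht, hB', k72, k80, -, k160, k168, -⟩ := Exec.count_loop (x := 88) (N := N₃ l)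
      (T := gs.length + 3) (c := in₃)
      (fun j m => Base m ∧ m.var 72 = N₁ l - i ∧ m.var 80 = N₂ l - c ∧ m.var 88 = N₃ l - j ∧
        m.var 160 = i ∧ m.var 168 = c ∧ m.var 176 = j ∧ m.var 184 = i * N₂ l + c ∧
        m.var 192 = N₂ l + c)
      (fun j => gs.map (Gate.map (loopEnv (N₂ l) i c j)))
      (fun j m _ h => h.2.2.2.1)
      (by
        rintro j m hj ⟨⟨b2, b3, b7, b16, bK⟩, h72, h80, h88, h160, h168, h176, h184, h192⟩
        have E := (exec_emitAll gs' m b7).seq ((Exec.plus m 176 176 16).seq (.minus _ 88 88 16))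
        have hE : gs'.map (Gate.map m.var) = gs.map (Gate.map (loopEnv (N₂ l) i c j)) := by
          rw [List.map_map, show (Gate.map m.var ∘ Gate.map fun v => 160 + 8 * v) =
            Gate.map (m.var ∘ fun v => 160 + 8 * v) from funext fun g => Gate.map_map _ _ _]
          apply hK
          intro v hv
          rcases v with _ | _ | _ | _ | _ | v
          · simpa [loopEnv]
          · simpa [loopEnv]
          · simpa [loopEnv]
          · simpa [loopEnv]
          · simpa [loopEnv]
          -- Constants are stored from `200 = 160 + 8 * 5` on, matching the shift by five in
          -- `loopEnv`.
          · have := bK v (by omega)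
            rw [show 200 + 8 * v = 160 + 8 * (v + 1 + 1 + 1 + 1 + 1) by ring] at this
            simpa [loopEnv] using this
        rw [hE, List.append_nil, List.append_nil] at E
        refine ⟨_, _, E, by simp [gs'], ⟨?_, ?_, ?_, ?_, ?_⟩, ?_, ?_, ?_, ?_, ?_, ?_, ?_, ?_⟩
        rotate_left 4
        · intro v hv
          have a1 : 200 + 8 * v ≠ 88 := by omega
          have a2 : 200 + 8 * v ≠ 176 := by omega
          simp [Memory.setVar, a1, a2, bK v hv]
        all_goals simp [Memory.setVar, *]
        omega) m (by simp [*])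
    exact ⟨t, m', e, ht, hB', k72, k80, k160, k168⟩
  have run₂ : ∀ i m, Base m → m.var 72 = N₁ l - i → m.var 80 = N₂ l →
      m.var 160 = i → m.var 168 = 0 → ∃ t m', Exec (.loop 80 in₂) m ((List.range (N₂ l)).flatMap
        fun c => (List.range (N₃ l)).flatMap fun j => gs.map (Gate.map (loopEnv (N₂ l) i c j))) t m' ∧
        t ≤ N₂ l * (N₃ l * (gs.length + 4) + 3 * N₂ l + 12) + 1 ∧ Base m' ∧
        m'.var 72 = N₁ l - i ∧ m'.var 160 = i := by
    intro i m hB h72 h80 h160 h168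
    obtain ⟨t, m', e, ht, hB', k72, -, k160, -⟩ := Exec.count_loop (x := 80) (N := N₂ l)
      (T := N₃ l * (gs.length + 4) + 3 * N₂ l + 11) (c := in₂)
      (fun c m => Base m ∧ m.var 72 = N₁ l - i ∧ m.var 80 = N₂ l - c ∧
        m.var 160 = i ∧ m.var 168 = c)
      (fun c => (List.range (N₃ l)).flatMap fun j => gs.map (Gate.map (loopEnv (N₂ l) i c j)))
      (fun j m _ h => h.2.2.1)
      (by
        rintro c m hj ⟨⟨b2, b3, b7, b16, bK⟩, h72, h80, h160, h168⟩
        obtain ⟨t₁, m₁, e₁, ht₁, -, hv₁, hf₁⟩ := exec_mulAdd (x := 184) (y := 2) (z := 168) (by omega)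
          (by omega) (by omega) (m.setVar 184 (m.var 160 + m.var 7)) (by simp [Memory.setVar, b7])
          (by simp [Memory.setVar, b16])
        have g₁ : ∀ v, v ≠ 184 → v ≠ 32 → v ≠ 40 → m₁.var v = m.var v := by
          intro v h1 h2 h3
          rw [hf₁ v h1 h2 h3]
          simp [Memory.setVar, h1]
        simp [Memory.setVar, b2, h160, h168, b7] at hv₁ ht₁
        obtain ⟨t₂, m₂, e₂, ht₂, hB₂, k72, k80, k160, k168⟩ := run₃ i c
          (((m₁.setVar 192 (m₁.var 2 + m₁.var 168)).setVar 176 0).setVar 88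
            (((m₁.setVar 192 (m₁.var 2 + m₁.var 168)).setVar 176 0).var 3 +
              ((m₁.setVar 192 (m₁.var 2 + m₁.var 168)).setVar 176 0).var 7))
          (by
            refine ⟨?_, ?_, ?_, ?_, ?_⟩
            rotate_left 4
            · intro v hv
              have a1 : 200 + 8 * v ≠ 88 := by omega
              have a2 : 200 + 8 * v ≠ 176 := by omega
              have a3 : 200 + 8 * v ≠ 192 := by omega
              simp [Memory.setVar, a1, a2, a3, g₁ (200 + 8 * v) (by omega) (by omega) (by omega),
                bK v hv]
            all_goals simp [Memory.setVar, *])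
          (by simp [Memory.setVar, *]) (by simp [Memory.setVar, *]) (by simp [Memory.setVar, *])
          (by simp [Memory.setVar, *]) (by simp [Memory.setVar, *]) (by simp [Memory.setVar, *])
          (by simp [Memory.setVar, *]) (by simp [Memory.setVar, *])
        have E := (Exec.plus m 184 160 7).seq <| e₁.seq <| (Exec.plus m₁ 192 2 168).seq <|
          (Exec.const _ 176 0).seq <| (Exec.plus _ 88 3 7).seq <| e₂.seq <|
          (Exec.plus m₂ 168 168 16).seq (.minus _ 80 80 16)
        simp only [List.append_nil, List.nil_append] at E
        obtain ⟨d2, d3, d7, d16, dK⟩ := hB₂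
        refine ⟨_, _, E, by omega, ⟨?_, ?_, ?_, ?_, ?_⟩, ?_, ?_, ?_, ?_⟩
        rotate_left 4
        · intro v hv
          have a1 : 200 + 8 * v ≠ 80 := by omega
          have a2 : 200 + 8 * v ≠ 168 := by omega
          simp [Memory.setVar, a1, a2, dK v hv]
        all_goals simp [Memory.setVar, *]
        omega) m (by simp [*])
    exact ⟨t, m', e, by simpa [add_assoc] using ht, hB', k72, k160⟩
  obtain ⟨t₁, m₁, e₁, ht₁, -⟩ := Exec.count_loop (x := 72) (N := N₁ l)
    (T := N₂ l * (N₃ l * (gs.length + 4) + 3 * N₂ l + 12) + 5) (c := in₁)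
    (fun i m => Base m ∧ m.var 72 = N₁ l - i ∧ m.var 160 = i)
    (fun i => (List.range (N₂ l)).flatMap fun c => (List.range (N₃ l)).flatMap fun j =>
      gs.map (Gate.map (loopEnv (N₂ l) i c j)))
    (fun j m _ h => h.2.1)
    (by
      rintro i m hi ⟨⟨b2, b3, b7, b16, bK⟩, h72, h160⟩
      obtain ⟨t₂, m₂, e₂, ht₂, ⟨d2, d3, d7, d16, dK⟩, k72, k160⟩ := run₂ i
        ((m.setVar 168 0).setVar 80 ((m.setVar 168 0).var 2 + (m.setVar 168 0).var 7))
        (by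
          refine ⟨?_, ?_, ?_, ?_, ?_⟩
          rotate_left 4
          · intro v hv
            have a1 : 200 + 8 * v ≠ 80 := by omega
            have a2 : 200 + 8 * v ≠ 168 := by omega
            simp [Memory.setVar, a1, a2, bK v hv]
          all_goals simp [Memory.setVar, *])
        (by simp [Memory.setVar, *]) (by simp [Memory.setVar, *]) (by simp [Memory.setVar, *])
        (by simp [Memory.setVar, *])
      have E := (Exec.const m 168 0).seq <| (Exec.plus _ 80 2 7).seq <| e₂.seq <|
        (Exec.plus m₂ 160 160 16).seq (.minus _ 72 72 16)
      simp only [List.append_nil, List.nil_append] at E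
      refine ⟨_, _, E, by omega, ⟨?_, ?_, ?_, ?_, ?_⟩, ?_, ?_⟩
      rotate_left 4
      · intro v hv
        have a1 : 200 + 8 * v ≠ 72 := by omega
        have a2 : 200 + 8 * v ≠ 160 := by omega
        simp [Memory.setVar, a1, a2, dK v hv]
      all_goals simp [Memory.setVar, *]
      omega)
    ((m''.setVar 160 0).setVar 72 ((m''.setVar 160 0).var 1 + (m''.setVar 160 0).var 7))
    (by
      refine ⟨⟨?_, ?_, ?_, ?_, ?_⟩, ?_, ?_⟩
      rotate_left 4
      · intro v hv
        have a1 : 200 + 8 * v ≠ 72 := by omega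
        have a2 : 200 + 8 * v ≠ 160 := by omega
        simp [Memory.setVar, a1, a2, hcon v hv]
      all_goals simp [Memory.setVar, hf, w7, w1, w2, v₃])
  have E := e.seq <| e'.seq <| (Exec.const m' 16 1).seq <| e''.seq <| (Exec.const _ 160 0).seq <|
    (Exec.plus _ 72 1 7).seq e₁
  simp only [List.nil_append] at E
  refine ⟨_, _, E, ?_⟩
  have b₁ := hq₁ l
  have b₂ := hq₂ l
  have b₃ := hq₃ l
  have : N₁ l * (N₂ l * (N₃ l * (gs.length + 4) + 3 * N₂ l + 12) + 5 + 1) ≤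
      q₁.eval l * (q₂.eval l * (q₃.eval l * (gs.length + 4) + 3 * q₂.eval l + 12) + 6) := by
    change _ ≤ q₁.eval l * (q₂.eval l * (q₃.eval l * (gs.length + 4) + 3 * q₂.eval l + 12) + 5 + 1)
    gcongr
  simp only [Polynomial.eval_add, Polynomial.eval_mul, Polynomial.eval_C, Polynomial.eval_ofNat] at ht ⊢
  omega

/-! ### Gates as controlled one-qubit unitaries -/

/-- The wires on which a gate acts. -/
def Gate.wires : Gate → List Wire
  | .not a => [a]
  | .cnot a b => [a, b]
  | .toffoli a b c => [a, b, c]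
  | .u _ _ a => [a]

/-- The wire that a gate may change. -/
def Gate.target : Gate → Wire
  | .not a => a
  | .cnot _ b => b
  | .toffoli _ _ c => c
  | .u _ _ a => a

/-- The unitary `NOT`. -/
def bitFlip : Matrix.unitaryGroup Bool ℂ :=
  ⟨Matrix.of fun b b' => if b = b' then 0 else 1, by
    rw [Matrix.mem_unitaryGroup_iff]
    ext b b'
    cases b <;> cases b' <;> simp [Matrix.mul_apply, Matrix.star_apply]⟩

theorem bitFlip_apply (b b' : Bool) : bitFlip.1 b b' = if b = b' then 0 else 1 := rfl

theorem bitFlip_inv : bitFlip⁻¹ = bitFlip := by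
  rw [inv_eq_iff_mul_eq_one]
  ext b b'
  simp only [Matrix.UnitaryGroup.mul_val, Matrix.mul_apply, bitFlip_apply]
  cases b <;> cases b' <;> simp

/-- The unitary applied to the target, depending on the controls. -/
def Gate.mat (U : Alphabet) : Gate → Basis → Matrix.unitaryGroup Bool ℂ
  | .not _, _ => bitFlip
  | .cnot a b, z => if a ≠ b ∧ z a = true then bitFlip else 1
  | .toffoli a b c, z => if (a ≠ c ∧ b ≠ c) ∧ z a = true ∧ z b = true then bitFlip else 1
  | .u inv j _, _ => if inv then (U j)⁻¹ else U j

theorem Gate.target_mem (g : Gate) : g.target ∈ g.wires := by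
  cases g <;> simp [Gate.target, Gate.wires]

theorem single_act_eq (z : Basis) (t : Wire) (v : Bool) (V : Matrix.unitaryGroup Bool ℂ)
    (hV : ∀ b, V.1 b (z t) = if b = v then 1 else 0) :
    (Finsupp.single (Function.update z t v) 1 : State) =
      ∑ b : Bool, Finsupp.single (Function.update z t b) (V.1 b (z t)) := by
  simp only [hV]
  cases v <;> simp

/-- All gates take one form, a one-qubit unitary on the target selected by the other wires.
Locality, unitarity and inversion can then be proved without distinguishing kinds of gates. -/
theorem Gate.onBasis_eq (U : Alphabet) (g : Gate) (z : Basis) :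
    g.onBasis U z = ∑ b : Bool, Finsupp.single (Function.update z g.target b)
      ((g.mat U z).1 b (z g.target)) := by
  have one_apply : ∀ b b' : Bool, (1 : Matrix.unitaryGroup Bool ℂ).1 b b' = if b = b' then 1 else 0 :=
    fun b b' => by simp [Matrix.one_apply]
  cases g with
  | u inv j a => rfl
  | not a =>
    refine single_act_eq z a (!z a) bitFlip fun b => ?_
    rw [bitFlip_apply]
    cases b <;> cases z a <;> simp
  | cnot a b =>
    simp only [Gate.onBasis, Gate.act, Gate.target, Gate.mat]
    by_cases h : a ≠ b
    · rw [if_pos h]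
      refine single_act_eq z b _ _ fun v => ?_
      by_cases h' : z a = true
      · rw [if_pos ⟨h, h'⟩, bitFlip_apply, h']
        cases v <;> cases z b <;> simp
      · rw [if_neg (fun h => h' h.2), one_apply]
        simp only [Bool.not_eq_true] at h'
        simp [h']
    · rw [if_neg h, if_neg (fun h' => h h'.1)]
      -- A gate whose target is also its control does nothing, which is the case of the identity
      -- matrix.
      conv_lhs => rw [← Function.update_eq_self b z]
      exact single_act_eq z b _ 1 fun v => by rw [one_apply]
  | toffoli a b c =>
    simp only [Gate.onBasis, Gate.act, Gate.target, Gate.mat]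
    by_cases h : a ≠ c ∧ b ≠ c
    · rw [if_pos h]
      refine single_act_eq z c _ _ fun v => ?_
      by_cases h' : z a = true ∧ z b = true
      · rw [if_pos ⟨h, h'⟩, bitFlip_apply, h'.1, h'.2]
        cases v <;> cases z c <;> simp
      · rw [if_neg (fun h => h' h.2), one_apply]
        have : (z a && z b) = false := by
          rw [← Bool.not_eq_true, Bool.and_eq_true]; exact h'
        simp [this]
    · rw [if_neg h, if_neg (fun h' => h h'.1)]
      conv_lhs => rw [← Function.update_eq_self c z]
      exact single_act_eq z c _ 1 fun v => by rw [one_apply]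

theorem Gate.mat_congr (U : Alphabet) (g : Gate) {z z' : Basis}
    (h : ∀ w ∈ g.wires, w ≠ g.target → z w = z' w) : g.mat U z = g.mat U z' := by
  cases g with
  | u | not => rfl
  | cnot a b =>
    simp only [Gate.mat]
    refine if_congr (and_congr_right fun hab => ?_) rfl rfl
    rw [h a (by simp [Gate.wires]) (by simpa [Gate.target])]
  | toffoli a b c =>
    simp only [Gate.mat]
    refine if_congr (and_congr_right fun hab => ?_) rfl rfl
    rw [h a (by simp [Gate.wires]) (by simpa [Gate.target] using hab.1),
      h b (by simp [Gate.wires]) (by simpa [Gate.target] using hab.2)]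

theorem Gate.mat_update (U : Alphabet) (g : Gate) (z : Basis) (b : Bool) :
    g.mat U (Function.update z g.target b) = g.mat U z :=
  g.mat_congr U fun w _ hw => by simp [hw]

theorem Gate.mat_dagger (U : Alphabet) (g : Gate) (z : Basis) :
    g.dagger.mat U z = (g.mat U z)⁻¹ := by
  cases g with
  | u inv j a => cases inv <;> simp [Gate.dagger, Gate.mat]
  | not => simp [Gate.dagger, Gate.mat, bitFlip_inv]
  | cnot | toffoli => simp only [Gate.dagger, Gate.mat]; split_ifs <;> simp [bitFlip_inv]

theorem Gate.target_dagger (g : Gate) : g.dagger.target = g.target := by cases g <;> rfl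

theorem Gate.wires_dagger (g : Gate) : g.dagger.wires = g.wires := by cases g <;> rfl

theorem Gate.target_relabel (f : Wire → Wire) (g : Gate) :
    (g.relabel f).target = f g.target := by cases g <;> rfl

theorem Gate.wires_relabel (f : Wire → Wire) (g : Gate) :
    (g.relabel f).wires = g.wires.map f := by cases g <;> rfl

theorem Gate.mat_relabel (U : Alphabet) {f : Wire → Wire} (hf : Function.Injective f) (g : Gate)
    (z : Basis) : (g.relabel f).mat U z = g.mat U (z ∘ f) := by
  cases g <;> simp [Gate.relabel, Gate.mat, hf.ne_iff]

theorem Gate.isClassical_relabel (f : Wire → Wire) (g : Gate) :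
    (g.relabel f).IsClassical ↔ g.IsClassical := by cases g <;> rfl

theorem Gate.isClassical_dagger (g : Gate) : g.dagger.IsClassical ↔ g.IsClassical := by
  cases g <;> rfl

theorem Gate.apply_ket (U : Alphabet) (g : Gate) (z : Basis) :
    g.apply U (ket z) = ∑ b : Bool, Finsupp.single (Function.update z g.target b)
      ((g.mat U z).1 b (z g.target)) := by
  simp [Gate.apply, ket, Gate.onBasis_eq]

/-! ### Running circuits -/

theorem run_append (U : Alphabet) (C D : List Gate) (ψ : State) :
    run U (C ++ D) ψ = run U D (run U C ψ) := by simp [run]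

theorem run_cons (U : Alphabet) (g : Gate) (C : List Gate) (ψ : State) :
    run U (g :: C) ψ = run U C (g.apply U ψ) := rfl

/-- `run` as a linear map. -/
def runLin (U : Alphabet) : List Gate → State →ₗ[ℂ] State
  | [] => LinearMap.id
  | g :: C => runLin U C ∘ₗ g.apply U

theorem run_eq (U : Alphabet) (C : List Gate) : run U C = runLin U C := by
  induction C with
  | nil => rfl
  | cons g C ih => funext ψ; rw [run_cons, ih]; rfl

theorem run_smul (U : Alphabet) (C : List Gate) (a : ℂ) (ψ : State) :
    run U C (a • ψ) = a • run U C ψ := by simp [run_eq]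

theorem run_sum (U : Alphabet) (C : List Gate) {ι : Type*} (s : Finset ι) (ψ : ι → State) :
    run U C (∑ i ∈ s, ψ i) = ∑ i ∈ s, run U C (ψ i) := by simp [run_eq]

/-- Two linear maps on states agree if they agree on basis states. -/
theorem State.linearMap_ext {A B : State →ₗ[ℂ] State} (h : ∀ z, A (ket z) = B (ket z)) : A = B := by
  ext z : 2
  simpa [ket] using h z

/-- A map of basis states as a linear map. -/
def mapLin (κ : Basis → Basis) : State →ₗ[ℂ] State := Finsupp.lmapDomain ℂ ℂ κ

theorem mapLin_apply (κ : Basis → Basis) (ψ : State) : mapLin κ ψ = Finsupp.mapDomain κ ψ := rfl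

theorem mapLin_ket (κ : Basis → Basis) (z : Basis) : mapLin κ (ket z) = ket (κ z) := by
  simp [mapLin_apply, ket]

/-- An intertwining criterion: `κ` has to respect the controls, the target bit and updates of the
target. It is used both for moving circuits to other wires and for changing bits on wires that a
circuit does not touch. -/
theorem Gate.apply_mapLin (U : Alphabet) (g g' : Gate) (κ : Basis → Basis)
    (hm : ∀ z, g'.mat U (κ z) = g.mat U z) (hv : ∀ z, κ z g'.target = z g.target)
    (hu : ∀ z b, κ (Function.update z g.target b) = Function.update (κ z) g'.target b) (ψ : State) :
    g'.apply U (mapLin κ ψ) = mapLin κ (g.apply U ψ) := by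
  have : g'.apply U ∘ₗ mapLin κ = mapLin κ ∘ₗ g.apply U := by
    refine State.linearMap_ext fun z => ?_
    simp only [LinearMap.comp_apply, mapLin_ket, Gate.apply_ket, map_sum, hm, hv]
    refine Finset.sum_congr rfl fun b _ => ?_
    rw [mapLin_apply, Finsupp.mapDomain_single, hu]
  exact LinearMap.congr_fun this ψ

theorem update_extend {f : Wire → Wire} (hf : Function.Injective f) (z z' : Basis) (w : Wire)
    (b : Bool) : Function.update (Function.extend f z' z) (f w) b =
      Function.extend f (Function.update z' w b) z := by
  funext v
  by_cases hv : ∃ u, f u = v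
  · obtain ⟨u, rfl⟩ := hv
    rw [hf.extend_apply]
    by_cases h : u = w
    · subst h; simp
    · rw [Function.update_of_ne (hf.ne h), Function.update_of_ne h, hf.extend_apply]
  · rw [Function.extend_apply' _ _ _ hv, Function.update_of_ne, Function.extend_apply' _ _ _ hv]
    rintro rfl
    exact hv ⟨w, rfl⟩

/-- Running a relabelled circuit. -/
theorem run_relabel (U : Alphabet) {f : Wire → Wire} (hf : Function.Injective f) (C : List Gate)
    (z : Basis) (ψ : State) :
    run U (relabel f C) (mapLin (fun z' => Function.extend f z' z) ψ) =
      mapLin (fun z' => Function.extend f z' z) (run U C ψ) := by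
  induction C generalizing ψ with
  | nil => rfl
  | cons g C ih =>
    simp only [relabel, List.map_cons, run_cons] at ih ⊢
    rw [Gate.apply_mapLin U g, ih]
    · intro z'
      rw [Gate.mat_relabel U hf]
      congr 1
      funext w
      simp [hf.extend_apply]
    · intro z'
      rw [Gate.target_relabel, hf.extend_apply]
    · intro z' b
      rw [Gate.target_relabel, update_extend hf]

theorem extend_comp_self {f : Wire → Wire} (hf : Function.Injective f) (z : Basis) :
    Function.extend f (z ∘ f) z = z := by
  funext v
  by_cases hv : ∃ u, f u = v
  · obtain ⟨u, rfl⟩ := hv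
    rw [hf.extend_apply]; rfl
  · rw [Function.extend_apply' _ _ _ hv]

theorem run_relabel_ket (U : Alphabet) {f : Wire → Wire} (hf : Function.Injective f)
    (C : List Gate) (z : Basis) :
    run U (relabel f C) (ket z) =
      mapLin (fun z' => Function.extend f z' z) (run U C (ket (z ∘ f))) := by
  rw [← run_relabel U hf, mapLin_ket, extend_comp_self hf]

theorem extend_left_injective {f : Wire → Wire} (hf : Function.Injective f) (z : Basis) :
    Function.Injective fun z' : Basis => Function.extend f z' z := by
  intro z₁ z₂ h
  funext w
  have := congrFun h (f w)
  simpa [hf.extend_apply] using this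

/-- All gates of `C` act on wires in `W` only. -/
def WiresIn (C : List Gate) (W : Set Wire) : Prop := ∀ g ∈ C, ∀ w ∈ g.wires, w ∈ W

theorem WiresIn.append {C D : List Gate} {W : Set Wire} (hC : WiresIn C W) (hD : WiresIn D W) :
    WiresIn (C ++ D) W := by
  intro g hg
  rcases List.mem_append.1 hg with h | h
  exacts [hC g h, hD g h]

theorem WiresIn.mono {C : List Gate} {W W' : Set Wire} (hC : WiresIn C W) (h : W ⊆ W') :
    WiresIn C W' := fun g hg w hw => h (hC g hg w hw)

theorem WiresIn.relabel {C : List Gate} (f : Wire → Wire) :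
    WiresIn (relabel f C) (Set.range f) := by
  intro g hg w hw
  obtain ⟨g', -, rfl⟩ := List.mem_map.1 hg
  rw [Gate.wires_relabel] at hw
  obtain ⟨v, -, rfl⟩ := List.mem_map.1 hw
  exact ⟨v, rfl⟩

theorem WiresIn.flatMap {ι : Type*} {L : List ι} {D : ι → List Gate} {W : Set Wire}
    (h : ∀ i ∈ L, WiresIn (D i) W) : WiresIn (L.flatMap D) W := by
  intro g hg
  obtain ⟨i, hi, hg⟩ := List.mem_flatMap.1 hg
  exact h i hi g hg

theorem WiresIn.dagger {C : List Gate} {W : Set Wire} (hC : WiresIn C W) :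
    WiresIn (dagger C) W := by
  intro g hg
  obtain ⟨g', h, rfl⟩ := List.mem_map.1 (List.mem_reverse.1 hg)
  rw [Gate.wires_dagger]
  exact hC g' h

/-- Neither gate changes the bits that determine the unitary or the input bit of the other, so both
orders give the same double sum. -/
theorem Gate.apply_comm (U : Alphabet) {g g' : Gate} (h : ∀ w ∈ g.wires, w ∉ g'.wires) (ψ : State) :
    g.apply U (g'.apply U ψ) = g'.apply U (g.apply U ψ) := by
  have h1 : g.target ≠ g'.target := fun e => h _ g.target_mem (e ▸ g'.target_mem)
  have m1 : ∀ z b, g.mat U (Function.update z g'.target b) = g.mat U z := fun z b =>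
    g.mat_congr U fun w hw _ => Function.update_of_ne (by rintro rfl; exact h _ hw g'.target_mem) _ _
  have m2 : ∀ z b, g'.mat U (Function.update z g.target b) = g'.mat U z := fun z b =>
    g'.mat_congr U fun w hw _ => Function.update_of_ne
      (by rintro rfl; exact h _ g.target_mem hw) _ _
  have : g.apply U ∘ₗ g'.apply U = g'.apply U ∘ₗ g.apply U := by
    refine State.linearMap_ext fun z => ?_
    have single_eq : ∀ (z : Basis) (a : ℂ), (Finsupp.single z a : State) = a • ket z := by
      simp [ket]
    simp only [LinearMap.comp_apply, Gate.apply_ket, single_eq, map_sum, map_smul, m1, m2,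
      Function.update_of_ne h1, Function.update_of_ne h1.symm, Finset.smul_sum, smul_smul]
    rw [Finset.sum_comm]
    refine Finset.sum_congr rfl fun b _ => Finset.sum_congr rfl fun b' _ => ?_
    rw [Function.update_comm h1, mul_comm]
  exact LinearMap.congr_fun this ψ

theorem run_comm (U : Alphabet) {C D : List Gate} {W : Set Wire} (hC : WiresIn C W)
    (hD : WiresIn D Wᶜ) (ψ : State) : run U (C ++ D) ψ = run U (D ++ C) ψ := by
  have one : ∀ (g : Gate) (D : List Gate) (ψ : State), (∀ w ∈ g.wires, w ∈ W) → WiresIn D Wᶜ →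
      run U D (g.apply U ψ) = g.apply U (run U D ψ) := by
    intro g D ψ hg
    induction D generalizing ψ with
    | nil => intro _; rfl
    | cons g' D ih =>
      intro hD
      rw [run_cons, run_cons, Gate.apply_comm U (g := g') (g' := g), ih]
      · exact fun x hx => hD x (by simp [hx])
      · intro w hw hw'
        exact hD g' (by simp) w hw (hg w hw')
  induction C generalizing ψ with
  | nil => simp
  | cons g C ih =>
    rw [List.cons_append, run_cons, ih (fun x hx => hC x (by simp [hx])), run_append, run_append,
      run_cons, one g D ψ (hC g (by simp)) hD]

/-- If `p` does not depend on the targets of the gates in `C`, projecting to `p` commutes with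
running `C`. -/
theorem run_filter (U : Alphabet) (C : List Gate) (p : Basis → Prop) [DecidablePred p]
    (hp : ∀ g ∈ C, ∀ z b, p (Function.update z g.target b) ↔ p z) (ψ : State) :
    run U C (ψ.filter p) = (run U C ψ).filter p := by
  let F : State →ₗ[ℂ] State :=
    { toFun := fun ψ => ψ.filter p
      map_add' := fun _ _ => Finsupp.filter_add
      map_smul' := fun _ _ => Finsupp.filter_smul }
  induction C generalizing ψ with
  | nil => rfl
  | cons g C ih =>
    rw [run_cons, run_cons, ← ih (fun x hx => hp x (by simp [hx]))]
    congr 1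
    have : g.apply U ∘ₗ F = F ∘ₗ g.apply U := by
      refine State.linearMap_ext fun z => ?_
      have hF : ∀ z a, F (Finsupp.single z a) = if p z then Finsupp.single z a else 0 := by
        intro z a
        split_ifs with h
        · exact Finsupp.filter_single_of_pos _ h
        · exact Finsupp.filter_single_of_neg _ h
      simp only [LinearMap.comp_apply, Gate.apply_ket, map_sum, hF, hp g (by simp)]
      by_cases h : p z
      · simp only [ket, hF, h, if_true]
        exact Gate.apply_ket U g z
      · simp [ket, hF, h]
    exact LinearMap.congr_fun this ψ

/-- Every basis state that occurs after running `C` agrees with the initial one off the targets. -/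
theorem eq_of_mem_support_run (U : Alphabet) (C : List Gate) {z z' : Basis}
    (h : z' ∈ (run U C (ket z)).support) {w : Wire} (hw : ∀ g ∈ C, w ≠ g.target) : z' w = z w := by
  have := run_filter U C (fun x => x w = z w) (by
    intro g hg x b
    rw [Function.update_of_ne (hw g hg)]) (ket z)
  rw [show (ket z).filter (fun x => x w = z w) = ket z from Finsupp.filter_single_of_pos _ rfl] at this
  rw [this, Finsupp.support_filter, Finset.mem_filter] at h
  exact h.2

theorem WiresIn.eq_of_mem_support {U : Alphabet} {C : List Gate} {W : Set Wire} (hC : WiresIn C W)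
    {z z' : Basis} (h : z' ∈ (run U C (ket z)).support) {w : Wire} (hw : w ∉ W) : z' w = z w :=
  eq_of_mem_support_run U C h fun g hg e => hw (hC g hg w (e ▸ g.target_mem))

/-! ### Unitarity -/

/-- The inner product of two states. -/
def State.ip (φ ψ : State) : ℂ := ψ.sum fun z c => star (φ z) * c

theorem State.ip_add_right (φ ψ χ : State) : φ.ip (ψ + χ) = φ.ip ψ + φ.ip χ :=
  Finsupp.sum_add_index' (by simp) (by intros; ring)

theorem State.ip_smul_right (φ ψ : State) (a : ℂ) : φ.ip (a • ψ) = a * φ.ip ψ := by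
  rw [State.ip, Finsupp.sum_smul_index (by simp), State.ip, Finsupp.mul_sum]
  exact Finsupp.sum_congr fun z _ => by ring

theorem State.ip_add_left (φ ψ χ : State) : (φ + ψ).ip χ = φ.ip χ + ψ.ip χ := by
  simp only [State.ip, ← Finsupp.sum_add, Finsupp.add_apply, star_add, add_mul]

theorem State.ip_smul_left (φ ψ : State) (a : ℂ) : (a • φ).ip ψ = star a * φ.ip ψ := by
  simp only [State.ip, Finsupp.mul_sum, Finsupp.smul_apply, smul_eq_mul, star_mul', mul_assoc]

theorem State.ip_single (z z' : Basis) (a b : ℂ) :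
    State.ip (Finsupp.single z a) (Finsupp.single z' b) = if z = z' then star a * b else 0 := by
  rw [State.ip, Finsupp.sum_single_index (by simp), Finsupp.single_apply]
  split_ifs <;> simp

/-- By sesquilinearity, isometry only has to be checked on the orthonormal family of basis states.
-/
theorem State.ip_ext {A : State →ₗ[ℂ] State}
    (h : ∀ z z', State.ip (A (ket z)) (A (ket z')) = if z = z' then 1 else 0) (φ ψ : State) :
    State.ip (A φ) (A ψ) = State.ip φ ψ := by
  induction φ using Finsupp.induction_linear with
  | zero => simp [State.ip]
  | add f g hf hg => rw [map_add, State.ip_add_left, State.ip_add_left, hf, hg]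
  | single z a =>
    induction ψ using Finsupp.induction_linear with
    | zero => simp [State.ip]
    | add f g hf hg => rw [map_add, State.ip_add_right, State.ip_add_right, hf, hg]
    | single z' b =>
      have single_eq : ∀ (z : Basis) (a : ℂ), (Finsupp.single z a : State) = a • ket z := by
        simp [ket]
      rw [single_eq z, single_eq z', map_smul, map_smul, State.ip_smul_left, State.ip_smul_left,
        State.ip_smul_right, State.ip_smul_right, h, ket, ket, State.ip_single]
      simp

/-- If two basis states differ off the target, their images have disjoint supports. If they agree
there, the same unitary acts on both, and its columns are orthonormal. -/
theorem Gate.apply_ip (U : Alphabet) (g : Gate) (φ ψ : State) :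
    State.ip (g.apply U φ) (g.apply U ψ) = State.ip φ ψ := by
  refine State.ip_ext (fun z z' => ?_) φ ψ
  rw [Gate.apply_ket, Gate.apply_ket]
  have col : ∀ (V : Matrix.unitaryGroup Bool ℂ) (c c' : Bool),
      star (V.1 true c) * V.1 true c' + star (V.1 false c) * V.1 false c' =
        if c = c' then 1 else 0 := by
    intro V c c'
    have := congrFun (congrFun (Matrix.UnitaryGroup.star_mul_self V) c) c'
    simpa [Matrix.mul_apply, Matrix.star_apply, Matrix.one_apply] using this
  obtain ⟨p, hp⟩ : ∃ p : Prop, p ↔ ∀ w, w ≠ g.target → z w = z' w := ⟨_, Iff.rfl⟩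
  have eq_iff : ∀ b b', Function.update z g.target b = Function.update z' g.target b' ↔
      b = b' ∧ p := by
    intro b b'
    rw [hp]
    constructor
    · intro h
      refine ⟨by simpa using congrFun h g.target, fun w hw => ?_⟩
      simpa [hw] using congrFun h w
    · rintro ⟨rfl, h⟩
      funext w
      by_cases hw : w = g.target
      · subst hw; simp
      · simp [hw, h w hw]
  simp only [Fintype.sum_bool, State.ip_add_left, State.ip_add_right, State.ip_single, eq_iff]
  by_cases h' : p
  · have h := hp.1 h'
    rw [g.mat_congr U (z := z') (z' := z) fun w _ hw => (h w hw).symm]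
    have h2 : z = z' ↔ z g.target = z' g.target := by
      refine ⟨fun e => by rw [e], fun e => funext fun w => ?_⟩
      by_cases hw : w = g.target
      · rw [hw, e]
      · exact h w hw
    simpa [h', h2] using col (g.mat U z) (z g.target) (z' g.target)
  · have : z ≠ z' := fun e => h' (hp.2 fun w _ => by rw [e])
    simp [h', this]

theorem run_ip (U : Alphabet) (C : List Gate) (φ ψ : State) :
    State.ip (run U C φ) (run U C ψ) = State.ip φ ψ := by
  induction C generalizing φ ψ with
  | nil => rfl
  | cons g C ih => rw [run_cons, run_cons, ih, Gate.apply_ip]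

theorem Gate.dagger_apply (U : Alphabet) (g : Gate) (ψ : State) :
    g.dagger.apply U (g.apply U ψ) = ψ := by
  have : g.dagger.apply U ∘ₗ g.apply U = LinearMap.id := by
    refine State.linearMap_ext fun z => ?_
    have single_eq : ∀ (z : Basis) (a : ℂ), (Finsupp.single z a : State) = a • ket z := by
      simp [ket]
    have col : ∀ b : Bool, (g.mat U z)⁻¹.1 b true * (g.mat U z).1 true (z g.target) +
        (g.mat U z)⁻¹.1 b false * (g.mat U z).1 false (z g.target) =
          if b = z g.target then 1 else 0 := by
      intro b
      have := congrFun (congrFun (Matrix.UnitaryGroup.star_mul_self (g.mat U z)) b) (z g.target)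
      simpa [Matrix.mul_apply, Matrix.one_apply] using this
    simp only [LinearMap.comp_apply, Gate.apply_ket, single_eq, map_sum, map_smul,
      Gate.mat_dagger, Gate.target_dagger, Gate.mat_update, Function.update_self,
      Function.update_idem, Finset.smul_sum, smul_smul, LinearMap.id_apply]
    rw [Finset.sum_comm]
    simp only [← Finset.sum_smul, Fintype.sum_bool, mul_comm ((g.mat U z).1 _ _)]
    rw [col, col]
    cases h : z g.target <;> simp [← h]
  exact LinearMap.congr_fun this ψ

theorem run_dagger_run (U : Alphabet) (C : List Gate) (ψ : State) :
    run U (dagger C) (run U C ψ) = ψ := by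
  induction C generalizing ψ with
  | nil => rfl
  | cons g C ih =>
    have : dagger (g :: C) = dagger C ++ [g.dagger] := by simp [dagger]
    rw [this, run_append, run_cons U g C, ih]
    exact g.dagger_apply U ψ

/-! ### Expectations -/

theorem State.expect_nonneg (ψ : State) {φ : Basis → ℝ} (h : ∀ z, 0 ≤ φ z) : 0 ≤ ψ.expect φ :=
  Finset.sum_nonneg fun z _ => mul_nonneg (by positivity) (h z)

theorem State.expect_congr {ψ : State} {φ φ' : Basis → ℝ} (h : ∀ z ∈ ψ.support, φ z = φ' z) :
    ψ.expect φ = ψ.expect φ' :=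
  Finset.sum_congr rfl fun z hz => by simp [h z hz]

theorem State.expect_ket (z : Basis) (φ : Basis → ℝ) : (ket z).expect φ = φ z := by
  rw [State.expect, ket, Finsupp.sum_single_index] <;> simp

theorem State.expect_smul (ψ : State) (a : ℂ) (φ : Basis → ℝ) :
    (a • ψ).expect φ = ‖a‖ ^ 2 * ψ.expect φ := by
  rw [State.expect, Finsupp.sum_smul_index (by simp), State.expect, Finsupp.mul_sum]
  exact Finsupp.sum_congr fun z _ => by rw [norm_mul]; ring

theorem State.expect_sum {ι : Type*} (ψ : State) (s : Finset ι) (φ : ι → Basis → ℝ) :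
    ψ.expect (fun z => ∑ i ∈ s, φ i z) = ∑ i ∈ s, ψ.expect (φ i) := by
  simp only [State.expect, Finsupp.sum, Finset.mul_sum]
  exact Finset.sum_comm

theorem State.expect_const_mul (ψ : State) (a : ℝ) (φ : Basis → ℝ) :
    ψ.expect (fun z => a * φ z) = a * ψ.expect φ := by
  rw [State.expect, State.expect, Finsupp.mul_sum]
  exact Finsupp.sum_congr fun z _ => by ring

theorem State.expect_add (ψ : State) (φ φ' : Basis → ℝ) :
    ψ.expect (fun z => φ z + φ' z) = ψ.expect φ + ψ.expect φ' := by
  simp only [State.expect, Finsupp.sum, mul_add, Finset.sum_add_distrib]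

theorem State.expect_mono (ψ : State) {φ φ' : Basis → ℝ} (h : ∀ z ∈ ψ.support, φ z ≤ φ' z) :
    ψ.expect φ ≤ ψ.expect φ' :=
  Finset.sum_le_sum fun z hz => mul_le_mul_of_nonneg_left (h z hz) (by positivity)

theorem State.expect_mapLin {κ : Basis → Basis} (hκ : Function.Injective κ) (ψ : State)
    (φ : Basis → ℝ) : (mapLin κ ψ).expect φ = ψ.expect (φ ∘ κ) :=
  Finsupp.sum_mapDomain_index_inj hκ

theorem State.expect_eq_sum {ψ : State} {s : Finset Basis} (hs : ψ.support ⊆ s) (φ : Basis → ℝ) :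
    ψ.expect φ = ∑ z ∈ s, ‖ψ z‖ ^ 2 * φ z :=
  Finset.sum_subset hs fun z _ hz => by simp [Finsupp.notMem_support_iff.1 hz]

/-- Without common basis states there is no interference, so squared amplitudes add. -/
theorem State.expect_sum_of_disjoint {ι : Type*} (s : Finset ι) (ψ : ι → State) (φ : Basis → ℝ)
    (h : ∀ i ∈ s, ∀ j ∈ s, i ≠ j → ∀ z, z ∈ (ψ i).support → z ∉ (ψ j).support) :
    (∑ i ∈ s, ψ i).expect φ = ∑ i ∈ s, (ψ i).expect φ := by
  induction s using Finset.induction_on with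
  | empty => simp [State.expect]
  | insert a s ha ih =>
    rw [Finset.sum_insert ha, Finset.sum_insert ha,
      ← ih fun i hi j hj => h i (by simp [hi]) j (by simp [hj])]
    refine Finsupp.sum_add_index_of_disjoint ?_ _
    rw [Finset.disjoint_left]
    intro z hz hz'
    obtain ⟨j, hj, hz''⟩ := Finset.mem_biUnion.1 (Finsupp.support_finsetSum hz')
    exact h a (by simp) j (by simp [hj]) (by rintro rfl; exact ha hj) z hz hz''

theorem State.expect_filter (ψ : State) (p : Basis → Prop) [DecidablePred p] (φ : Basis → ℝ) :
    State.expect (ψ.filter p) φ = ψ.expect fun z => if p z then φ z else 0 := by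
  rw [State.expect_eq_sum (s := ψ.support) (by rw [Finsupp.support_filter]; exact Finset.filter_subset _ _),
    State.expect_eq_sum subset_rfl]
  refine Finset.sum_congr rfl fun z _ => ?_
  rw [Finsupp.filter_apply]
  split_ifs <;> simp

theorem State.ip_self (ψ : State) : State.ip ψ ψ = (ψ.expect fun _ => 1 : ℝ) := by
  simp only [State.ip, State.expect, Finsupp.sum, mul_one, Complex.ofReal_sum]
  refine Finset.sum_congr rfl fun z _ => ?_
  have := Complex.conj_mul' (ψ z)
  simpa using this

theorem run_expect_one (U : Alphabet) (C : List Gate) (ψ : State) :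
    (run U C ψ).expect (fun _ => 1) = ψ.expect fun _ => 1 := by
  have := run_ip U C ψ ψ
  rw [State.ip_self, State.ip_self] at this
  exact_mod_cast this

theorem State.eq_sum_ket (ψ : State) : ψ = ∑ z ∈ ψ.support, ψ z • ket z := by
  conv_lhs => rw [← Finsupp.sum_single ψ]
  simp [Finsupp.sum, ket]

/-- Measuring wires that a circuit does not change before running it is harmless. -/
theorem run_expect_eq (U : Alphabet) (C : List Gate) (ψ : State) (φ : Basis → ℝ)
    (h : ∀ z ∈ ψ.support, ∀ z' ∈ ψ.support, z ≠ z' → ∃ w, z w ≠ z' w ∧ ∀ g ∈ C, w ≠ g.target) :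
    (run U C ψ).expect φ = ψ.expect fun z => (run U C (ket z)).expect φ := by
  conv_lhs => rw [ψ.eq_sum_ket, run_sum]
  rw [State.expect_sum_of_disjoint]
  · simp only [run_smul, State.expect_smul]
    rfl
  · intro z hz z' hz' hne x hx hx'
    rw [run_smul] at hx hx'
    obtain ⟨w, hw, hw'⟩ := h z hz z' hz' hne
    apply hw
    rw [← eq_of_mem_support_run U C (Finsupp.support_smul hx) hw',
      ← eq_of_mem_support_run U C (Finsupp.support_smul hx') hw']

/-- Running a circuit and evaluating a functional that only depends on the wires in `W`. -/
theorem WiresIn.expect_congr {U : Alphabet} {C : List Gate} {W : Set Wire} (hC : WiresIn C W)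
    {z z' : Basis} (hz : ∀ w ∈ W, z w = z' w) {φ : Basis → ℝ}
    (hφ : ∀ x x' : Basis, (∀ w ∈ W, x w = x' w) → φ x = φ x') :
    (run U C (ket z)).expect φ = (run U C (ket z')).expect φ := by
  -- Adding the difference of `z` and `z'` is invisible on `W`, hence commutes with the circuit, and
  -- it carries one input to the other.
  let κ : Basis → Basis := fun x w => xor (x w) (xor (z w) (z' w))
  have hκ : Function.Injective κ := by
    intro x y h
    funext w
    have := congrFun h w
    simpa [κ] using this
  have hW : ∀ x w, w ∈ W → κ x w = x w := by
    intro x w hw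
    simp [κ, hz w hw]
  have hκz : κ z = z' := by
    funext w
    simp [κ]
  have key : ∀ ψ, run U C (mapLin κ ψ) = mapLin κ (run U C ψ) := by
    induction C with
    | nil => intro ψ; rfl
    | cons g C ih =>
      intro ψ
      have hg := hC g (by simp)
      rw [run_cons, run_cons, Gate.apply_mapLin U g g κ, ih (fun x hx => hC x (by simp [hx]))]
      · exact fun x => g.mat_congr U fun w hw _ => hW x w (hg w hw)
      · exact fun x => hW x _ (hg _ g.target_mem)
      · intro x b
        funext w
        by_cases hw : w = g.target
        · subst hw
          rw [hW _ _ (hg _ g.target_mem)]; simp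
        · simp [κ, hw]
  have := key (ket z)
  rw [mapLin_ket, hκz] at this
  rw [this, State.expect_mapLin hκ]
  exact State.expect_congr fun x _ => hφ _ _ fun w hw => (hW x w hw).symm

/-- Circuits on disjoint sets of wires produce independent results. -/
theorem expect_parallel (U : Alphabet) (N : ℕ) (D : ℕ → List Gate) (W : ℕ → Set Wire)
    (hD : ∀ c < N, WiresIn (D c) (W c)) (hW : ∀ c c', c ≠ c' → ∀ w, w ∈ W c → w ∉ W c')
    (F : ℕ → Basis → ℝ) (hF : ∀ c, ∀ x x' : Basis, (∀ w ∈ W c, x w = x' w) → F c x = F c x')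
    (z : Basis) :
    (run U ((List.range N).flatMap D) (ket z)).expect (fun x => ∏ c ∈ Finset.range N, F c x) =
      ∏ c ∈ Finset.range N, (run U (D c) (ket z)).expect (F c) := by
  induction N with
  | zero => simp [run, State.expect_ket]
  | succ N ih =>
    have hrange : WiresIn ((List.range N).flatMap D) {w | ∃ c < N, w ∈ W c} :=
      WiresIn.flatMap fun c hc => (hD c (by have := List.mem_range.1 hc; omega)).mono
        fun w hw => ⟨c, List.mem_range.1 hc, hw⟩
    -- The last circuit acts outside the wires of the earlier ones, so the results of these may be
    -- regarded as measured before it runs. Its own input is then still the initial one on `W N`.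
    rw [List.range_succ, List.flatMap_append, run_append, run_expect_eq]
    · rw [List.flatMap_singleton]
      have step : ∀ x ∈ (run U ((List.range N).flatMap D) (ket z)).support,
          (run U (D N) (ket x)).expect (fun x => ∏ c ∈ Finset.range (N + 1), F c x) =
            (run U (D N) (ket z)).expect (F N) * ∏ c ∈ Finset.range N, F c x := by
        intro x hx
        rw [mul_comm, ← (hD N (by omega)).expect_congr (U := U) (z := x) (z' := z) _ (hF N),
          ← State.expect_const_mul]
        · refine State.expect_congr fun y hy => ?_
          rw [Finset.prod_range_succ]
          congr 1
          refine Finset.prod_congr rfl fun c hc => hF c _ _ fun w hw => ?_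
          refine (hD N (by omega)).eq_of_mem_support hy ?_
          exact hW c N (by have := Finset.mem_range.1 hc; omega) w hw
        · intro w hw
          refine hrange.eq_of_mem_support hx ?_
          rintro ⟨c, hc, hw'⟩
          exact hW c N (by omega) w hw' hw
      rw [State.expect_congr step, State.expect_const_mul, ih fun c hc => hD c (by omega),
        Finset.prod_range_succ, mul_comm]
    · intro x hx x' hx' hne
      obtain ⟨w, hw⟩ : ∃ w, x w ≠ x' w := by
        by_contra hcon
        push Not at hcon
        exact hne (funext hcon)
      refine ⟨w, hw, fun g hg e => hw ?_⟩
      rw [List.flatMap_singleton] at hg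
      have hwN : w ∈ W N := hD N (by omega) g hg w (e ▸ g.target_mem)
      have hw' : w ∉ {w | ∃ c < N, w ∈ W c} := by
        rintro ⟨c, hc, hw'⟩
        exact hW c N (by omega) w hw' hwN
      rw [hrange.eq_of_mem_support hx hw', hrange.eq_of_mem_support hx' hw']

/-- A statement about the wires in `W` that holds for every result of a circuit. -/
theorem forall_support_parallel (U : Alphabet) (N : ℕ) (D : ℕ → List Gate) (W : ℕ → Set Wire)
    (hD : ∀ c < N, WiresIn (D c) (W c)) (hW : ∀ c c', c ≠ c' → ∀ w, w ∈ W c → w ∉ W c')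
    (p : ℕ → Basis → Prop)
    (hp : ∀ c, ∀ x x' : Basis, (∀ w ∈ W c, x w = x' w) → (p c x ↔ p c x'))
    (z : Basis) (h : ∀ c < N, ∀ x ∈ (run U (D c) (ket z)).support, p c x) :
    ∀ x ∈ (run U ((List.range N).flatMap D) (ket z)).support, ∀ c < N, p c x := by
  have h0 : ∀ c₀ < N, (run U ((List.range N).flatMap D) (ket z)).expect
      (fun x => if p c₀ x then 0 else 1) = 0 := by
    intro c₀ hc₀
    -- Independence is applied to the indicator of failure at `c₀`; its expectation vanishes, so no
    -- basis state of the support can fail.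
    have := expect_parallel U N D W hD hW (fun c x => if c = c₀ then (if p c₀ x then 0 else 1) else 1)
      (by
        intro c x x' hx
        split_ifs with h1 h2 h3 h3
        · rfl
        · subst h1; exact absurd ((hp c x x' hx).1 h2) h3
        · subst h1; exact absurd ((hp c x x' hx).2 h3) h2
        · rfl
        · rfl) z
    simp only [Finset.prod_ite_eq', Finset.mem_range, hc₀, if_true] at this
    rw [this]
    refine Finset.prod_eq_zero (Finset.mem_range.2 hc₀) ?_
    simp only [if_true]
    exact Finset.sum_eq_zero fun x hx => by simp [h c₀ hc₀ x hx]
  intro x hx c hc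
  by_contra hx'
  have := (Finset.sum_eq_zero_iff_of_nonneg (fun y _ => by positivity)).1 (h0 c hc) x hx
  simp [hx'] at this
  exact (Finsupp.mem_support_iff.1 hx) this

/-- Composing two families of circuits on disjoint sets of wires. -/
theorem run_parallel_append (U : Alphabet) (N : ℕ) (A B : ℕ → List Gate) (W : ℕ → Set Wire)
    (hA : ∀ c < N, WiresIn (A c) (W c)) (hB : ∀ c < N, WiresIn (B c) (W c))
    (hW : ∀ c c', c ≠ c' → ∀ w, w ∈ W c → w ∉ W c') (ψ : State) :
    run U ((List.range N).flatMap A ++ (List.range N).flatMap B) ψ =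
      run U ((List.range N).flatMap fun c => A c ++ B c) ψ := by
  induction N with
  | zero => rfl
  | succ N ih =>
    have h1 : WiresIn (A N) (W N) := hA N (by omega)
    have h2 : WiresIn ((List.range N).flatMap B) (W N)ᶜ :=
      WiresIn.flatMap fun c hc => (hB c (by have := List.mem_range.1 hc; omega)).mono
        fun w hw hw' => hW c N (by have := List.mem_range.1 hc; omega) w hw hw'
    simp only [List.range_succ, List.flatMap_append, List.flatMap_singleton]
    have c := run_comm U h1 h2 (run U ((List.range N).flatMap A) ψ)
    have i := ih (fun c hc => hA c (by omega)) fun c hc => hB c (by omega)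
    simp only [run_append] at c i ⊢
    rw [c, i]

/-! ### Classical circuits -/

theorem Gate.apply_classical (U : Alphabet) {g : Gate} (hg : g.IsClassical) (z : Basis) :
    g.apply U (ket z) = ket (g.act z) := by
  cases g with
  | u => exact absurd hg (by simp [Gate.IsClassical])
  | _ => simp [Gate.apply, ket, Gate.onBasis]

theorem runClassical_append (C D : List Gate) (z : Basis) :
    runClassical (C ++ D) z = runClassical D (runClassical C z) := by simp [runClassical]

theorem run_classical_ket (U : Alphabet) {C : List Gate} (hC : ∀ g ∈ C, g.IsClassical) (z : Basis) :
    run U C (ket z) = ket (runClassical C z) := by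
  induction C generalizing z with
  | nil => rfl
  | cons g C ih =>
    rw [run_cons, Gate.apply_classical U (hC g (by simp)), ih fun x hx => hC x (by simp [hx])]
    rfl

theorem run_classical (U : Alphabet) {C : List Gate} (hC : ∀ g ∈ C, g.IsClassical) (ψ : State) :
    run U C ψ = mapLin (runClassical C) ψ := by
  rw [run_eq]
  refine LinearMap.congr_fun (State.linearMap_ext fun z => ?_) ψ
  rw [← run_eq, run_classical_ket U hC, mapLin_ket]

theorem ket_injective : Function.Injective ket := fun z z' h => by
  simpa [ket, Finsupp.single_left_inj] using h

/-- Inherited from the quantum semantics, in which a classical circuit maps kets to kets; the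
alphabet is irrelevant and taken trivial. -/
theorem runClassical_dagger {C : List Gate} (hC : ∀ g ∈ C, g.IsClassical) (z : Basis) :
    runClassical (dagger C) (runClassical C z) = z := by
  have hC' : ∀ g ∈ dagger C, g.IsClassical := by
    intro g hg
    obtain ⟨g', h, rfl⟩ := List.mem_map.1 (List.mem_reverse.1 hg)
    exact (Gate.isClassical_dagger g').2 (hC g' h)
  apply ket_injective
  have := run_dagger_run (fun _ => 1) C (ket z)
  rwa [run_classical_ket _ hC, run_classical_ket _ hC'] at this

theorem runClassical_injective {C : List Gate} (hC : ∀ g ∈ C, g.IsClassical) :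
    Function.Injective (runClassical C) :=
  Function.LeftInverse.injective (runClassical_dagger hC)

theorem run_classical_expect (U : Alphabet) {C : List Gate} (hC : ∀ g ∈ C, g.IsClassical)
    (ψ : State) (φ : Basis → ℝ) : (run U C ψ).expect φ = ψ.expect (φ ∘ runClassical C) := by
  rw [run_classical U hC, State.expect_mapLin (runClassical_injective hC)]

theorem Gate.act_of_ne {g : Gate} {z : Basis} {w : Wire} (hw : w ≠ g.target) : g.act z w = z w := by
  cases g with
  | u => rfl
  | not a => exact Function.update_of_ne hw _ _
  | cnot a b =>
    simp only [Gate.act]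
    split_ifs
    exacts [Function.update_of_ne hw _ _, rfl]
  | toffoli a b c =>
    simp only [Gate.act]
    split_ifs
    exacts [Function.update_of_ne hw _ _, rfl]

theorem runClassical_of_notTarget {C : List Gate} {w : Wire} (hw : ∀ g ∈ C, w ≠ g.target)
    (z : Basis) : runClassical C z w = z w := by
  induction C generalizing z with
  | nil => rfl
  | cons g C ih =>
    change runClassical C (g.act z) w = _
    rw [ih (fun g hg => hw g (by simp [hg])), Gate.act_of_ne (hw g (by simp))]

theorem WiresIn.runClassical_eq {C : List Gate} {W : Set Wire} (hC : WiresIn C W) {w : Wire}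
    (hw : w ∉ W) (z : Basis) : runClassical C z w = z w :=
  runClassical_of_notTarget (by rintro g hg rfl; exact hw (hC g hg _ g.target_mem)) z

/-- The result on a set of wires containing those of the circuit depends only on these wires. -/
theorem WiresIn.runClassical_congr {C : List Gate} {W : Set Wire} (hC : WiresIn C W)
    {z z' : Basis} (hz : ∀ w ∈ W, z w = z' w) :
    ∀ w ∈ W, runClassical C z w = runClassical C z' w := by
  induction C generalizing z z' with
  | nil => exact hz
  | cons g C ih =>
    refine ih (fun x hx => hC x (by simp [hx])) fun w hw => ?_
    have hg := hC g (by simp)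
    cases g with
    | u => exact hz w hw
    | not a =>
      simp only [Gate.act, Function.update_apply, hz w hw, hz a (hg a (by simp [Gate.wires]))]
    | cnot a b =>
      simp only [Gate.act]
      split_ifs
      · simp only [Function.update_apply, hz w hw, hz a (hg a (by simp [Gate.wires])),
          hz b (hg b (by simp [Gate.wires]))]
      · exact hz w hw
    | toffoli a b c =>
      simp only [Gate.act]
      split_ifs
      · simp only [Function.update_apply, hz w hw, hz a (hg a (by simp [Gate.wires])),
          hz b (hg b (by simp [Gate.wires])), hz c (hg c (by simp [Gate.wires]))]
      · exact hz w hw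

theorem runClassical_relabel {f : Wire → Wire} (hf : Function.Injective f) {C : List Gate}
    (hC : ∀ g ∈ C, g.IsClassical) (z : Basis) :
    runClassical (relabel f C) z = Function.extend f (runClassical C (z ∘ f)) z := by
  have hC' : ∀ g ∈ relabel f C, g.IsClassical := by
    intro g hg
    obtain ⟨g', h, rfl⟩ := List.mem_map.1 hg
    exact (Gate.isClassical_relabel f g').2 (hC g' h)
  apply ket_injective
  have := run_relabel_ket (fun _ => 1) hf C z
  rwa [run_classical_ket _ hC', run_classical_ket _ hC, mapLin_ket] at this

/-! ### Loops of controlled NOT gates -/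

/-- The condition under which a classical gate flips its target. -/
def Gate.ctrl : Gate → Basis → Bool
  | .not _, _ => true
  | .cnot a _, z => z a
  | .toffoli a b _, z => z a && z b
  | .u _ _ _, _ => false

/-- Gates whose targets are in the register `t` and whose controls are not. -/
def Gate.Into (t : ℕ) : Gate → Prop
  | .not a => a.1 = t
  | .cnot a b => a.1 ≠ t ∧ b.1 = t
  | .toffoli a b c => a.1 ≠ t ∧ b.1 ≠ t ∧ c.1 = t
  | .u _ _ _ => False

theorem Gate.Into.target {t : ℕ} {g : Gate} (h : g.Into t) : g.target.1 = t := by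
  cases g <;> simp_all [Gate.Into, Gate.target]

theorem Gate.Into.ctrl_congr {t : ℕ} {g : Gate} (h : g.Into t) {z z' : Basis}
    (hz : ∀ w : Wire, w.1 ≠ t → z w = z' w) : g.ctrl z = g.ctrl z' := by
  cases g with
  | not | u => rfl
  | cnot a b => exact hz a h.1
  | toffoli a b c => simp only [Gate.ctrl, hz a h.1, hz b h.2.1]

theorem Gate.Into.act_target {t : ℕ} {g : Gate} (h : g.Into t) (z : Basis) :
    g.act z g.target = xor (z g.target) (g.ctrl z) := by
  cases g with
  | u => exact h.elim
  | not a => simp [Gate.act, Gate.target, Gate.ctrl]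
  | cnot a b =>
    have : a ≠ b := by rintro rfl; exact h.1 h.2
    simp [Gate.act, Gate.target, Gate.ctrl, this]
  | toffoli a b c =>
    have h1 : a ≠ c := by rintro rfl; exact h.1 h.2.2
    have h2 : b ≠ c := by rintro rfl; exact h.2.1 h.2.2
    simp [Gate.act, Gate.target, Gate.ctrl, h1, h2]

theorem Gate.Into.isClassical {t : ℕ} {g : Gate} (h : g.Into t) : g.IsClassical := by
  cases g <;> simp_all [Gate.Into, Gate.IsClassical]

theorem Gate.Into.act_eq {t : ℕ} {g : Gate} (h : g.Into t) (z : Basis) {w : Wire}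
    (hw : g.target = w → g.ctrl z = false) : g.act z w = z w := by
  by_cases e : g.target = w
  · have := h.act_target z
    rw [hw e, e] at this
    simpa using this
  · exact Gate.act_of_ne (Ne.symm e)

theorem Gate.Into.act_of_register_ne {t : ℕ} {g : Gate} (h : g.Into t) (z : Basis) {w : Wire}
    (hw : w.1 ≠ t) : g.act z w = z w :=
  Gate.act_of_ne (by rintro rfl; exact hw h.target)

/-- Since all targets lie in register `t` and all controls outside it, every control keeps its
initial value while the circuit runs. -/
theorem runClassical_into_eq {t : ℕ} {C : List Gate} (hC : ∀ g ∈ C, g.Into t) (z : Basis) {w : Wire}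
    (hw : ∀ g ∈ C, g.target = w → g.ctrl z = false) : runClassical C z w = z w := by
  induction C generalizing z with
  | nil => rfl
  | cons g C ih =>
    change runClassical C (g.act z) w = _
    have hg := hC g (by simp)
    rw [ih (fun x hx => hC x (by simp [hx])), hg.act_eq z (hw g (by simp))]
    intro x hx e
    rw [← hw x (by simp [hx]) e]
    exact (hC x (by simp [hx])).ctrl_congr fun v hv => hg.act_of_register_ne z hv

theorem runClassical_into_of_register_ne {t : ℕ} {C : List Gate} (hC : ∀ g ∈ C, g.Into t)
    (z : Basis) {w : Wire} (hw : w.1 ≠ t) : runClassical C z w = z w :=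
  runClassical_of_notTarget (by rintro g hg rfl; exact hw (hC g hg).target) z

/-- At most one of the gates that may flip the wire `w` is active. -/
theorem runClassical_into_unique {ι : Type*} {t : ℕ} {L : List ι} (hL : L.Nodup) {G : ι → Gate}
    (hG : ∀ x ∈ L, (G x).Into t) (z : Basis) {w : Wire} {x₀ : ι} (hx₀ : x₀ ∈ L)
    (hw : (G x₀).target = w)
    (hu : ∀ x ∈ L, (G x).target = w → (G x).ctrl z = true → x = x₀) :
    runClassical (L.map G) z w = xor (z w) ((G x₀).ctrl z) := by
  obtain ⟨A, B, rfl⟩ := List.append_of_mem hx₀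
  have hnd := List.nodup_append.1 hL
  have hnd2 := List.nodup_cons.1 hnd.2.1
  have hA : ∀ g ∈ A.map G, g.Into t := by
    intro g hg
    obtain ⟨x, hx, rfl⟩ := List.mem_map.1 hg
    exact hG x (by simp [hx])
  have hB : ∀ g ∈ B.map G, g.Into t := by
    intro g hg
    obtain ⟨x, hx, rfl⟩ := List.mem_map.1 hg
    exact hG x (by simp [hx])
  have hx := hG x₀ (by simp)
  rw [List.map_append, runClassical_append, List.map_cons]
  set z₁ := runClassical (A.map G) z
  have hz₁ : ∀ v : Wire, v.1 ≠ t → z₁ v = z v := fun v hv =>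
    runClassical_into_of_register_ne hA z hv
  have hz₁w : z₁ w = z w := by
    refine runClassical_into_eq hA z fun g hg e => ?_
    obtain ⟨x, hxA, rfl⟩ := List.mem_map.1 hg
    by_contra hc
    have := hu x (by simp [hxA]) e (by simpa using hc)
    subst this
    exact hnd.2.2 x hxA x (by simp) rfl
  change runClassical (B.map G) ((G x₀).act z₁) w = _
  rw [runClassical_into_eq hB, ← hw, hx.act_target, hx.ctrl_congr hz₁, hw, hz₁w]
  intro g hg e
  obtain ⟨x, hxB, rfl⟩ := List.mem_map.1 hg
  by_contra hc
  rw [(hG x (by simp [hxB])).ctrl_congr (z' := z) fun v hv => by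
    rw [hx.act_of_register_ne _ hv, hz₁ v hv]] at hc
  have := hu x (by simp [hxB]) e (by simpa using hc)
  subst this
  exact hnd2.1 hxB

theorem loops_single (N₁ N₂ N₃ : ℕ) (g : Gate) : loops N₁ N₂ N₃ [g] =
    (List.range N₁ ×ˢ (List.range N₂ ×ˢ List.range N₃)).map
      fun x => g.map (loopEnv N₂ x.1 x.2.1 x.2.2) := by
  simp [loops, SProd.sprod, List.product, List.map_eq_flatMap, List.flatMap_assoc]

theorem mem_loops_single {N₁ N₂ N₃ : ℕ} {g g' : Gate} : g' ∈ loops N₁ N₂ N₃ [g] ↔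
    ∃ i c j, i < N₁ ∧ c < N₂ ∧ j < N₃ ∧ g.map (loopEnv N₂ i c j) = g' := by
  simp only [loops, List.mem_flatMap, List.mem_range, List.map_cons, List.map_nil,
    List.mem_singleton]
  constructor
  · rintro ⟨i, hi, c, hc, j, hj, rfl⟩
    exact ⟨i, c, j, hi, hc, hj, rfl⟩
  · rintro ⟨i, c, j, hi, hc, hj, rfl⟩
    exact ⟨i, hi, c, hc, j, hj, rfl⟩

/-- The form used for copying: among all iterations only `(i, c, j)` can flip the wire `w`, so the
whole loop acts on `w` as that single gate. -/
theorem runClassical_loops {N₁ N₂ N₃ t : ℕ} {g : Gate}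
    (hg : ∀ i c j, (g.map (loopEnv N₂ i c j)).Into t) (z : Basis) {w : Wire} {i c j : ℕ}
    (hi : i < N₁) (hc : c < N₂) (hj : j < N₃) (hw : (g.map (loopEnv N₂ i c j)).target = w)
    (hu : ∀ i' c' j', i' < N₁ → c' < N₂ → j' < N₃ → (g.map (loopEnv N₂ i' c' j')).target = w →
      (g.map (loopEnv N₂ i' c' j')).ctrl z = true → i' = i ∧ c' = c ∧ j' = j) :
    runClassical (loops N₁ N₂ N₃ [g]) z w = xor (z w) ((g.map (loopEnv N₂ i c j)).ctrl z) := by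
  rw [loops_single]
  refine runClassical_into_unique (t := t) (x₀ := (i, c, j))
    (List.nodup_range.product (List.nodup_range.product List.nodup_range))
    (fun x _ => hg _ _ _) z (by simp [hi, hc, hj]) hw ?_
  rintro ⟨i', c', j'⟩ hx e h
  rw [List.mem_product, List.mem_product] at hx
  simp only [List.mem_range] at hx
  obtain ⟨rfl, rfl, rfl⟩ := hu i' c' j' hx.1 hx.2.1 hx.2.2 e h
  rfl

theorem loops_into {N₁ N₂ N₃ t : ℕ} {g : Gate} (hg : ∀ i c j, (g.map (loopEnv N₂ i c j)).Into t) :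
    ∀ g' ∈ loops N₁ N₂ N₃ [g], g'.Into t := by
  intro g' h
  obtain ⟨i, c, j, -, -, -, rfl⟩ := mem_loops_single.1 h
  exact hg i c j

/-- Copy the first `m` bits of the strings `i < n` from register `a` to register `b`. -/
def copyReg (n m a b : ℕ) : List Gate := loops n 1 m [.cnot (a + 5, 0, 2) (b + 5, 0, 2)]

theorem copyReg_into (n m : ℕ) {a b : ℕ} (hab : a ≠ b) : ∀ g ∈ copyReg n m a b, g.Into b :=
  loops_into fun _ _ _ => ⟨hab, rfl⟩

theorem runClassical_copyReg (n m : ℕ) {a b : ℕ} (hab : a ≠ b) (z : Basis) (w : Wire) :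
    runClassical (copyReg n m a b) z w =
      if w.1 = b ∧ w.2.1 < n ∧ w.2.2 < m then xor (z w) (z (a, w.2)) else z w := by
  obtain ⟨r, i, j⟩ := w
  split_ifs with h
  · obtain ⟨rfl, hi, hj⟩ := h
    refine runClassical_loops (t := r) (g := .cnot (a + 5, 0, 2) (r + 5, 0, 2))
      (fun _ _ _ => ⟨hab, rfl⟩) z (i := i) (c := 0) (j := j) hi
      (by omega) hj rfl ?_
    intro i' c' j' _ hc _ e _
    simp only [Gate.map, Gate.target, loopEnv, Prod.mk.injEq] at e
    omega
  · refine runClassical_of_notTarget (fun g hg e => h ?_) z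
    obtain ⟨i', c', j', hi, hc, hj, rfl⟩ := mem_loops_single.1 hg
    simp only [Gate.map, Gate.target, loopEnv, Prod.mk.injEq] at e
    obtain ⟨rfl, rfl, rfl⟩ := e
    exact ⟨rfl, hi, hj⟩

/-- Copy the strings in register `0` to register `5` of each of `R` interleaved copies. -/
def fanOut (n R m : ℕ) : List Gate := loops n R m [.cnot (0 + 5, 0, 2) (5 + 5, 3, 2)]

theorem fanOut_into (n R m : ℕ) : ∀ g ∈ fanOut n R m, g.Into 5 :=
  loops_into fun _ _ _ => ⟨(by omega : (0 : ℕ) ≠ 5), rfl⟩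

/-- Uniqueness of division with remainder; it keeps interleaved copies apart. -/
theorem mul_add_inj {R i c i' c' : ℕ} (hc : c < R) (hc' : c' < R) (h : i * R + c = i' * R + c') :
    i = i' ∧ c = c' := by
  have hR : 0 < R := by omega
  have h1 : (i * R + c) / R = i := by
    rw [mul_comm, Nat.mul_add_div hR, Nat.div_eq_of_lt hc, add_zero]
  have h2 : (i' * R + c') / R = i' := by
    rw [mul_comm, Nat.mul_add_div hR, Nat.div_eq_of_lt hc', add_zero]
  have : i = i' := by rw [← h1, h, h2]
  subst this
  exact ⟨rfl, by omega⟩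

theorem runClassical_fanOut {n R m i c j : ℕ} (hc : c < R) (z : Basis) :
    runClassical (fanOut n R m) z (5, i * R + c, j) =
      if i < n ∧ j < m then xor (z (5, i * R + c, j)) (z (0, i, j)) else z (5, i * R + c, j) := by
  split_ifs with h
  · refine runClassical_loops (t := 5) (g := .cnot (0 + 5, 0, 2) (5 + 5, 3, 2))
      (fun _ _ _ => ⟨(by omega : (0 : ℕ) ≠ 5), rfl⟩) z (i := i)
      (c := c) (j := j) h.1 hc h.2 rfl ?_
    intro i' c' j' _ hc' _ e _
    simp only [Gate.map, Gate.target, loopEnv, Prod.mk.injEq] at e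
    obtain ⟨h1, h2⟩ := mul_add_inj hc' hc e.2.1
    exact ⟨h1, h2, e.2.2⟩
  · refine runClassical_of_notTarget (fun g hg e => h ?_) z
    obtain ⟨i', c', j', hi, hc', hj, rfl⟩ := mem_loops_single.1 hg
    simp only [Gate.map, Gate.target, loopEnv, Prod.mk.injEq] at e
    obtain ⟨h1, -⟩ := mul_add_inj hc hc' e.2.1
    exact ⟨h1 ▸ hi, e.2.2 ▸ hj⟩

/-- Copy the strings in register `a` of the selected one of `R` interleaved copies to register `b`;
copy `c` is selected if the wire `(6, c, 0)` is on. -/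
def selectReg (n R m a b : ℕ) : List Gate :=
  loops n R m [.toffoli (6 + 5, 1, 5) (a + 5, 3, 2) (b + 5, 0, 2)]

theorem selectReg_into (n R m : ℕ) {a b : ℕ} (hab : a ≠ b) (hb : b ≠ 6) :
    ∀ g ∈ selectReg n R m a b, g.Into b :=
  loops_into fun _ _ _ => ⟨hb.symm, hab, rfl⟩

theorem runClassical_selectReg {n R m a b c : ℕ} (hab : a ≠ b) (hb : b ≠ 6) (hc : c < R) (z : Basis)
    (hz : ∀ c' < R, c' ≠ c → z (6, c', 0) = false) {i j : ℕ} (hi : i < n) (hj : j < m) :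
    runClassical (selectReg n R m a b) z (b, i, j) =
      xor (z (b, i, j)) (z (6, c, 0) && z (a, i * R + c, j)) := by
  refine runClassical_loops (t := b) (g := .toffoli (6 + 5, 1, 5) (a + 5, 3, 2) (b + 5, 0, 2))
    (fun _ _ _ => ⟨hb.symm, hab, rfl⟩) z (i := i) (c := c) (j := j) hi hc hj rfl ?_
  intro i' c' j' _ hc' _ e h
  simp only [Gate.map, Gate.target, loopEnv, Prod.mk.injEq] at e
  simp only [Gate.map, Gate.ctrl, loopEnv, Bool.and_eq_true] at h
  refine ⟨e.2.1, ?_, e.2.2⟩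
  by_contra hne
  rw [hz c' hc' hne] at h
  simp at h

theorem runClassical_selectReg_none {n R m a b : ℕ} (hab : a ≠ b) (hb : b ≠ 6) (z : Basis)
    (hz : ∀ c' < R, z (6, c', 0) = false) (w : Wire) :
    runClassical (selectReg n R m a b) z w = z w := by
  refine runClassical_into_eq (selectReg_into n R m hab hb) z fun g hg e => ?_
  obtain ⟨i', c', j', hi, hc', hj, rfl⟩ := mem_loops_single.1 hg
  simp [Gate.map, Gate.ctrl, loopEnv, hz c' hc']

/-- Copy the strings in register `a` to register `b` if the wire `(4, 0, 0)` is on. -/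
def condReg (n m a b : ℕ) : List Gate :=
  loops n 1 m [.toffoli (4 + 5, 5, 5) (a + 5, 0, 2) (b + 5, 0, 2)]

theorem condReg_into (n m : ℕ) {a b : ℕ} (hab : a ≠ b) (hb : b ≠ 4) :
    ∀ g ∈ condReg n m a b, g.Into b :=
  loops_into fun _ _ _ => ⟨hb.symm, hab, rfl⟩

theorem runClassical_condReg {n m a b : ℕ} (hab : a ≠ b) (hb : b ≠ 4) (z : Basis)
    {i j : ℕ} (hi : i < n) (hj : j < m) :
    runClassical (condReg n m a b) z (b, i, j) =
      xor (z (b, i, j)) (z (4, 0, 0) && z (a, i, j)) := by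
  refine runClassical_loops (t := b) (g := .toffoli (4 + 5, 5, 5) (a + 5, 0, 2) (b + 5, 0, 2))
    (fun _ _ _ => ⟨hb.symm, hab, rfl⟩) z (i := i) (c := 0) (j := j) hi (by omega) hj rfl ?_
  intro i' c' j' _ hc' _ e _
  simp only [Gate.map, Gate.target, loopEnv, Prod.mk.injEq] at e
  omega

/-! ### Finding the first active index -/

/-- If the `c`-th circuit in a sequence turns on the wire `hit c` and turns off the wire `ok` if
`ok` is on and `β c` holds, then in the end the wire `hit c` indicates the first `c` for which
`β c` holds. -/
theorem runClassical_first (N : ℕ) (T : ℕ → List Gate) (ok : Wire) (hit : ℕ → Wire)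
    (hhit : Function.Injective hit) (hok : ∀ c, hit c ≠ ok) (β : ℕ → Basis → Bool)
    (hβ : ∀ c z z', (∀ w, w ≠ ok → (∀ c', w ≠ hit c') → z w = z' w) → β c z = β c z')
    (hT : ∀ c < N, ∀ z, z (hit c) = false → runClassical (T c) z =
      Function.update (Function.update z (hit c) (z ok && β c z)) ok (z ok && !β c z))
    (z : Basis) (hz : z ok = true) (hz' : ∀ c < N, z (hit c) = false) :
    (∀ c < N, runClassical ((List.range N).flatMap T) z (hit c) =
        decide (β c z = true ∧ ∀ c' < c, β c' z = false)) ∧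
      runClassical ((List.range N).flatMap T) z ok = decide (∀ c < N, β c z = false) ∧
      ∀ w, w ≠ ok → (∀ c < N, w ≠ hit c) → runClassical ((List.range N).flatMap T) z w = z w := by
  have key : ∀ M ≤ N, (∀ c < N, runClassical ((List.range M).flatMap T) z (hit c) =
        decide (c < M ∧ β c z = true ∧ ∀ c' < c, β c' z = false)) ∧
      runClassical ((List.range M).flatMap T) z ok = decide (∀ c < M, β c z = false) ∧
      ∀ w, w ≠ ok → (∀ c < N, w ≠ hit c) →
        runClassical ((List.range M).flatMap T) z w = z w := by
    intro M
    induction M with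
    | zero =>
      intro _
      refine ⟨fun c hc => by simpa [runClassical] using hz' c hc, by simpa [runClassical] using hz,
        fun w _ _ => rfl⟩
    | succ M ih =>
      intro hM
      obtain ⟨h1, h2, h3⟩ := ih (by omega)
      rw [List.range_succ, List.flatMap_append, runClassical_append, List.flatMap_singleton]
      set z₁ := runClassical ((List.range M).flatMap T) z
      have hβ₁ : β M z₁ = β M z := hβ M _ _ fun w hw hw' => h3 w hw fun c _ => hw' c
      rw [hT M (by omega) z₁ (by rw [h1 M (by omega)]; simp), hβ₁, h2]
      refine ⟨fun c hc => ?_, ?_, fun w hw hw' => ?_⟩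
      · rw [Function.update_of_ne (hok c)]
        by_cases hcM : c = M
        · subst hcM
          rw [Function.update_self, Bool.eq_iff_iff]
          simp
          tauto
        · rw [Function.update_of_ne (hhit.ne hcM), h1 c hc]
          have : c < M ↔ c < M + 1 := by omega
          simp only [this]
      · rw [Function.update_self, Bool.eq_iff_iff]
        simp only [Bool.and_eq_true, decide_eq_true_eq, Bool.not_eq_true', Order.lt_add_one_iff]
        constructor
        · rintro ⟨h, h'⟩ c hc
          rcases Nat.lt_or_ge c M with h4 | h4
          · exact h c h4
          · rwa [show c = M by omega]
        · exact fun h => ⟨fun c hc => h c (by omega), h M le_rfl⟩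
      · rw [Function.update_of_ne hw, Function.update_of_ne (hw' M (by omega)), h3 w hw hw']
  obtain ⟨h1, h2, h3⟩ := key N le_rfl
  refine ⟨fun c hc => ?_, h2, h3⟩
  rw [h1 c hc]
  simp [hc]

/-! ### Parallel classical circuits -/

theorem runClassical_parallel (N : ℕ) (D : ℕ → List Gate) (W : ℕ → Set Wire)
    (hD : ∀ c < N, WiresIn (D c) (W c)) (hW : ∀ c c', c ≠ c' → ∀ w, w ∈ W c → w ∉ W c') (z : Basis)
    {c : ℕ} (hc : c < N) {w : Wire} (hw : w ∈ W c) :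
    runClassical ((List.range N).flatMap D) z w = runClassical (D c) z w := by
  have key : ∀ M ≤ N, (∀ c < M, ∀ w ∈ W c, runClassical ((List.range M).flatMap D) z w =
      runClassical (D c) z w) ∧ ∀ w, (∀ c < M, w ∉ W c) →
        runClassical ((List.range M).flatMap D) z w = z w := by
    intro M
    induction M with
    | zero => exact fun _ => ⟨fun c hc => absurd hc (by omega), fun w _ => rfl⟩
    | succ M ih =>
      intro hM
      obtain ⟨h1, h2⟩ := ih (by omega)
      rw [List.range_succ, List.flatMap_append, List.flatMap_singleton]
      refine ⟨fun c hc w hw => ?_, fun w hw => ?_⟩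
      · rw [runClassical_append]
        by_cases hcM : c = M
        · subst hcM
          exact (hD c (by omega)).runClassical_congr
            (fun v hv => h2 v fun c' hc' h' => hW c c' (by omega) v hv h') w hw
        · rw [(hD M (by omega)).runClassical_eq (hW c M hcM w hw), h1 c (by omega) w hw]
      · rw [runClassical_append, (hD M (by omega)).runClassical_eq (hw M (by omega)),
          h2 w fun c hc => hw c (by omega)]
  exact (key N le_rfl).1 c hc w hw

theorem place_injective {a b M c : ℕ} (ha : 0 < a) (hM : 0 < M) :
    Function.Injective (place a b M c) := by
  rintro ⟨r, i, j⟩ ⟨r', i', j'⟩ h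
  simp only [place, Prod.mk.injEq] at h
  obtain ⟨h1, h2, h3⟩ := h
  have h1 := Nat.eq_of_mul_eq_mul_right ha (Nat.add_right_cancel h1)
  have h2 := Nat.eq_of_mul_eq_mul_right hM (Nat.add_right_cancel h2)
  subst h1 h2 h3
  rfl

/-- The wires of the `c`-th of `M` interleaved copies. -/
def slot (a b M c : ℕ) : Set Wire := {w | c < M ∧ w ∈ Set.range (place a b M c)}

theorem place_mem_slot {a b M c : ℕ} (hc : c < M) (w : Wire) : place a b M c w ∈ slot a b M c :=
  ⟨hc, w, rfl⟩

/-- The bound `c < M` is part of `slot`, so that disjointness holds for all pairs of indices;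
without it, copies `c` and `c + M` would overlap. -/
theorem slot_disjoint {a b M : ℕ} (c c' : ℕ) (h : c ≠ c') (w : Wire) (hw : w ∈ slot a b M c) :
    w ∉ slot a b M c' := by
  obtain ⟨hc, w, rfl⟩ := hw
  rintro ⟨hc', w', e⟩
  simp only [place, Prod.mk.injEq] at e
  exact h (mul_add_inj hc' hc e.2.1).2.symm

theorem WiresIn.relabel_slot {a b M c : ℕ} (hc : c < M) (C : List Gate) :
    WiresIn (MeasurementProtocol.relabel (place a b M c) C) (slot a b M c) :=
  (WiresIn.relabel _).mono fun _ hw => ⟨hc, hw⟩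

/-! ### The coherent check -/

/-- Copy the answers of a prover and run the check `chk` on each index. -/
def checkAll (n xl : ℕ) (chk : List Gate) : List Gate :=
  copyReg n 1 4 7 ++ copyReg n xl 6 11 ++
    (List.range n).flatMap fun i => relabel (place 4 3 n i) chk

/-- Record on wire `(5, 0, 0)` whether all checks succeeded. -/
def allFlag (n : ℕ) : List Gate :=
  loops 1 1 1 [.not (10, 5, 5)] ++
    loops 1 n 1 [.not (8, 4, 5), .toffoli (10, 5, 5) (8, 4, 5) (14, 1, 5), .not (8, 4, 5),
      .cnot (14, 1, 5) (10, 5, 5)]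

/-- Compute, record, uncompute: after a success nothing but the flag may remain, since otherwise
leftover work bits would be entangled with the answers and the test could not be undone. -/
def verify (n xl : ℕ) (chk : List Gate) : List Gate :=
  checkAll n xl chk ++ allFlag n ++ dagger (checkAll n xl chk)

/-- The wire `(3, n + i, 0)` carries the output of check `i`. If the flag is still on and the check
failed, the work wire `(9, i, 0)` is turned on and then turns the flag off. -/
def allFlagStep (n i : ℕ) : List Gate :=
  [.not (3, n + i, 0), .toffoli (5, 0, 0) (3, n + i, 0) (9, i, 0), .not (3, n + i, 0),
      .cnot (9, i, 0) (5, 0, 0)]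

theorem allFlag_eq (n : ℕ) : allFlag n =
    .not (5, 0, 0) :: (List.range n).flatMap (allFlagStep n) := by
  simp [allFlag, loops, List.range_one, loopEnv, Gate.map]
  rfl

theorem runClassical_allFlagStep (n i : ℕ) (z : Basis) (hz : z (9, i, 0) = false) :
    runClassical (allFlagStep n i) z =
      Function.update (Function.update z (9, i, 0) (z (5, 0, 0) && !z (3, n + i, 0))) (5, 0, 0)
        (z (5, 0, 0) && z (3, n + i, 0)) := by
  funext w
  by_cases h5 : w = (5, 0, 0)
  · subst h5
    cases h : z (5, 0, 0) <;> cases h' : z (3, n + i, 0) <;>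
      simp [runClassical, allFlagStep, Gate.act, hz, h, h']
  by_cases h9 : w = (9, i, 0)
  · subst h9
    simp [runClassical, allFlagStep, Gate.act, hz]
  by_cases h3 : w = (3, n + i, 0)
  · subst h3
    simp [runClassical, allFlagStep, Gate.act]
  · simp [runClassical, allFlagStep, Gate.act, h3, h5, h9]

theorem runClassical_allFlag (n : ℕ) (z : Basis) (h5 : z (5, 0, 0) = false)
    (h9 : ∀ i < n, z (9, i, 0) = false) :
    (∀ i < n, runClassical (allFlag n) z (9, i, 0) =
      decide (z (3, n + i, 0) = false ∧ ∀ i' < i, z (3, n + i', 0) = true)) ∧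
    runClassical (allFlag n) z (5, 0, 0) = decide (∀ i < n, z (3, n + i, 0) = true) ∧
    ∀ w, w ≠ (5, 0, 0) → (∀ i < n, w ≠ (9, i, 0)) → runClassical (allFlag n) z w = z w := by
  rw [allFlag_eq]
  change (∀ i < n, runClassical _ (Function.update z (5, 0, 0) (!z (5, 0, 0))) _ = _) ∧
    runClassical _ (Function.update z (5, 0, 0) (!z (5, 0, 0))) _ = _ ∧
    ∀ w, _ → _ → runClassical _ (Function.update z (5, 0, 0) (!z (5, 0, 0))) _ = _
  obtain ⟨h1, h2, h3⟩ := runClassical_first n (allFlagStep n) (5, 0, 0) (fun i => (9, i, 0))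
    (fun i i' h => by simpa using h) (fun _ => by simp) (fun i z => !z (3, n + i, 0))
    (fun i z z' h => by simp [h (3, n + i, 0) (by simp) (by simp)])
    (fun i _ z hz => by rw [runClassical_allFlagStep n i z hz]; simp)
    (Function.update z (5, 0, 0) (!z (5, 0, 0))) (by simp [h5])
    (fun i hi => by simp [h9 i hi])
  refine ⟨fun i hi => by simpa using h1 i hi, by simpa using h2, fun w hw hw' => ?_⟩
  rw [h3 w hw hw', Function.update_of_ne hw]

theorem checkAll_wires (n xl : ℕ) (chk : List Gate) :
    WiresIn (checkAll n xl chk) {w | w.1 ≠ 5 ∧ w.1 ≠ 9} := by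
  refine WiresIn.append (WiresIn.append ?_ ?_) (WiresIn.flatMap fun i _ => ?_)
  · intro g hg w hw
    obtain ⟨i, c, j, -, -, -, rfl⟩ := mem_loops_single.1 hg
    simp only [Gate.map, Gate.wires, loopEnv, List.mem_cons, List.not_mem_nil, or_false] at hw
    rcases hw with rfl | rfl <;> simp
  · intro g hg w hw
    obtain ⟨i, c, j, -, -, -, rfl⟩ := mem_loops_single.1 hg
    simp only [Gate.map, Gate.wires, loopEnv, List.mem_cons, List.not_mem_nil, or_false] at hw
    rcases hw with rfl | rfl <;> simp
  · refine (WiresIn.relabel _).mono ?_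
    rintro _ ⟨w, rfl⟩
    simp only [place, Set.mem_ofPred_eq]
    omega

theorem checkAll_classical {n xl : ℕ} {chk : List Gate} (h : ∀ g ∈ chk, g.IsClassical) :
    ∀ g ∈ checkAll n xl chk, g.IsClassical := by
  intro g hg
  simp only [checkAll, List.mem_append, List.mem_flatMap] at hg
  rcases hg with (hg | hg) | ⟨i, -, hg⟩
  · exact (copyReg_into _ _ (by decide) g hg).isClassical
  · exact (copyReg_into _ _ (by decide) g hg).isClassical
  · obtain ⟨g', hg', rfl⟩ := List.mem_map.1 hg
    exact (Gate.isClassical_relabel _ _).2 (h g' hg')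

theorem allFlag_classical (n : ℕ) : ∀ g ∈ allFlag n, g.IsClassical := by
  intro g hg
  simp only [allFlag_eq, List.mem_cons, List.mem_flatMap, allFlagStep, List.not_mem_nil,
    or_false] at hg
  rcases hg with rfl | ⟨i, -, rfl | rfl | rfl | rfl⟩ <;> trivial

theorem dagger_classical {C : List Gate} (h : ∀ g ∈ C, g.IsClassical) :
    ∀ g ∈ dagger C, g.IsClassical := by
  intro g hg
  obtain ⟨g', hg', rfl⟩ := List.mem_map.1 (List.mem_reverse.1 hg)
  exact (Gate.isClassical_dagger _).2 (h g' hg')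

theorem verify_classical {n xl : ℕ} {chk : List Gate} (h : ∀ g ∈ chk, g.IsClassical) :
    ∀ g ∈ verify n xl chk, g.IsClassical := by
  intro g hg
  simp only [verify, List.mem_append] at hg
  rcases hg with (hg | hg) | hg
  · exact checkAll_classical h g hg
  · exact allFlag_classical n g hg
  · exact dagger_classical (checkAll_classical h) g hg

/-- Register `9` is clean only if the flag ends on: otherwise it marks the first failing index. That
is harmless, because failed blocks are never selected. -/
theorem runClassical_verify {n xl : ℕ} {chk : List Gate} (hchk : ∀ g ∈ chk, g.IsClassical)
    (z : Basis) (h5 : z (5, 0, 0) = false) (h9 : ∀ i < n, z (9, i, 0) = false) :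
    (runClassical (verify n xl chk) z (5, 0, 0) =
      decide (∀ i < n, runClassical (checkAll n xl chk) z (3, n + i, 0) = true)) ∧
    (runClassical (verify n xl chk) z (5, 0, 0) = true →
      ∀ i < n, runClassical (verify n xl chk) z (9, i, 0) = false) ∧
    ∀ w, w ≠ (5, 0, 0) → (∀ i < n, w ≠ (9, i, 0)) →
      runClassical (verify n xl chk) z w = z w := by
  set z₁ := runClassical (checkAll n xl chk) z with hz₁
  have hW := checkAll_wires n xl chk
  have e5 : z₁ (5, 0, 0) = z (5, 0, 0) := hW.runClassical_eq (by simp) z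
  have e9 : ∀ i, z₁ (9, i, 0) = z (9, i, 0) := fun i => hW.runClassical_eq (by simp) z
  obtain ⟨h1, h2, h3⟩ := runClassical_allFlag n z₁ (by rw [e5, h5])
    (fun i hi => by rw [e9, h9 i hi])
  have hv : runClassical (verify n xl chk) z =
      runClassical (dagger (checkAll n xl chk)) (runClassical (allFlag n) z₁) := by
    rw [verify, runClassical_append, runClassical_append]
  have out : ∀ w : Wire, w.1 = 5 ∨ w.1 = 9 →
      runClassical (verify n xl chk) z w = runClassical (allFlag n) z₁ w := by
    intro w hw
    rw [hv]
    exact hW.dagger.runClassical_eq (by simp only [Set.mem_ofPred_eq]; omega) _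
  refine ⟨by rw [out _ (by simp), h2], fun h i hi => ?_, fun w hw hw' => ?_⟩
  · rw [out _ (by simp), h2, decide_eq_true_eq] at h
    rw [out _ (by simp), h1 i hi, h i hi]
    simp
  · by_cases hr : w.1 = 5 ∨ w.1 = 9
    · rw [out w hr, h3 w hw hw']
      exact hW.runClassical_eq (by simp only [Set.mem_ofPred_eq]; omega) z
    · rw [hv, hW.dagger.runClassical_congr (z' := z₁) ?_ w
        (by simp only [Set.mem_ofPred_eq]; omega), hz₁,
        runClassical_dagger (checkAll_classical hchk)]
      rintro ⟨r, i, j⟩ hw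
      simp only [Set.mem_ofPred_eq] at hw
      refine h3 _ ?_ fun i _ => ?_
      · simp; omega
      · simp; omega

theorem receive_zero {n m : ℕ} (k : Fin n → Bits m) (i : Fin n) (j : Fin m) :
    receive k (0, i, j) = k i j := by simp [receive]

theorem receive_of_not {n m : ℕ} (k : Fin n → Bits m) {w : Wire}
    (h : ¬ (w.1 = 0 ∧ w.2.1 < n ∧ w.2.2 < m)) : receive k w = false := by
  simp only [receive, Bool.and_eq_false_iff, decide_eq_false_iff_not]
  by_cases h0 : w.1 = 0
  · right
    split_ifs with h1 h2
    · exact absurd ⟨h0, h1, h2⟩ h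
    · rfl
    · rfl
  · exact .inl h0

theorem receive_copy {n m : ℕ} (k : Fin n → Bits m) (i j : ℕ) :
    (if i < n ∧ j < m then receive k (0, i, j) else false) = receive k (0, i, j) := by
  split_ifs with h
  · rfl
  · exact (receive_of_not k (by tauto)).symm

/-! ### A block: a copy of a prover whose test answers are checked coherently -/

/-- Where a block keeps the wires of the prover. -/
def proverWire : Wire → Wire := place 2 0 1 0

theorem proverWire_injective : Function.Injective proverWire := place_injective (by simp) (by simp)

theorem proverWire_apply (r i j : ℕ) : proverWire (r, i, j) = (2 * r, i, j) := by
  simp [proverWire, place, mul_comm]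

theorem not_mem_range_proverWire {w : Wire} (hw : w.1 % 2 = 1) : w ∉ Set.range proverWire := by
  rintro ⟨⟨r, i, j⟩, rfl⟩
  rw [proverWire_apply] at hw
  simp only at hw
  omega

/-- The registers that are not used by the prover: saved keys, saved commitments, flag. -/
def saved {n kl yl : ℕ} (k : Fin n → Bits kl) (y : Fin n → Bits yl) (s : Bool) : Basis := fun w =>
  if w.1 = 3 then receive k (0, w.2) else if w.1 = 15 then receive y (0, w.2) else
    (decide (w = (5, 0, 0)) && s)

/-- The basis state of a block given the basis state of the prover. -/
def blockState {n kl yl : ℕ} (k : Fin n → Bits kl) (y : Fin n → Bits yl) (s : Bool) (z : Basis) :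
    Basis := Function.extend proverWire z (saved k y s)

theorem blockState_even {n kl yl : ℕ} (k : Fin n → Bits kl) (y : Fin n → Bits yl) (s : Bool)
    (z : Basis) (r i j : ℕ) : blockState k y s z (2 * r, i, j) = z (r, i, j) := by
  rw [← proverWire_apply, blockState, proverWire_injective.extend_apply]

theorem blockState_odd {n kl yl : ℕ} (k : Fin n → Bits kl) (y : Fin n → Bits yl) (s : Bool)
    (z : Basis) {w : Wire} (hw : w.1 % 2 = 1) : blockState k y s z w = saved k y s w :=
  Function.extend_apply' _ _ _ (not_mem_range_proverWire hw)

/-- Run the commitment and the test circuit, keeping copies of the keys and commitments. -/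
def testBlock (n kl yl : ℕ) (commit test : List Gate) : List Gate :=
  copyReg n kl 0 3 ++ relabel proverWire commit ++ copyReg n yl 2 15 ++ relabel proverWire test

theorem State.eq_sum_filter {α : Type} [Fintype α] (ψ : State) (v : Basis → α)
    (p : α → Basis → Prop) [∀ a, DecidablePred (p a)] (hp : ∀ a z, p a z ↔ v z = a) :
    ψ = ∑ a, Finsupp.filter (p a) ψ := by
  ext z
  rw [Finsupp.finsetSum_apply, Finset.sum_eq_single (v z)]
  · rw [Finsupp.filter_apply_pos]
    exact (hp _ _).2 rfl
  · intro a _ h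
    rw [Finsupp.filter_apply_neg]
    exact fun h' => h ((hp _ _).1 h').symm
  · simp

/-- Copying the commitments to register `15` replaces their measurement: the branches for different
`y` become orthogonal, and each evolves like the state of `P` after it has reported `y`. -/
theorem run_testBlock (U : Alphabet) {n kl : ℕ} (yl : ℕ) (commit test : List Gate)
    (k : Fin n → Bits kl) :
    run U (testBlock n kl yl commit test) (ket (receive k)) =
      ∑ y : Fin n → Bits yl, mapLin (blockState k y false) (run U test
        ((run U commit (ket (receive k))).filter fun z => ∀ i : Fin n, z.read 1 i yl = y i)) := by
  set z₁ := runClassical (copyReg n kl 0 3) (receive k) with hz₁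
  set ψ := run U commit (ket (receive k)) with hψ
  have hz₁' : ∀ w : Wire, z₁ w = if w.1 = 3 then receive k (0, w.2) else receive k w := by
    intro w
    rw [hz₁, runClassical_copyReg n kl (by decide)]
    by_cases h3 : w.1 = 3
    · rw [if_pos h3, ← receive_copy k w.2.1 w.2.2, receive_of_not k (w := w) (by omega)]
      simp only [h3, true_and, Bool.false_xor]
      split_ifs <;> rfl
    · simp [h3]
  have hp : z₁ ∘ proverWire = receive k := by
    funext ⟨r, i, j⟩
    rw [Function.comp_apply, proverWire_apply, hz₁', if_neg (by simp; omega)]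
    by_cases hr : r = 0
    · subst hr; rfl
    · rw [receive_of_not k (by simp; omega), receive_of_not k (by simp; omega)]
  have hcl : ∀ n m a b : ℕ, a ≠ b → ∀ g ∈ copyReg n m a b, g.IsClassical :=
    fun n m a b hab g hg => (copyReg_into n m hab g hg).isClassical
  rw [testBlock, run_append, run_append, run_append,
    run_classical_ket U (hcl _ _ _ _ (by decide)), ← hz₁, run_relabel_ket U proverWire_injective,
    hp, ← hψ, State.eq_sum_filter ψ (fun z (i : Fin n) => z.read 1 i yl)
      (fun y z => ∀ i : Fin n, z.read 1 i yl = y i) (fun y z => by rw [funext_iff]),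
    map_sum, run_sum, run_sum]
  refine Finset.sum_congr rfl fun y _ => ?_
  rw [← State.eq_sum_filter ψ (fun z (i : Fin n) => z.read 1 i yl)
      (fun y z => ∀ i : Fin n, z.read 1 i yl = y i) (fun y z => by rw [funext_iff])]
  rw [run_classical U (hcl n yl 2 15 (by decide)), mapLin_apply, mapLin_apply,
    ← Finsupp.mapDomain_comp]
  refine Eq.trans ?_ (run_relabel U proverWire_injective test (saved k y false) _)
  congr 1
  refine Finsupp.mapDomain_congr fun z hz => ?_
  have hy : ∀ i : Fin n, z.read 1 i yl = y i := by
    rw [Finsupp.support_filter, Finset.mem_filter] at hz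
    exact hz.2
  change _ = blockState k y false z
  funext ⟨r, i, j⟩
  rw [Function.comp_apply, runClassical_copyReg n yl (by decide)]
  rcases Nat.even_or_odd' r with ⟨r, rfl | rfl⟩
  · rw [if_neg (by simp; omega), blockState_even, ← proverWire_apply,
      proverWire_injective.extend_apply]
  · have hn : (2 * r + 1, i, j) ∉ Set.range proverWire :=
      not_mem_range_proverWire (by simp)
    rw [blockState_odd _ _ _ _ (by simp), Function.extend_apply' _ _ _ hn, hz₁', saved]
    by_cases h3 : r = 1
    · subst h3; simp
    have h30 : receive k (2 * r + 1, i, j) = false := receive_of_not k (by simp)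
    by_cases h15 : r = 7
    · subst h15
      simp only [h30]
      split_ifs with h h' h'
      · simp at h'
      · have := proverWire_injective.extend_apply z z₁ (1, i, j)
        rw [proverWire_apply] at this
        rw [this]
        have := congrFun (hy ⟨i, h.2.1⟩) ⟨j, h.2.2⟩
        simp only [Basis.read] at this
        rw [this, ← receive_zero y]
        simp
      · simp at h'
      · rw [receive_of_not y (by simpa using h)]
    · have h14 : 2 * r ≠ 14 := by omega
      simp [h3, h14, h30]

theorem getD_ofFn {m : ℕ} (k : Bits m) (j : ℕ) :
    (List.ofFn k).getD j false = if h : j < m then k ⟨j, h⟩ else false := by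
  rw [List.getD_eq_getElem?_getD, List.getElem?_ofFn]
  split_ifs <;> rfl

theorem receive_zero_eq {n m : ℕ} (k : Fin n → Bits m) (i j : ℕ) (hi : i < n) :
    receive k (0, i, j) = (List.ofFn (k ⟨i, hi⟩)).getD j false := by
  rw [getD_ofFn]
  simp [receive, hi]

theorem runClassical_checkAll_blockState {n kl xl yl : ℕ} {chk : List Gate}
    (hchk : ∀ g ∈ chk, g.IsClassical) (k : Fin n → Bits kl) (y : Fin n → Bits yl) (z : Basis)
    (i : ℕ) (hi : i < n) :
    runClassical (checkAll n xl chk) (blockState k y false z) (3, n + i, 0) =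
      runClassical chk (inputs [List.ofFn (k ⟨i, hi⟩), [z (2, i, 0)], List.ofFn (z.read 3 i xl),
        List.ofFn (y ⟨i, hi⟩)]) (0, 1, 0) := by
  have hf : Function.Injective (place 4 3 n i) := place_injective (by simp) (by omega)
  have h0 : ((3, n + i, 0) : Wire) = place 4 3 n i (0, 1, 0) := by simp [place]
  rw [checkAll, runClassical_append, runClassical_parallel n _ (slot 4 3 n)
    (fun _ h => WiresIn.relabel_slot h _) slot_disjoint _ hi (h0 ▸ place_mem_slot hi _), h0,
    runClassical_relabel hf hchk, hf.extend_apply]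
  · congr 1
    rw [runClassical_append]
    funext ⟨r, i', j⟩
    -- Inputs of an interleaved copy sit at index `0` only; any other index falls beyond the `n`
    -- strings present and reads zero.
    have hb : i' ≠ 0 → ¬ i' * n + i < n := by
      intro h
      have := Nat.le_mul_of_pos_left n (Nat.pos_of_ne_zero h)
      omega
    simp only [Function.comp_apply, place]
    rw [runClassical_copyReg n xl (by decide), runClassical_copyReg n 1 (by decide),
      runClassical_copyReg n 1 (by decide), blockState_odd _ _ _ _ (by simp; omega)]
    have e6 := blockState_even k y false z 3 (i' * n + i) j
    have e4 := blockState_even k y false z 2 (i' * n + i) j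
    simp only [Nat.reduceMul] at e4 e6
    simp only [e4, e6]
    by_cases hi' : i' = 0
    · subst hi'
      simp only [zero_mul, zero_add, inputs, decide_true, Bool.true_and, hi, true_and]
      -- The placement sends registers `0, 1, 2, 3` of the check to `3, 7, 11, 15`: saved keys,
      -- copied bits, copied strings, saved commitments.
      match r with
      | 0 => simp [saved, receive_zero_eq k i j hi]
      | 1 =>
        by_cases hj : j = 0
        · simp [saved, hj]
        · simp [saved, hj]
      | 2 =>
        rw [List.getD_cons_succ, List.getD_cons_succ, List.getD_cons_zero, getD_ofFn]
        simp [saved, Basis.read]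
      | 3 => simp [saved, receive_zero_eq y i j hi]
      | r + 4 =>
        have h2 : (r + 4) * 4 + 3 ≠ 15 := by omega
        have h3 : (r + 4) * 4 + 3 ≠ 5 := by omega
        have h4 : (r + 4) * 4 + 3 ≠ 7 := by omega
        have h5 : (r + 4) * 4 + 3 ≠ 11 := by omega
        simp [saved, h2, h3, h4, h5]
    · have h5 : r * 4 + 3 ≠ 5 := by omega
      simp only [hb hi', inputs, hi', decide_false, Bool.false_and, false_and, and_false, if_false]
      rw [saved, receive_of_not k (by simp [hb hi']), receive_of_not y (by simp [hb hi'])]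
      simp [h5]

/-- On passing branches verification does nothing but turn on the flag. This exactness is what
allows the test to be inverted afterwards. -/
theorem runClassical_verify_blockState {n kl xl yl : ℕ} {chk : List Gate}
    (hchk : ∀ g ∈ chk, g.IsClassical) (k : Fin n → Bits kl) (y : Fin n → Bits yl) (z : Basis)
    {chkf : Bits kl → Bool → Bits xl → Bits yl → Bool}
    (hspec : ∀ k b x y, runClassical chk
      (inputs [List.ofFn k, [b], List.ofFn x, List.ofFn y]) (0, 1, 0) = chkf k b x y) :
    (runClassical (verify n xl chk) (blockState k y false z) (5, 0, 0) = true ↔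
      ∀ i : Fin n, chkf (k i) (z (2, i, 0)) (z.read 3 i xl) (y i) = true) ∧
    ((∀ i : Fin n, chkf (k i) (z (2, i, 0)) (z.read 3 i xl) (y i) = true) →
      runClassical (verify n xl chk) (blockState k y false z) = blockState k y true z) ∧
    ∀ w, w ≠ (5, 0, 0) → (∀ i < n, w ≠ (9, i, 0)) →
      runClassical (verify n xl chk) (blockState k y false z) w = blockState k y false z w := by
  obtain ⟨h1, h2, h3⟩ := runClassical_verify (xl := xl) hchk (blockState k y false z)
    (by rw [blockState_odd _ _ _ _ (by simp)]; simp [saved]) (n := n)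
    (fun i _ => by rw [blockState_odd _ _ _ _ (by simp)]; simp [saved])
  have h1' : runClassical (verify n xl chk) (blockState k y false z) (5, 0, 0) = true ↔
      ∀ i : Fin n, chkf (k i) (z (2, i, 0)) (z.read 3 i xl) (y i) = true := by
    rw [h1, decide_eq_true_eq]
    constructor
    · intro h i
      rw [← hspec, ← runClassical_checkAll_blockState hchk k y z i i.2]
      exact h i i.2
    · intro h i hi
      rw [runClassical_checkAll_blockState hchk k y z i hi, hspec]
      exact h ⟨i, hi⟩
  refine ⟨h1', fun h => ?_, h3⟩
  have hf := h1'.2 h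
  funext w
  by_cases h5 : w = (5, 0, 0)
  · subst h5
    rw [hf, blockState_odd _ _ _ _ (by simp)]
    simp [saved]
  have hsame : blockState k y false z w = blockState k y true z w := by
    obtain ⟨r, i, j⟩ := w
    rcases Nat.even_or_odd' r with ⟨r, rfl | rfl⟩
    · rw [blockState_even, blockState_even]
    · rw [blockState_odd _ _ _ _ (by simp), blockState_odd _ _ _ _ (by simp), saved, saved]
      simp [h5]
  rw [← hsame]
  by_cases h9 : ∃ i < n, w = (9, i, 0)
  · obtain ⟨i, hi, rfl⟩ := h9
    rw [h2 hf i hi, blockState_odd _ _ _ _ (by simp)]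
    simp [saved]
  · push Not at h9
    exact h3 w h5 h9

theorem filter_mapLin (κ : Basis → Basis) (ψ : State) (p : Basis → Prop) [DecidablePred p] :
    (mapLin κ ψ).filter p = mapLin κ (ψ.filter fun z => p (κ z)) := by
  induction ψ using Finsupp.induction_linear with
  | zero => rw [map_zero, Finsupp.filter_zero, Finsupp.filter_zero, map_zero]
  | add f g hf hg => rw [map_add, Finsupp.filter_add, Finsupp.filter_add, map_add, hf, hg]
  | single z c =>
    rw [mapLin_apply, Finsupp.mapDomain_single]
    by_cases h : p (κ z)
    · rw [Finsupp.filter_single_of_pos _ h,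
        Finsupp.filter_single_of_pos (fun z => p (κ z)) h, mapLin_apply,
        Finsupp.mapDomain_single]
    · rw [Finsupp.filter_single_of_neg _ h,
        Finsupp.filter_single_of_neg (fun z => p (κ z)) h, map_zero]

theorem exists_of_mem_support_mapLin {κ : Basis → Basis} {ψ : State} {z : Basis}
    (h : z ∈ (mapLin κ ψ).support) : ∃ z' ∈ ψ.support, κ z' = z := by
  have := Finsupp.mapDomain_support h
  simpa using this

theorem filter_sum {ι : Type*} (s : Finset ι) (ψ : ι → State) (p : Basis → Prop)
    [DecidablePred p] : (∑ i ∈ s, ψ i).filter p = ∑ i ∈ s, (ψ i).filter p :=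
  map_sum (Finsupp.filterAddHom p) _ _

/-- The specification of a circuit for the check. -/
def IsCheck {kl xl yl : ℕ} (chkf : Bits kl → Bool → Bits xl → Bits yl → Bool) (chk : List Gate) :
    Prop :=
  (∀ g ∈ chk, g.IsClassical) ∧ ∀ k b x y, runClassical chk
      (inputs [List.ofFn k, [b], List.ofFn x, List.ofFn y]) (0, 1, 0) = chkf k b x y

section

variable {n kl xl yl : ℕ} (chkf : Bits kl → Bool → Bits xl → Bits yl → Bool)

/-- All answers pass the check. -/
def Passes (k : Fin n → Bits kl) (y : Fin n → Bits yl) (z : Basis) : Prop :=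
  ∀ i : Fin n, chkf (k i) (z (2, i, 0)) (z.read 3 i xl) (y i) = true

/-- The state of the prover after a test round in which the commitments `y` were accepted. -/
def passed (U : Alphabet) (P : Prover) (l : ℕ) (k : Fin n → Bits kl) (y : Fin n → Bits yl) :
    State :=
  (run U (P.test l) (P.committed U l k y)).filter (Passes chkf k y)

/-- The probability that the prover passes the check. -/
def passProb (U : Alphabet) (P : Prover) (l : ℕ) (k : Fin n → Bits kl) : ℝ :=
  ∑ y : Fin n → Bits yl, (run U (P.test l) (P.committed U l k y)).prob (Passes chkf k y)

/-- Commit, answer the test and set the flag `(5, 0, 0)` if the check is passed. -/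
def block (n kl xl yl : ℕ) (P : Prover) (l : ℕ) (chk : List Gate) : List Gate :=
  testBlock n kl yl (P.commit l) (P.test l) ++ verify n xl chk

/-- Undo the test and answer the Hadamard round. -/
def blockHadamard (P : Prover) (l : ℕ) : List Gate :=
  relabel proverWire (dagger (P.test l) ++ P.hadamard l)

variable {chkf} {chk : List Gate}

/-- The flagged part of a block is the state of `P` projected to passing answers, with untouched
side registers. -/
theorem filter_run_block (hchk : IsCheck chkf chk) (U : Alphabet) (P : Prover) (l : ℕ)
    (k : Fin n → Bits kl) :
    (run U (block n kl xl yl P l chk) (ket (receive k))).filter (fun z => z (5, 0, 0) = true) =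
      ∑ y : Fin n → Bits yl, mapLin (blockState k y true) (passed chkf U P l k y) := by
  rw [block, run_append, run_testBlock, run_classical U (verify_classical hchk.1), map_sum,
    filter_sum]
  refine Finset.sum_congr rfl fun y _ => ?_
  rw [filter_mapLin, filter_mapLin, passed]
  have : (fun z => runClassical (verify n xl chk) (blockState k y false z) (5, 0, 0) = true) =
      Passes chkf k y := by
    funext z
    exact propext (runClassical_verify_blockState hchk.1 k y z hchk.2).1
  simp only [this]
  rw [mapLin_apply, mapLin_apply, ← Finsupp.mapDomain_comp, mapLin_apply]
  refine Finsupp.mapDomain_congr fun z hz => ?_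
  rw [Finsupp.support_filter, Finset.mem_filter] at hz
  exact (runClassical_verify_blockState hchk.1 k y z hchk.2).2.1 hz.2

theorem passes_of_mem_support_block (hchk : IsCheck chkf chk) (U : Alphabet) (P : Prover) (l : ℕ)
    (k : Fin n → Bits kl) {z : Basis}
    (hz : z ∈ (run U (block n kl xl yl P l chk) (ket (receive k))).support)
    (h5 : z (5, 0, 0) = true) (i : Fin n) :
    chkf (k i) (z (4, i, 0)) (z.read 6 i xl) (z.read 15 i yl) = true := by
  have hz' : z ∈ ((run U (block n kl xl yl P l chk) (ket (receive k))).filter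
      (fun z => z (5, 0, 0) = true)).support := by
    rw [Finsupp.support_filter, Finset.mem_filter]
    exact ⟨hz, h5⟩
  rw [filter_run_block hchk] at hz'
  obtain ⟨y, -, hy⟩ := Finset.mem_biUnion.1 (Finsupp.support_finsetSum hz')
  obtain ⟨z', hp, rfl⟩ := exists_of_mem_support_mapLin hy
  unfold passed at hp
  rw [ Finsupp.support_filter, Finset.mem_filter] at hp
  have h15 : (blockState k y true z').read 15 i yl = y i := by
    funext j
    rw [Basis.read, blockState_odd _ _ _ _ (by simp), ← receive_zero y]
    simp [saved]
  have h6 : (blockState k y true z').read 6 i xl = z'.read 3 i xl := by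
    funext j
    exact blockState_even k y true z' 3 i j
  rw [h15, h6, blockState_even k y true z' 2 i 0]
  exact hp.2 i

/-- The flag is not a wire of the prover, so projecting on it commutes with the undo and Hadamard
circuits. What remains is a sum over the saved commitments. -/
theorem expect_block (hchk : IsCheck chkf chk) (U : Alphabet) (P : Prover) (l : ℕ)
    (k : Fin n → Bits kl) (F : Basis → ℝ) :
    (run U (block n kl xl yl P l chk ++ blockHadamard P l) (ket (receive k))).expect
        (fun z => if z (5, 0, 0) = true then F z else 0) =
      ∑ y : Fin n → Bits yl, (run U (P.hadamard l) (run U (dagger (P.test l))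
        (passed chkf U P l k y))).expect fun z => F (blockState k y true z) := by
  rw [← State.expect_filter, run_append, ← run_filter, filter_run_block hchk, run_sum,
    State.expect_sum_of_disjoint]
  · refine Finset.sum_congr rfl fun y _ => ?_
    rw [blockHadamard, ← run_append]
    refine Eq.trans (congrArg (fun ψ => State.expect ψ F) (run_relabel U proverWire_injective
      (dagger (P.test l) ++ P.hadamard l) (saved k y true) (passed chkf U P l k y))) ?_
    rw [State.expect_mapLin (extend_left_injective proverWire_injective _)]
    rfl
  -- Different `y` do not interfere, because the saved copy in register `15` still tells them apart.
  · intro y _ y' _ hne z hz hz'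
    refine hne (funext fun i => funext fun j => ?_)
    have key : ∀ y : Fin n → Bits yl, z ∈ (run U (blockHadamard P l)
        (mapLin (blockState k y true) (passed chkf U P l k y))).support →
        z (15, i, j) = y i j := by
      intro y h
      have e := run_relabel U proverWire_injective
        (dagger (P.test l) ++ P.hadamard l) (saved k y true) (passed chkf U P l k y)
      change run U (blockHadamard P l) (mapLin (blockState k y true) (passed chkf U P l k y)) = _
        at e
      rw [e] at h
      obtain ⟨z', -, rfl⟩ := exists_of_mem_support_mapLin h
      refine (blockState_odd k y true z' (by simp)).trans ?_
      rw [← receive_zero y]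
      simp [saved]
    rw [← key y hz, ← key y' hz']
  · intro g hg z b
    obtain ⟨g', -, rfl⟩ := List.mem_map.1 hg
    rw [Function.update_of_ne]
    rw [Gate.target_relabel]
    intro e
    exact not_mem_range_proverWire (w := (5, 0, 0)) (by simp) ⟨_, e.symm⟩

theorem expect_block_flag (hchk : IsCheck chkf chk) (U : Alphabet) (P : Prover) (l : ℕ)
    (k : Fin n → Bits kl) :
    (run U (block n kl xl yl P l chk ++ blockHadamard P l) (ket (receive k))).expect
        (fun z => if z (5, 0, 0) = true then 1 else 0) = passProb chkf U P l k := by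
  rw [expect_block hchk U P l k fun _ => 1, passProb]
  refine Finset.sum_congr rfl fun y _ => ?_
  rw [run_expect_one, run_expect_one, passed, State.expect_filter]
  rfl

theorem expect_block_not_flag (hchk : IsCheck chkf chk) (U : Alphabet) (P : Prover) (l : ℕ)
    (k : Fin n → Bits kl) :
    (run U (block n kl xl yl P l chk ++ blockHadamard P l) (ket (receive k))).expect
        (fun z => if z (5, 0, 0) = true then 0 else 1) = 1 - passProb chkf U P l k := by
  rw [← expect_block_flag hchk, eq_sub_iff_add_eq, ← State.expect_add]
  have e : (fun z : Basis => (if z (5, 0, 0) = true then (0 : ℝ) else 1) +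
      if z (5, 0, 0) = true then 1 else 0) = fun _ => 1 := by
    funext z
    split_ifs <;> simp
  rw [e, run_expect_one, State.expect_ket]

end

/-! ### Deferred measurement of untouched wires -/

theorem State.expect_eq_sum_values (ψ : State) (F : Basis → ℝ) (s : Finset ℝ)
    (hs : ∀ z ∈ ψ.support, F z ∈ s) :
    ψ.expect F = ∑ v ∈ s, v * State.expect (ψ.filter fun z => F z = v) fun _ => 1 := by
  simp only [State.expect_filter, ← State.expect_const_mul]
  rw [← State.expect_sum]
  refine State.expect_congr fun z hz => ?_
  rw [Finset.sum_eq_single (F z)]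
  · simp
  · intro v _ h
    simp [Ne.symm h]
  · exact fun h => absurd (hs z hz) h

/-- The level sets of `F` are preserved, so projecting onto each commutes with the circuit, which
also preserves norms. -/
theorem run_expect_of_notTarget (U : Alphabet) (C : List Gate) (ψ : State) (F : Basis → ℝ)
    (hF : ∀ g ∈ C, ∀ z b, F (Function.update z g.target b) = F z) :
    (run U C ψ).expect F = ψ.expect F := by
  rw [State.expect_eq_sum_values (run U C ψ) F ((ψ.support ∪ (run U C ψ).support).image F)
    (fun z hz => Finset.mem_image_of_mem _ (Finset.mem_union_right _ hz)),
    State.expect_eq_sum_values ψ F ((ψ.support ∪ (run U C ψ).support).image F)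
    (fun z hz => Finset.mem_image_of_mem _ (Finset.mem_union_left _ hz))]
  refine Finset.sum_congr rfl fun v _ => ?_
  rw [← run_filter U C _ (fun g hg z b => by rw [hF g hg z b]), run_expect_one]

theorem exists_of_mem_support_run (U : Alphabet) (C : List Gate) {ψ : State} {z : Basis}
    (h : z ∈ (run U C ψ).support) : ∃ z' ∈ ψ.support, z ∈ (run U C (ket z')).support := by
  rw [State.eq_sum_ket ψ, run_sum] at h
  obtain ⟨z', hz', h⟩ := Finset.mem_biUnion.1 (Finsupp.support_finsetSum h)
  refine ⟨z', hz', ?_⟩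
  rw [run_smul] at h
  exact Finsupp.support_smul h

/-- Turns the protocol with its intermediate measurement into one circuit measured at the end,
provided the second circuit leaves register `1` alone. -/
theorem sum_committed_expect (U : Alphabet) (P : Prover) (l : ℕ) {n m m' : ℕ} (k : Fin n → Bits m)
    (C : List Gate) (hC : ∀ g ∈ C, g.target.1 ≠ 1) (φ : (Fin n → Bits m') → Basis → ℝ) :
    ∑ y : Fin n → Bits m', (run U C (P.committed U l k y)).expect (φ y) =
      (run U (P.commit l ++ C) (ket (receive k))).expect
        fun z => φ (fun i => z.read 1 i m') z := by
  have h : ∀ y : Fin n → Bits m', (run U C (P.committed U l k y)).expect (φ y) =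
      (run U (P.commit l ++ C) (ket (receive k))).expect
        fun z => if ∀ i : Fin n, z.read 1 i m' = y i then φ y z else 0 := by
    intro y
    rw [Prover.committed, run_filter, State.expect_filter, run_append]
    intro g hg z b
    have : ∀ i : Fin n, Basis.read (Function.update z g.target b) 1 i m' = Basis.read z 1 i m' := by
      intro i
      funext j
      exact Function.update_of_ne (fun e => hC g hg (by rw [← e])) _ _
    simp only [this]
  rw [Finset.sum_congr rfl fun y _ => h y, ← State.expect_sum]
  congr 1
  funext z
  rw [Finset.sum_eq_single fun i : Fin n => z.read 1 i m']
  · simp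
  · intro y _ hne
    rw [if_neg]
    exact fun h => hne (funext h).symm
  · simp

/-! ### Selecting the first successful block -/

/-- Mark on the wires `(6, c, 0)` the first of the copies `c < R` whose flag `(15, c, 0)` is on;
the wire `(4, 0, 0)` tells whether there is none. -/
def selectFirst (R : ℕ) : List Gate :=
  loops 1 1 1 [.not (9, 5, 5)] ++
    loops 1 R 1 [.toffoli (9, 5, 5) (20, 1, 5) (11, 1, 5), .cnot (11, 1, 5) (9, 5, 5)]

/-- Wire `(4, 0, 0)` says that the search is still open; the first flag that is met marks its copy
and closes it. -/
def selectStep (c : ℕ) : List Gate :=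
  [.toffoli (4, 0, 0) (15, c, 0) (6, c, 0), .cnot (6, c, 0) (4, 0, 0)]

theorem selectFirst_eq (R : ℕ) : selectFirst R =
    .not (4, 0, 0) :: (List.range R).flatMap selectStep := by
  simp [selectFirst, loops, List.range_one, loopEnv, Gate.map]
  rfl

theorem runClassical_selectStep (c : ℕ) (z : Basis) (hz : z (6, c, 0) = false) :
    runClassical (selectStep c) z =
      Function.update (Function.update z (6, c, 0) (z (4, 0, 0) && z (15, c, 0))) (4, 0, 0)
        (z (4, 0, 0) && !z (15, c, 0)) := by
  funext w
  by_cases h5 : w = (4, 0, 0)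
  · subst h5
    cases h : z (4, 0, 0) <;> cases h' : z (15, c, 0) <;>
      simp [runClassical, selectStep, Gate.act, hz, h, h']
  by_cases h9 : w = (6, c, 0)
  · subst h9
    simp [runClassical, selectStep, Gate.act, hz]
  · simp [runClassical, selectStep, Gate.act, h5, h9]

theorem runClassical_selectFirst (R : ℕ) (z : Basis) (h4 : z (4, 0, 0) = false)
    (h6 : ∀ c < R, z (6, c, 0) = false) :
    (∀ c < R, runClassical (selectFirst R) z (6, c, 0) =
      decide (z (15, c, 0) = true ∧ ∀ c' < c, z (15, c', 0) = false)) ∧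
    runClassical (selectFirst R) z (4, 0, 0) = decide (∀ c < R, z (15, c, 0) = false) ∧
    ∀ w, w.1 ≠ 4 → w.1 ≠ 6 → runClassical (selectFirst R) z w = z w := by
  rw [selectFirst_eq]
  change (∀ c < R, runClassical _ (Function.update z (4, 0, 0) (!z (4, 0, 0))) _ = _) ∧
    runClassical _ (Function.update z (4, 0, 0) (!z (4, 0, 0))) _ = _ ∧
    ∀ w, _ → _ → runClassical _ (Function.update z (4, 0, 0) (!z (4, 0, 0))) _ = _
  obtain ⟨h1, h2, h3⟩ := runClassical_first R selectStep (4, 0, 0) (fun c => (6, c, 0))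
    (fun i i' h => by simpa using h) (fun _ => by simp) (fun c z => z (15, c, 0))
    (fun c z z' h => h (15, c, 0) (by simp) (by simp))
    (fun c _ z hz => runClassical_selectStep c z hz)
    (Function.update z (4, 0, 0) (!z (4, 0, 0))) (by simp [h4])
    (fun c hc => by simp [h6 c hc])
  refine ⟨fun i hi => by simpa using h1 i hi, by simpa using h2, fun w hw hw' => ?_⟩
  have hne : w ≠ (4, 0, 0) := by rintro rfl; exact hw rfl
  rw [h3 w hne (by rintro c - rfl; exact hw' rfl), Function.update_of_ne hne]

theorem selectFirst_classical (R : ℕ) : ∀ g ∈ selectFirst R, g.IsClassical := by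
  intro g hg
  simp only [selectFirst_eq, List.mem_cons, List.mem_flatMap, selectStep, List.not_mem_nil,
    or_false] at hg
  rcases hg with rfl | ⟨i, -, rfl | rfl⟩ <;> trivial

/-- Select a block and report its commitments; if all blocks fail, report the commitments of the
range superpositions in register `14`. -/
def selection (n R yl : ℕ) : List Gate :=
  selectFirst R ++ selectReg n R yl 35 1 ++ condReg n yl 14 1

/-- Report the answers, of length `m`, of the selected block. -/
def answers (n R m : ℕ) : List Gate := selectReg n R 1 13 2 ++ selectReg n R m 17 3

theorem selection_classical (n R yl : ℕ) : ∀ g ∈ selection n R yl, g.IsClassical := by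
  intro g hg
  simp only [selection, List.mem_append] at hg
  rcases hg with (hg | hg) | hg
  · exact selectFirst_classical R g hg
  · exact (selectReg_into _ _ _ (by decide) (by decide) g hg).isClassical
  · exact (condReg_into _ _ (by decide) (by decide) g hg).isClassical

theorem answers_classical (n R m : ℕ) : ∀ g ∈ answers n R m, g.IsClassical := by
  intro g hg
  simp only [answers, List.mem_append] at hg
  rcases hg with hg | hg
  · exact (selectReg_into _ _ _ (by decide) (by decide) g hg).isClassical
  · exact (selectReg_into _ _ _ (by decide) (by decide) g hg).isClassical

/-- The results of the classical part when block `c` is the first whose flag is on. -/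
theorem runClassical_selected {n R yl m c : ℕ} (z : Basis)
    (h0 : ∀ w : Wire, 0 < w.1 → w.1 < 5 ∨ w.1 = 6 → z w = false)
    (hc : c < R) (h15 : z (15, c, 0) = true) (hlt : ∀ c' < c, z (15, c', 0) = false) :
    let z' := runClassical (selection n R yl ++ answers n R m) z
    (∀ i < n, ∀ j < yl, z' (1, i, j) = z (35, i * R + c, j)) ∧
    (∀ i < n, z' (2, i, 0) = z (13, i * R + c, 0)) ∧
    (∀ i < n, ∀ j < m, z' (3, i, j) = z (17, i * R + c, j)) ∧ z' (4, 0, 0) = false := by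
  obtain ⟨s1, s2, s3⟩ := runClassical_selectFirst R z (h0 _ (by simp) (by simp))
    (fun c _ => h0 _ (by simp) (by simp))
  rw [answers, selection, runClassical_append, runClassical_append, runClassical_append,
    runClassical_append]
  set z₁ := runClassical (selectFirst R) z
  have sc : z₁ (6, c, 0) = true := by rw [s1 c hc]; simpa [h15] using hlt
  have sn : ∀ c' < R, c' ≠ c → z₁ (6, c', 0) = false := by
    intro c' hc' hne
    rw [s1 c' hc', decide_eq_false_iff_not]
    rintro ⟨h, h'⟩
    rcases Nat.lt_or_gt_of_ne hne with hl | hl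
    · rw [hlt c' hl] at h; simp at h
    · rw [h' c hl] at h15; simp at h15
  have s4 : z₁ (4, 0, 0) = false := by
    rw [s2, decide_eq_false_iff_not]
    intro h
    rw [h c hc] at h15
    simp at h15
  set z₂ := runClassical (selectReg n R yl 35 1) z₁ with hz₂
  have e₂ : ∀ w : Wire, w.1 ≠ 1 → z₂ w = z₁ w := fun w hw =>
    runClassical_into_of_register_ne (selectReg_into n R yl (by decide) (by decide)) z₁ hw
  set z₃ := runClassical (condReg n yl 14 1) z₂ with hz₃
  have e₃ : ∀ w : Wire, w.1 ≠ 1 → z₃ w = z₂ w := fun w hw =>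
    runClassical_into_of_register_ne (condReg_into n yl (by decide) (by decide)) z₂ hw
  set z₄ := runClassical (selectReg n R 1 13 2) z₃ with hz₄
  have e₄ : ∀ w : Wire, w.1 ≠ 2 → z₄ w = z₃ w := fun w hw =>
    runClassical_into_of_register_ne (selectReg_into n R 1 (by decide) (by decide)) z₃ hw
  have e₅ : ∀ w : Wire, w.1 ≠ 3 → runClassical (selectReg n R m 17 3) z₄ w = z₄ w := fun w hw =>
    runClassical_into_of_register_ne (selectReg_into n R m (by decide) (by decide)) z₄ hw
  refine ⟨fun i hi j hj => ?_, fun i hi => ?_, fun i hi j hj => ?_, ?_⟩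
  · rw [e₅ _ (by simp), e₄ _ (by simp), hz₃,
      runClassical_condReg (by decide) (by decide) _ hi hj, e₂ (4, 0, 0) (by simp), s4, hz₂,
      runClassical_selectReg (by decide) (by decide) hc _ sn hi hj, sc, s3 _ (by simp) (by simp),
      s3 _ (by simp) (by simp), h0 _ (by simp) (by simp)]
    simp
  · rw [e₅ _ (by simp), hz₄, runClassical_selectReg (by decide) (by decide) hc _
        (fun c' h h' => by rw [e₃ _ (by simp), e₂ _ (by simp), sn c' h h']) hi (by simp),
      e₃ _ (by simp), e₂ _ (by simp), s3 _ (by simp) (by simp),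
      e₃ _ (by simp), e₂ _ (by simp), sc, e₃ _ (by simp), e₂ _ (by simp), s3 _ (by simp) (by simp),
      h0 _ (by simp) (by simp)]
    simp
  · rw [runClassical_selectReg (by decide) (by decide) hc _
        (fun c' h h' => by rw [e₄ _ (by simp), e₃ _ (by simp), e₂ _ (by simp), sn c' h h']) hi hj,
      e₄ _ (by simp), e₃ _ (by simp), e₂ _ (by simp), s3 _ (by simp) (by simp),
      e₄ _ (by simp), e₃ _ (by simp), e₂ _ (by simp), sc,
      e₄ _ (by simp), e₃ _ (by simp), e₂ _ (by simp), s3 _ (by simp) (by simp),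
      h0 _ (by simp) (by simp)]
    simp
  · rw [e₅ _ (by simp), e₄ _ (by simp), e₃ _ (by simp), e₂ _ (by simp), s4]

/-- The results of the classical part when no flag is on. -/
theorem runClassical_not_selected {n R yl m : ℕ} (z : Basis)
    (h0 : ∀ w : Wire, 0 < w.1 → w.1 < 5 ∨ w.1 = 6 → z w = false)
    (h15 : ∀ c < R, z (15, c, 0) = false) :
    let z' := runClassical (selection n R yl ++ answers n R m) z
    (∀ i < n, ∀ j < yl, z' (1, i, j) = z (14, i, j)) ∧
    (∀ i, z' (2, i, 0) = false) ∧
    (∀ i j, z' (3, i, j) = false) ∧ z' (4, 0, 0) = true ∧ ∀ w : Wire, 6 < w.1 → z' w = z w := by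
  obtain ⟨s1, s2, s3⟩ := runClassical_selectFirst R z (h0 _ (by simp) (by simp))
    (fun c _ => h0 _ (by simp) (by simp))
  rw [answers, selection, runClassical_append, runClassical_append, runClassical_append,
    runClassical_append]
  set z₁ := runClassical (selectFirst R) z
  have sn : ∀ c' < R, z₁ (6, c', 0) = false := by
    intro c' hc'
    rw [s1 c' hc', h15 c' hc']
    simp
  have s4 : z₁ (4, 0, 0) = true := by
    rw [s2, decide_eq_true_eq]
    exact h15
  rw [show runClassical (selectReg n R yl 35 1) z₁ = z₁ from
    funext (runClassical_selectReg_none (by decide) (by decide) z₁ sn)]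
  set z₃ := runClassical (condReg n yl 14 1) z₁ with hz₃
  have e₃ : ∀ w : Wire, w.1 ≠ 1 → z₃ w = z₁ w := fun w hw =>
    runClassical_into_of_register_ne (condReg_into n yl (by decide) (by decide)) z₁ hw
  have sn₃ : ∀ c' < R, z₃ (6, c', 0) = false := fun c h => by rw [e₃ _ (by simp), sn c h]
  rw [show runClassical (selectReg n R 1 13 2) z₃ = z₃ from
    funext (runClassical_selectReg_none (by decide) (by decide) z₃ sn₃),
    show runClassical (selectReg n R m 17 3) z₃ = z₃ from
    funext (runClassical_selectReg_none (by decide) (by decide) z₃ sn₃)]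
  refine ⟨fun i hi j hj => ?_, fun i => ?_, fun i j => ?_, ?_, fun w hw => ?_⟩
  · rw [hz₃, runClassical_condReg (by decide) (by decide) _ hi hj, s4, s3 _ (by simp) (by simp),
      s3 _ (by simp) (by simp), h0 _ (by simp) (by simp)]
    simp
  · rw [e₃ _ (by simp), s3 _ (by simp) (by simp), h0 _ (by simp) (by simp)]
  · rw [e₃ _ (by simp), s3 _ (by simp) (by simp), h0 _ (by simp) (by simp)]
  · rw [e₃ _ (by simp), s4]
  · rw [e₃ _ (by omega), s3 _ (by omega) (by omega)]

/-! ### Distributing the keys -/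

/-- Blocks use the odd registers from `5` on, the samplers the even registers from `8` on; both
receive their keys in their first register. Register `10`, the input bit of the samplers, stays
zero. -/
def distribute (n R kl : ℕ) : List Gate := fanOut n R kl ++ copyReg n kl 0 8

theorem distribute_classical (n R kl : ℕ) : ∀ g ∈ distribute n R kl, g.IsClassical := by
  intro g hg
  rcases List.mem_append.1 hg with hg | hg
  · exact (fanOut_into n R kl g hg).isClassical
  · exact (copyReg_into n kl (by decide) g hg).isClassical

theorem runClassical_distribute {n kl : ℕ} (R : ℕ) (k : Fin n → Bits kl) :
    (∀ c < R, runClassical (distribute n R kl) (receive k) ∘ place 2 5 R c = receive k) ∧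
    (∀ i : Fin n, runClassical (distribute n R kl) (receive k) ∘ place 2 8 n i =
      inputs [List.ofFn (k i), [false]]) ∧
    ∀ w : Wire, w.1 ≠ 5 → w.1 ≠ 8 → runClassical (distribute n R kl) (receive k) w =
      receive k w := by
  rw [distribute, runClassical_append]
  set z₁ := runClassical (fanOut n R kl) (receive k) with hz₁
  have e₁ : ∀ w : Wire, w.1 ≠ 5 → z₁ w = receive k w := fun w hw =>
    runClassical_into_of_register_ne (fanOut_into n R kl) _ hw
  have e₂ : ∀ w : Wire, w.1 ≠ 8 → runClassical (copyReg n kl 0 8) z₁ w = z₁ w := fun w hw =>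
    runClassical_into_of_register_ne (copyReg_into n kl (by decide)) _ hw
  refine ⟨fun c hc => ?_, fun i => ?_, fun w h5 h8 => by rw [e₂ w h8, e₁ w h5]⟩
  · funext ⟨r, i, j⟩
    simp only [Function.comp_apply, place]
    rw [e₂ _ (by simp; omega)]
    by_cases hr : r = 0
    · subst hr
      simp only [zero_mul, zero_add]
      rw [hz₁, runClassical_fanOut hc, receive_of_not k (w := (5, _, _)) (by simp),
        ← receive_copy k i j]
      split_ifs <;> simp
    · rw [e₁ _ (by simp; omega), receive_of_not k (by simp), receive_of_not k (by simp [hr])]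
  · funext ⟨r, i', j⟩
    simp only [Function.comp_apply, place]
    by_cases hr : r = 0
    · subst hr
      rw [runClassical_copyReg n kl (by decide), e₁ _ (by simp), e₁ _ (by simp),
        receive_of_not k (w := (0 * 2 + 8, _, _)) (by simp)]
      simp only [zero_mul, zero_add, true_and, inputs, List.getD_cons_zero, Bool.false_xor]
      rw [receive_copy]
      by_cases h : i' = 0
      · subst h
        rw [zero_mul, zero_add, receive_zero_eq k i j i.2]
        simp
      · have := Nat.le_mul_of_pos_left n (Nat.pos_of_ne_zero h)
        rw [receive_of_not k (by simp; omega)]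
        simp [h]
    · rw [e₂ _ (by simpa using hr), e₁ _ (by simp only [ne_eq]; omega), receive_of_not k (by simp)]
      match r, hr with
      | 1, _ =>
        by_cases hj : j = 0
        · simp [inputs, hj]
        · simp [inputs, hj]
      | r + 2, _ => simp [inputs]

/-- Interleaved copies of a circuit on the registers `b, b + 2, …`. -/
def spread (b M : ℕ) (C : List Gate) : List Gate :=
  (List.range M).flatMap fun c => relabel (place 2 b M c) C

theorem spread_wires (b M : ℕ) (C : List Gate) :
    WiresIn (spread b M C) {w | b ≤ w.1 ∧ w.1 % 2 = b % 2} := by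
  refine WiresIn.flatMap fun c _ => (WiresIn.relabel _).mono ?_
  rintro _ ⟨w, rfl⟩
  simp only [place, Set.mem_ofPred_eq]
  omega

theorem forall_support_spread (U : Alphabet) (b M : ℕ) (C : List Gate) (z : Basis)
    (p : ℕ → Basis → Prop)
    (h : ∀ c < M, ∀ x ∈ (run U C (ket (z ∘ place 2 b M c))).support, p c x) :
    ∀ x ∈ (run U (spread b M C) (ket z)).support, ∀ c < M, p c (x ∘ place 2 b M c) := by
  intro x hx c hc
  refine forall_support_parallel U M _ (slot 2 b M) (fun c hc => WiresIn.relabel_slot hc C)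
    slot_disjoint (fun c x => c < M → p c (x ∘ place 2 b M c)) ?_ z ?_ x hx c hc hc
  · intro c x x' hxx
    by_cases hc : c < M
    · rw [show x ∘ place 2 b M c = x' ∘ place 2 b M c from
        funext fun w => hxx _ (place_mem_slot hc w)]
    · simp [hc]
  · intro c hc x hx _
    have hf : Function.Injective (place 2 b M c) := place_injective (by simp) (by omega)
    rw [run_relabel_ket U hf] at hx
    obtain ⟨z', hz', rfl⟩ := exists_of_mem_support_mapLin hx
    rw [show (Function.extend (place 2 b M c) z' z) ∘ place 2 b M c = z' from
      funext fun w => hf.extend_apply _ _ _]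
    exact h c hc z' hz'

/-! ### The perfect prover and its test round -/

section

variable (n R kl xl yl w : ℕ) (P : Prover) (l : ℕ) (chk samp : List Gate)

/-- Commit in `R` blocks and prepare range superpositions, and report the commitments of the first
block that passes its check. -/
def newCommit : List Gate :=
  distribute n R kl ++ spread 5 R (block n kl xl yl P l chk) ++ spread 8 n samp ++
    selection n R yl

/-- Report the answers of the selected block, or those of the range superpositions. -/
def newTest : List Gate := answers n R xl ++ condReg n xl 12 3

/-- Undo the test in all blocks, and then answer the Hadamard round in all blocks. -/
def newHadamard : List Gate := spread 5 R (blockHadamard P l) ++ answers n R w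

variable {n R kl xl yl w P l chk samp} {chkf : Bits kl → Bool → Bits xl → Bits yl → Bool}

/-- Holds for every basis state in the support: either the reported data come from a flagged block,
or from the samplers, and both satisfy the check with certainty. -/
theorem passes_newTest (hchk : IsCheck chkf chk) (U : Alphabet) (k : Fin n → Bits kl)
    (hsamp : ∀ i : Fin n, ∀ z ∈ (run U samp (ket (inputs [List.ofFn (k i), [false]]))).support,
      chkf (k i) false (z.read 2 0 xl) (z.read 3 0 yl) = true)
    {z : Basis} (hz : z ∈ (run U (newCommit n R kl xl yl P l chk samp ++ newTest n R xl)
      (ket (receive k))).support) (i : Fin n) :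
    chkf (k i) (z (2, i, 0)) (z.read 3 i xl) (z.read 1 i yl) = true := by
  obtain ⟨d1, d2, d3⟩ := runClassical_distribute R k
  have hcl : ∀ g ∈ selection n R yl ++ (answers n R xl ++ condReg n xl 12 3), g.IsClassical := by
    intro g hg
    simp only [List.mem_append] at hg
    rcases hg with hg | hg | hg
    · exact selection_classical n R yl g hg
    · exact answers_classical n R xl g hg
    · exact (condReg_into n xl (by decide) (by decide) g hg).isClassical
  rw [newCommit, newTest, List.append_assoc _ (selection n R yl), run_append,
    run_classical U hcl] at hz
  obtain ⟨x, hx, rfl⟩ := exists_of_mem_support_mapLin hz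
  rw [run_append] at hx
  obtain ⟨x₀, hx₀, hx⟩ := exists_of_mem_support_run U _ hx
  rw [run_append, run_classical_ket U (distribute_classical n R kl)] at hx₀
  set zK := runClassical (distribute n R kl) (receive k)
  have hblock : ∀ c < R, x (15, c, 0) = true →
      chkf (k i) (x (13, i * R + c, 0)) (x.read 17 (i * R + c) xl) (x.read 35 (i * R + c) yl) =
        true := by
    intro c hc h15
    -- The samplers act on even registers only and leave the blocks as they are.
    have hodd : ∀ r i j, x (2 * r + 1, i, j) = x₀ (2 * r + 1, i, j) := fun r i j =>
      (spread_wires 8 n samp).eq_of_mem_support hx (by simp only [Set.mem_ofPred_eq]; omega)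
    have := forall_support_spread U 5 R _ zK (fun _ z => z (5, 0, 0) = true →
        chkf (k i) (z (4, i, 0)) (z.read 6 i xl) (z.read 15 i yl) = true)
        (fun c hc z hz h => by
          rw [d1 c hc] at hz
          exact passes_of_mem_support_block hchk U P l k hz h i) x₀ hx₀ c hc
    simp only [Function.comp_apply, place, Nat.reduceMul, Nat.reduceAdd, zero_mul, zero_add] at this
    unfold Basis.read at this ⊢
    simp only [Function.comp_apply, place, Nat.reduceMul, Nat.reduceAdd] at this
    simp only [hodd 6, hodd 7, hodd 8, hodd 17, Nat.reduceMul, Nat.reduceAdd] at h15 this ⊢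
    exact this h15
  have hhon : chkf (k i) false (x.read 12 i xl) (x.read 14 i yl) = true := by
    have := forall_support_spread U 8 n samp x₀ (fun i z => ∀ hi : i < n,
      chkf (k ⟨i, hi⟩) false (z.read 2 0 xl) (z.read 3 0 yl) = true)
      (fun i hi z hz _ => by
        refine hsamp ⟨i, hi⟩ z ?_
        rw [← d2 ⟨i, hi⟩]
        have : x₀ ∘ place 2 8 n i = zK ∘ place 2 8 n i := funext fun w =>
          (spread_wires 5 R _).eq_of_mem_support hx₀
            (by simp only [Set.mem_ofPred_eq, place]; omega)
        rwa [this] at hz) x hx i i.2 i.2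
    unfold Basis.read at this ⊢
    simpa only [Function.comp_apply, place, Nat.reduceMul, Nat.reduceAdd, zero_mul, zero_add]
      using this
  have h0 : ∀ w : Wire, 0 < w.1 → w.1 < 5 ∨ w.1 = 6 → x w = false := by
    intro w hw hw'
    rw [(spread_wires 8 n samp).eq_of_mem_support hx (by simp only [Set.mem_ofPred_eq]; omega),
      (spread_wires 5 R _).eq_of_mem_support hx₀ (by simp only [Set.mem_ofPred_eq]; omega),
      d3 w (by omega) (by omega), receive_of_not k (by omega)]
  rw [← List.append_assoc, runClassical_append]
  have e : ∀ (z : Basis) (w : Wire), w.1 ≠ 3 → runClassical (condReg n xl 12 3) z w = z w :=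
    fun z w hw => runClassical_into_of_register_ne
      (condReg_into n xl (by decide) (by decide)) _ hw
  by_cases hc : ∃ c, c < R ∧ x (15, c, 0) = true
  · have hlt := fun c' (h : c' < Nat.find hc) => Nat.find_min hc h
    obtain ⟨hcR, h15⟩ := Nat.find_spec hc
    obtain ⟨s1, s2, s3, s4⟩ := runClassical_selected (n := n) (yl := yl) (m := xl) x h0 hcR h15
      (fun c' h => by simpa [h.trans hcR] using hlt c' h)
    have := hblock _ hcR h15
    rw [e _ _ (by simp), s2 i i.2]
    convert this using 2
    · funext j
      rw [Basis.read, runClassical_condReg (by decide) (by decide) _ i.2 j.2, s4, s3 i i.2 j j.2]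
      simp [Basis.read]
    · funext j
      rw [Basis.read, e _ _ (by simp), s1 i i.2 j j.2]
      rfl
  -- Without a flagged block the reported bit is the untouched `0`, which agrees with the input bit
  -- given to the samplers; the string and the commitment come from registers `12` and `14`.
  · push Not at hc
    obtain ⟨s1, s2, s3, s4, s5⟩ := runClassical_not_selected (n := n) (yl := yl) (m := xl) x h0
      (R := R) (fun c h => by simpa using hc c h)
    rw [e _ _ (by simp), s2 i]
    convert hhon using 2
    · funext j
      rw [Basis.read, runClassical_condReg (by decide) (by decide) _ i.2 j.2, s4, s3 i j,
        s5 _ (by simp)]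
      simp [Basis.read]
    · funext j
      rw [Basis.read, e _ _ (by simp), s1 i i.2 j j.2]
      rfl

end

/-! ### The Hadamard round of the perfect prover -/

theorem expect_spread (U : Alphabet) (b M : ℕ) (C : List Gate) (z : Basis)
    (f : ℕ → Basis → ℝ) :
    (run U (spread b M C) (ket z)).expect
        (fun x => ∏ c ∈ Finset.range M, f c (x ∘ place 2 b M c)) =
      ∏ c ∈ Finset.range M, (run U C (ket (z ∘ place 2 b M c))).expect (f c) := by
  have h := expect_parallel U M _ (slot 2 b M) (fun c hc => WiresIn.relabel_slot hc C)
    slot_disjoint (fun c x => if c < M then f c (x ∘ place 2 b M c) else 0) ?_ z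
  · rw [spread]
    refine Eq.trans ?_ (h.trans ?_)
    · congr 1
      funext x
      exact Finset.prod_congr rfl fun c hc => (if_pos (Finset.mem_range.1 hc)).symm
    · refine Finset.prod_congr rfl fun c hc => ?_
      have hc := Finset.mem_range.1 hc
      have hf : Function.Injective (place 2 b M c) := place_injective (by simp) (by omega)
      rw [run_relabel_ket U hf, State.expect_mapLin (extend_left_injective hf z)]
      congr 1
      funext z'
      simp only [Function.comp_apply, hc, if_true]
      congr 1
      exact funext fun w => hf.extend_apply _ _ _
  · intro c x x' hxx
    by_cases hc : c < M
    · rw [show x ∘ place 2 b M c = x' ∘ place 2 b M c from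
        funext fun w => hxx _ (place_mem_slot hc w)]
    · simp [hc]

theorem WiresIn.relabel_image {C : List Gate} {W : Set Wire} (hC : WiresIn C W) (f : Wire → Wire) :
    WiresIn (MeasurementProtocol.relabel f C) (f '' W) := by
  intro g hg w hw
  obtain ⟨g', hg', rfl⟩ := List.mem_map.1 hg
  rw [Gate.wires_relabel] at hw
  obtain ⟨w', hw', rfl⟩ := List.mem_map.1 hw
  exact ⟨w', hC g' hg' w' hw', rfl⟩

/-- Prover register `r` becomes `2 * r` in a block and then `4 * r + 5` overall. Flags and saved
commitments, in registers `15` and `35`, are congruent to `3` modulo `4`. -/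
theorem blockHadamard_wires (P : Prover) (l R : ℕ) :
    WiresIn (spread 5 R (blockHadamard P l)) {w | w.1 % 4 = 1 ∧ 5 ≤ w.1} := by
  refine WiresIn.flatMap fun c _ => ((WiresIn.relabel proverWire).relabel_image _).mono ?_
  rintro _ ⟨_, ⟨⟨r, i, j⟩, rfl⟩, rfl⟩
  simp only [proverWire_apply, place, Set.mem_ofPred_eq]
  omega

theorem selectReg_wires (n R m a b : ℕ) :
    WiresIn (selectReg n R m a b) {w | w.1 = 6 ∨ w.1 = a ∨ w.1 = b} := by
  intro g hg w hw
  obtain ⟨i, c, j, -, -, -, rfl⟩ := mem_loops_single.1 hg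
  simp only [Gate.map, Gate.wires, loopEnv, List.mem_cons, List.not_mem_nil, or_false] at hw
  rcases hw with rfl | rfl | rfl <;> simp

theorem condReg_wires (n m a b : ℕ) :
    WiresIn (condReg n m a b) {w | w.1 = 4 ∨ w.1 = a ∨ w.1 = b} := by
  intro g hg w hw
  obtain ⟨i, c, j, -, -, -, rfl⟩ := mem_loops_single.1 hg
  simp only [Gate.map, Gate.wires, loopEnv, List.mem_cons, List.not_mem_nil, or_false] at hw
  rcases hw with rfl | rfl | rfl <;> simp

theorem selectFirst_wires (R : ℕ) :
    WiresIn (selectFirst R) {w | w.1 = 4 ∨ w.1 = 6 ∨ w.1 = 15} := by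
  intro g hg w hw
  simp only [selectFirst_eq, List.mem_cons, List.mem_flatMap, selectStep, List.not_mem_nil,
    or_false] at hg
  rcases hg with rfl | ⟨i, -, rfl | rfl⟩ <;>
    simp only [Gate.wires, List.mem_cons, List.not_mem_nil, or_false] at hw <;>
    rcases hw with rfl | rfl | rfl <;> simp

theorem selection_wires (n R yl : ℕ) :
    WiresIn (selection n R yl) {w | ¬ (w.1 % 4 = 1 ∧ 5 ≤ w.1)} := by
  refine WiresIn.append (WiresIn.append ((selectFirst_wires R).mono ?_)
    ((selectReg_wires _ _ _ _ _).mono ?_)) ((condReg_wires _ _ _ _).mono ?_) <;>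
  · intro w hw
    simp only [Set.mem_ofPred_eq] at hw ⊢
    omega

/-- The pattern of a first success at `c`: failures before it, no condition after it. -/
theorem prod_range_pattern {R c : ℕ} (hc : c < R) (p q : ℝ) :
    ∏ c' ∈ Finset.range R, (if c' < c then p else if c' = c then q else 1) = p ^ c * q := by
  induction R with
  | zero => omega
  | succ R ih =>
    rw [Finset.prod_range_succ]
    rcases Nat.lt_or_ge c R with h | h
    · rw [ih h, if_neg (by omega), if_neg (by omega), mul_one]
    · have : c = R := by omega
      subst this
      rw [if_neg (by omega), if_pos rfl,
        Finset.prod_congr rfl fun c' h => if_pos (Finset.mem_range.1 h)]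
      simp

section

variable {n R kl xl yl w : ℕ} {P : Prover} {l : ℕ} {chk samp : List Gate}
  {chkf : Bits kl → Bool → Bits xl → Bits yl → Bool}

/-- Selection uses only flags and saved commitments, so it commutes with the Hadamard part of the
blocks. Each block may therefore be completed before the selection, which makes the blocks
independent experiments. -/
theorem run_newHadamard (U : Alphabet) (ψ : State) :
    run U (newCommit n R kl xl yl P l chk samp ++ newHadamard n R w P l) ψ =
      run U (distribute n R kl ++ spread 5 R (block n kl xl yl P l chk ++ blockHadamard P l) ++
        spread 8 n samp ++ (selection n R yl ++ answers n R w)) ψ := by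
  have hcomm := run_comm U (C := spread 8 n samp ++ selection n R yl)
    (D := spread 5 R (blockHadamard P l)) (W := {w | ¬ (w.1 % 4 = 1 ∧ 5 ≤ w.1)})
    (WiresIn.append ((spread_wires 8 n samp).mono fun w hw => by
      simp only [Set.mem_ofPred_eq] at hw ⊢
      omega) (selection_wires n R yl))
    ((blockHadamard_wires P l R).mono fun w hw => by
      simpa only [Set.mem_compl_iff, Set.mem_ofPred_eq, not_not] using hw)
  have hpar := run_parallel_append U R
    (fun c => relabel (place 2 5 R c) (block n kl xl yl P l chk))
    (fun c => relabel (place 2 5 R c) (blockHadamard P l)) (slot 2 5 R)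
    (fun c hc => WiresIn.relabel_slot hc _) (fun c hc => WiresIn.relabel_slot hc _) slot_disjoint
  have happ : (spread 5 R (block n kl xl yl P l chk ++ blockHadamard P l)) =
      (List.range R).flatMap fun c => relabel (place 2 5 R c) (block n kl xl yl P l chk) ++
        relabel (place 2 5 R c) (blockHadamard P l) := by
    simp [spread, relabel]
  rw [happ]
  simp only [newCommit, newHadamard, run_append] at hcomm hpar ⊢
  rw [hcomm, ← hpar]
  rfl

/-- Decompose according to the first successful block. An inequality suffices: the branch without
success contributes a nonnegative amount, which is dropped. -/
theorem le_expect_newHadamard (hchk : IsCheck chkf chk) (U : Alphabet) (k : Fin n → Bits kl)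
    (φ : (Fin n → Bits yl) → (Fin n → Bool) → (Fin n → Bits w) → ℝ) (hφ : ∀ y b d, 0 ≤ φ y b d) :
    ∑ c ∈ Finset.range R, (1 - passProb chkf U P l k) ^ c * ∑ y : Fin n → Bits yl,
        (run U (P.hadamard l) (run U (dagger (P.test l)) (passed chkf U P l k y))).expect
          (fun z => φ y (fun i => z (2, i, 0)) fun i => z.read 3 i w) ≤
      (run U (newCommit n R kl xl yl P l chk samp ++ newHadamard n R w P l)
        (ket (receive k))).expect fun z =>
          φ (fun i => z.read 1 i yl) (fun i => z (2, i, 0)) fun i => z.read 3 i w := by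
  obtain ⟨d1, d2, d3⟩ := runClassical_distribute R k
  have hcl : ∀ g ∈ selection n R yl ++ answers n R w, g.IsClassical := by
    intro g hg
    rcases List.mem_append.1 hg with hg | hg
    · exact selection_classical n R yl g hg
    · exact answers_classical n R w g hg
  rw [run_newHadamard, run_append, run_classical_expect U hcl, run_append, run_append,
    run_classical_ket U (distribute_classical n R kl)]
  set zK := runClassical (distribute n R kl) (receive k)
  set D := block n kl xl yl P l chk ++ blockHadamard P l with hD
  let val : Basis → ℝ := fun z =>
    φ (fun i => z.read 15 i yl) (fun i => z (4, i, 0)) fun i => z.read 6 i w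
  -- For fixed `c` the product over `c'` is the value of block `c` times the indicator that `c` is
  -- the first flagged block. Being a product, it factorizes over the independent blocks.
  let f : ℕ → ℕ → Basis → ℝ := fun c c' z =>
    if c' < c then (if z (5, 0, 0) = true then 0 else 1) else
      if c' = c then (if z (5, 0, 0) = true then val z else 0) else 1
  have hexp : ∀ c < R, (1 - passProb chkf U P l k) ^ c * ∑ y : Fin n → Bits yl,
        (run U (P.hadamard l) (run U (dagger (P.test l)) (passed chkf U P l k y))).expect
          (fun z => φ y (fun i => z (2, i, 0)) fun i => z.read 3 i w) =
      (run U (spread 8 n samp) (run U (spread 5 R D) (ket zK))).expect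
        fun x => ∏ c' ∈ Finset.range R, f c c' (x ∘ place 2 5 R c') := by
    intro c hc
    rw [run_expect_of_notTarget, expect_spread, ← prod_range_pattern hc]
    · refine Finset.prod_congr rfl fun c' hc' => ?_
      rw [d1 c' (Finset.mem_range.1 hc')]
      simp only [f]
      split_ifs with h1 h2
      · exact (expect_block_not_flag hchk U P l k).symm
      · rw [hD, expect_block hchk U P l k val]
        refine Finset.sum_congr rfl fun y _ => ?_
        congr 1
        funext z
        simp only [val]
        congr 1
        · funext i j
          rw [Basis.read, blockState_odd _ _ _ _ (by simp), ← receive_zero y]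
          simp [saved]
        · funext i
          exact (blockState_even k y true z 2 i 0).symm
        · funext i j
          exact (blockState_even k y true z 3 i j).symm
      · rw [run_expect_one, State.expect_ket]
    -- Sampler targets are in even registers and blocks in odd ones.
    · intro g hg z b
      refine Finset.prod_congr rfl fun c' hc' => ?_
      congr 1
      funext x
      simp only [Function.comp_apply]
      rw [Function.update_of_ne]
      intro e
      have := spread_wires 8 n samp g hg _ g.target_mem
      rw [← e] at this
      simp only [place, Set.mem_ofPred_eq] at this
      omega
  rw [Finset.sum_congr rfl fun c hc => hexp c (Finset.mem_range.1 hc), ← State.expect_sum]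
  refine State.expect_mono _ fun x hx => ?_
  obtain ⟨x₀, hx₀, hx⟩ := exists_of_mem_support_run U _ hx
  have h0 : ∀ w : Wire, 0 < w.1 → w.1 < 5 ∨ w.1 = 6 → x w = false := by
    intro w hw hw'
    rw [(spread_wires 8 n samp).eq_of_mem_support hx (by simp only [Set.mem_ofPred_eq]; omega),
      (spread_wires 5 R _).eq_of_mem_support hx₀ (by simp only [Set.mem_ofPred_eq]; omega),
      d3 w (by omega) (by omega), receive_of_not k (by omega)]
  have hflag : ∀ c, (x ∘ place 2 5 R c) (5, 0, 0) = x (15, c, 0) := fun c => by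
    simp [place]
  by_cases hc : ∃ c, c < R ∧ x (15, c, 0) = true
  · have hlt := fun c' (h : c' < Nat.find hc) => Nat.find_min hc h
    obtain ⟨hcR, h15⟩ := Nat.find_spec hc
    set c₀ := Nat.find hc
    have hlt : ∀ c' < c₀, x (15, c', 0) = false := fun c' h => by
      simpa [h.trans hcR] using hlt c' h
    obtain ⟨s1, s2, s3, s4⟩ := runClassical_selected (n := n) (yl := yl) (m := w) x h0 hcR h15 hlt
    rw [Finset.sum_eq_single c₀, Finset.prod_eq_single c₀]
    · simp only [f, lt_irrefl, if_false, if_true, hflag, h15, val, Function.comp_apply]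
      apply le_of_eq
      congr 1
      · funext i j
        rw [Basis.read, Basis.read, s1 i i.2 j j.2]
        rfl
      · funext i
        rw [s2 i i.2]
        rfl
      · funext i j
        rw [Basis.read, Basis.read, s3 i i.2 j j.2]
        rfl
    · intro c' _ hne
      simp only [f, hflag, hne, if_false]
      split_ifs with h1 h2
      · rw [hlt c' h1] at h2
        simp at h2
      · rfl
      · rfl
    · exact fun h => absurd (Finset.mem_range.2 hcR) h
    · intro c hcm hne
      rcases Nat.lt_or_gt_of_ne hne with h | h
      · refine Finset.prod_eq_zero hcm ?_
        simp only [f, hflag, hlt c h, lt_irrefl, if_false, if_true, Bool.false_eq_true]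
      · refine Finset.prod_eq_zero (Finset.mem_range.2 hcR) ?_
        simp only [f, hflag, h15, if_true]
        exact if_pos h
    · exact fun h => absurd (Finset.mem_range.2 hcR) h
  -- If no flag is on, every product vanishes at its factor `c' = c`.
  · push Not at hc
    rw [Finset.sum_eq_zero]
    · exact hφ _ _ _
    · intro c hcm
      refine Finset.prod_eq_zero hcm ?_
      simp only [f, hflag, hc c (Finset.mem_range.1 hcm), lt_irrefl, if_false, if_true]
      exact if_neg Bool.false_ne_true

end

/-! ### Uniform generation of the new circuits -/

section

variable {n R kl xl yl w : ℕ → ℕ} {chk samp : ℕ → List Gate}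

theorem verify_poly (hn : PolyTimeNat n) (hxl : PolyTimeNat xl) (hchk : PolyTimeCircuits chk) :
    PolyTimeCircuits fun l => verify (n l) (xl l) (chk l) := by
  have h1 : PolyTimeNat fun _ => 1 := PolyTimeNat.const 1
  have hc : PolyTimeCircuits fun l => checkAll (n l) (xl l) (chk l) :=
    ((PolyTimeCircuits.loops hn h1 h1 _).append (PolyTimeCircuits.loops hn h1 hxl _)).append
      (hchk.copies hn 4 3)
  exact (hc.append ((PolyTimeCircuits.loops h1 h1 h1 _).append
    (PolyTimeCircuits.loops h1 hn h1 _))).append hc.dagger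

theorem block_poly (hn : PolyTimeNat n) (hkl : PolyTimeNat kl) (hxl : PolyTimeNat xl)
    (hyl : PolyTimeNat yl) (hchk : PolyTimeCircuits chk) (P : Prover) :
    PolyTimeCircuits fun l => block (n l) (kl l) (xl l) (yl l) P l (chk l) := by
  have h1 : PolyTimeNat fun _ => 1 := PolyTimeNat.const 1
  exact ((((PolyTimeCircuits.loops hn h1 hkl _).append (P.commit_poly.relabel 2 0)).append
    (PolyTimeCircuits.loops hn h1 hyl _)).append (P.test_poly.relabel 2 0)).append
    (verify_poly hn hxl hchk)

theorem newCommit_poly (hn : PolyTimeNat n) (hR : PolyTimeNat R) (hkl : PolyTimeNat kl)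
    (hxl : PolyTimeNat xl) (hyl : PolyTimeNat yl) (hchk : PolyTimeCircuits chk)
    (hsamp : PolyTimeCircuits samp) (P : Prover) :
    PolyTimeCircuits fun l =>
      newCommit (n l) (R l) (kl l) (xl l) (yl l) P l (chk l) (samp l) := by
  have h1 : PolyTimeNat fun _ => 1 := PolyTimeNat.const 1
  exact (((((PolyTimeCircuits.loops hn hR hkl _).append (PolyTimeCircuits.loops hn h1 hkl _)).append
    ((block_poly hn hkl hxl hyl hchk P).copies hR 2 5)).append (hsamp.copies hn 2 8)).append
    ((((PolyTimeCircuits.loops h1 h1 h1 _).append (PolyTimeCircuits.loops h1 hR h1 _)).append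
      (PolyTimeCircuits.loops hn hR hyl _)).append (PolyTimeCircuits.loops hn h1 hyl _)))

theorem answers_poly {m : ℕ → ℕ} (hn : PolyTimeNat n) (hR : PolyTimeNat R) (hm : PolyTimeNat m) :
    PolyTimeCircuits fun l => answers (n l) (R l) (m l) :=
  (PolyTimeCircuits.loops hn hR (PolyTimeNat.const 1) _).append (PolyTimeCircuits.loops hn hR hm _)

/-- The perfect prover made from a prover. -/
def newProver (hn : PolyTimeNat n) (hR : PolyTimeNat R) (hkl : PolyTimeNat kl)
    (hxl : PolyTimeNat xl) (hyl : PolyTimeNat yl) (hw : PolyTimeNat w)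
    (hchk : PolyTimeCircuits chk) (hsamp : PolyTimeCircuits samp) (P : Prover) : Prover where
  commit l := newCommit (n l) (R l) (kl l) (xl l) (yl l) P l (chk l) (samp l)
  test l := newTest (n l) (R l) (xl l)
  hadamard l := newHadamard (n l) (R l) (w l) P l
  commit_poly := newCommit_poly hn hR hkl hxl hyl hchk hsamp P
  test_poly := (answers_poly hn hR hxl).append
    (PolyTimeCircuits.loops hn (PolyTimeNat.const 1) hxl _)
  hadamard_poly := (((P.test_poly.dagger.append P.hadamard_poly).relabel 2 0).copies hR 2 5).append
    (answers_poly hn hR hw)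

end

theorem newTest_target (n R xl : ℕ) : ∀ g ∈ newTest n R xl, g.target.1 ≠ 1 := by
  intro g hg
  simp only [newTest, answers, List.mem_append] at hg
  rcases hg with (hg | hg) | hg
  · rw [(selectReg_into _ _ _ (by decide) (by decide) g hg).target]; decide
  · rw [(selectReg_into _ _ _ (by decide) (by decide) g hg).target]; decide
  · rw [(condReg_into _ _ (by decide) (by decide) g hg).target]; decide

theorem newHadamard_target (n R w : ℕ) (P : Prover) (l : ℕ) :
    ∀ g ∈ newHadamard n R w P l, g.target.1 ≠ 1 := by
  intro g hg
  simp only [newHadamard, answers, List.mem_append] at hg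
  rcases hg with hg | hg | hg
  · have := spread_wires 5 R _ g hg _ g.target_mem
    simp only [Set.mem_ofPred_eq] at this
    omega
  · rw [(selectReg_into _ _ _ (by decide) (by decide) g hg).target]; decide
  · rw [(selectReg_into _ _ _ (by decide) (by decide) g hg).target]; decide

/-! ### The new prover in the protocol -/

namespace ETCF

variable {U : Alphabet} (E : ETCF U)

/-- By `chk_eq` the two cases of the verifier's test coincide. This is why the prover can run the
test without knowing `h`. -/
theorem testOk_iff {l n : ℕ} (h : Bits n) (r : E.Coins l n) (y : Fin n → Bits (E.yLen l))
    (z : Basis) : (∀ i, E.testOk h r y z i) ↔ Passes (E.F.chk l) (E.key h r) y z := by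
  refine forall_congr' fun i => ?_
  rw [testOk, ← E.chk_eq, ite_self]

theorem testAccept_eq (P : Prover) {n : ℕ} (l : ℕ) (h : Bits n) :
    E.testAccept P l h = avg fun r : E.Coins l n =>
      passProb (E.F.chk l) U P l (E.key h r) := by
  simp only [testAccept, testOk_iff, passProb]

theorem exists_check : ∃ C : ℕ → List Gate, PolyTimeCircuits C ∧
    ∀ l, IsCheck (E.F.chk l) (C l) := by
  obtain ⟨C, hC, hcl, hspec⟩ := E.F.chk_poly
  refine ⟨C, hC, fun l => ⟨hcl l, fun k b x y => ?_⟩⟩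
  exact hspec l (k, b, x, y) 0 [_] rfl 0 _ rfl

/-- By `samp_eq` one sampler serves both kinds of keys, and a pair with nonzero amplitude lies in
the support that the check decides. -/
theorem chk_of_mem_support_samp {l n : ℕ} (h : Bits n) (r : E.Coins l n) (i : Fin n) (b : Bool)
    {z : Basis}
    (hz : z ∈ (run U (E.F.samp l) (ket (inputs [List.ofFn (E.key h r i), [b]]))).support) :
    E.F.chk l (E.key h r i) b (z.read 2 0 _) (z.read 3 0 _) = true := by
  have key : ∀ (k : Bits (E.keyLen l)) (f : Bits (E.xLen l) → Bits (E.yLen l) → ℝ),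
      z ∈ (E.rangeState l k b f).support →
        z.read 2 0 _ ∈ E.X l ∧ z.read 3 0 _ ∈ supp (f (z.read 2 0 _)) := by
    intro k f hz
    obtain ⟨x, hx, hz⟩ := Finset.mem_biUnion.1 (Finsupp.support_finsetSum hz)
    obtain ⟨y, -, hz⟩ := Finset.mem_biUnion.1 (Finsupp.support_finsetSum hz)
    obtain ⟨rfl, hne⟩ := (Finsupp.mem_support_single _ _ _).1 hz
    have h2 : (inputs [List.ofFn k, [b], List.ofFn x, List.ofFn y]).read 2 0 (E.xLen l) = x := by
      funext j
      simp [Basis.read, inputs]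
    have h3 : (inputs [List.ofFn k, [b], List.ofFn x, List.ofFn y]).read 3 0 (E.yLen l) = y := by
      funext j
      simp [Basis.read, inputs]
    rw [h2, h3]
    refine ⟨hx, ?_⟩
    by_contra hc
    apply hne
    -- Outside the support the amplitude is zero, since the real square root vanishes on nonpositive
    -- arguments.
    rw [Real.sqrt_eq_zero_of_nonpos (not_lt.1 hc)]
    simp
  by_cases hi : h i = true
  · have e : E.key h r i = (E.F.gen l (r.1 i)).1 := if_pos hi
    rw [e] at hz ⊢
    rw [E.F.samp_spec l _ (E.F.gen_mem l _)] at hz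
    exact (E.F.chk_spec l _ (E.F.gen_mem l _) _ _ _).2 (key _ _ hz)
  · have e : E.key h r i = (E.G.gen l (r.2 i)).1 := if_neg hi
    rw [e] at hz ⊢
    rw [E.samp_eq, E.G.samp_spec l _ (E.G.gen_mem l _)] at hz
    rw [E.chk_eq]
    exact (E.G.chk_spec l _ (E.G.gen_mem l _) _ _ _).2 (key _ _ hz)

theorem avg_const {α : Type} [Fintype α] [Nonempty α] (c : ℝ) : avg (fun _ : α => c) = c := by
  have : (Fintype.card α : ℝ) ≠ 0 := by exact_mod_cast Fintype.card_ne_zero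
  simp [avg, this]

theorem perfect_newProver {n R w : ℕ → ℕ} {chk : ℕ → List Gate} (hn : PolyTimeNat n)
    (hR : PolyTimeNat R) (hw : PolyTimeNat w) (hchk : PolyTimeCircuits chk)
    (hspec : ∀ l, IsCheck (E.F.chk l) (chk l)) (P : Prover) :
    E.Perfect (newProver hn hR E.keyLen_poly E.xLen_poly E.yLen_poly hw hchk E.F.samp_poly P) n := by
  intro l h
  rw [testAccept_eq, ← avg_const (α := E.Coins l (n l)) 1]
  congr 1
  funext r
  set P' := newProver hn hR E.keyLen_poly E.xLen_poly E.yLen_poly hw hchk E.F.samp_poly P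
  refine (sum_committed_expect U P' l (E.key h r) (P'.test l) (newTest_target _ _ _)
    fun y z => if Passes (E.F.chk l) (E.key h r) y z then 1 else 0).trans ?_
  rw [State.expect_congr (φ' := fun _ => 1), run_expect_one, State.expect_ket]
  intro z hz
  exact if_pos fun i => passes_newTest (hspec l) U (E.key h r)
    (fun i z hz => E.chk_of_mem_support_samp h r i false hz) hz i

theorem decode_congr {l n : ℕ} (h : Bits n) (r : E.Coins l n) (y : Fin n → Bits (E.yLen l))
    {z z' : Basis} (i : Fin n) (h2 : z (2, i, 0) = z' (2, i, 0))
    (h3 : z.read 3 i (E.F.w l) = z'.read 3 i (E.F.w l)) :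
    E.decode h r y z i = E.decode h r y z' i := by
  unfold decode
  simp only [h2, h3]

/-- A basis state in which the answers `b` and `d` can be read. -/
def answerState {n w : ℕ} (b : Fin n → Bool) (d : Fin n → Bits w) : Basis := fun v =>
  if v.1 = 2 then receive (fun i (_ : Fin 1) => b i) (0, v.2) else receive d (0, v.2)

/-- Decoding sees a basis state only through the answers, so the lower bound for functions of the
answers applies to functions of the decoded bits. -/
theorem decode_answerState {l n : ℕ} (h : Bits n) (r : E.Coins l n) (y : Fin n → Bits (E.yLen l))
    (z : Basis) :
    E.decode h r y (answerState (fun i : Fin n => z (2, i, 0)) fun i => z.read 3 i (E.F.w l)) =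
      E.decode h r y z := by
  funext i
  refine E.decode_congr h r y i ?_ ?_
  · exact receive_zero (fun i (_ : Fin 1) => z (2, i, 0)) i 0
  · funext j
    exact receive_zero (fun i : Fin n => z.read 3 i (E.F.w l)) i j

/-- The expectation of `φ` of the decoded results after the test round was passed and undone. -/
def undoneExpect (P : Prover) {n : ℕ} (l : ℕ) (h : Bits n) (r : E.Coins l n)
    (φ : (Fin n → Option Bool) → ℝ) : ℝ :=
  ∑ y : Fin n → Bits (E.yLen l), (run U (P.hadamard l) (run U (dagger (P.test l))
    (passed (E.F.chk l) U P l (E.key h r) y))).expect fun z => φ (E.decode h r y z)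

/-- The expectation of `φ` of the decoded results in the Hadamard round, for given keys. -/
def keyExpect (P : Prover) {n : ℕ} (l : ℕ) (h : Bits n) (r : E.Coins l n)
    (φ : (Fin n → Option Bool) → ℝ) : ℝ :=
  ∑ y : Fin n → Bits (E.yLen l),
    (run U (P.hadamard l) (P.committed U l (E.key h r) y)).expect fun z => φ (E.decode h r y z)

theorem hadamardExpect_eq (P : Prover) {n : ℕ} (l : ℕ) (h : Bits n)
    (φ : (Fin n → Option Bool) → ℝ) :
    E.hadamardExpect P l h φ = avg fun r : E.Coins l n => E.keyExpect P l h r φ := rfl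

theorem undoneExpect_le_newProver {n R : ℕ → ℕ} {chk : ℕ → List Gate} (hn : PolyTimeNat n)
    (hR : PolyTimeNat R) (hchk : PolyTimeCircuits chk)
    (hspec : ∀ l, IsCheck (E.F.chk l) (chk l)) (P : Prover) (l : ℕ) (h : Bits (n l))
    (r : E.Coins l (n l)) (φ : (Fin (n l) → Option Bool) → ℝ) (hφ : ∀ o, 0 ≤ φ o) :
    (∑ c ∈ Finset.range (R l), (1 - passProb (E.F.chk l) U P l (E.key h r)) ^ c) *
      E.undoneExpect P l h r φ ≤
    E.keyExpect (newProver hn hR E.keyLen_poly E.xLen_poly E.yLen_poly E.F.w_poly hchk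
      E.F.samp_poly P) l h r φ := by
  set P' := newProver hn hR E.keyLen_poly E.xLen_poly E.yLen_poly E.F.w_poly hchk E.F.samp_poly P
  rw [keyExpect, sum_committed_expect U P' l (E.key h r) (P'.hadamard l)
    (newHadamard_target _ _ _ _ _) fun y z => φ (E.decode h r y z), Finset.sum_mul]
  have := le_expect_newHadamard (l := l) (R := R l) (samp := E.F.samp l) (P := P) (hspec l) U (E.key h r)
    (fun y b d => φ (E.decode h r y (answerState b d))) (fun _ _ _ => hφ _) (w := E.F.w l)
  simp only [decode_answerState] at this
  exact this

end ETCF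

/-! ### Distance estimates -/

/-- The distance of measurement statistics of two pure states in terms of their overlap. With `b = β
/ √a`, each difference of squared norms is at most `‖α - b‖ * ‖α + b‖`; then apply Cauchy–Schwarz.
-/
theorem sum_abs_sq_sub_le {ι : Type*} (s : Finset ι) (α β : ι → ℂ) {a : ℝ} (ha : 0 < a)
    (hα : ∑ i ∈ s, ‖α i‖ ^ 2 = 1) (hβ : ∑ i ∈ s, ‖β i‖ ^ 2 = a)
    (hαβ : ∑ i ∈ s, (star (α i) * β i).re = a) :
    ∑ i ∈ s, |‖α i‖ ^ 2 - ‖β i‖ ^ 2 / a| ≤ 2 * √(1 - a) := by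
  set t := √a with ht
  have ht0 : 0 < t := Real.sqrt_pos.2 ha
  have hta : t ^ 2 = a := Real.sq_sqrt ha.le
  have hpt : ∀ i, |‖α i‖ ^ 2 - ‖β i‖ ^ 2 / a| ≤
      ‖α i - β i / t‖ * ‖α i + β i / t‖ := by
    intro i
    rw [← norm_mul, ← hta, ← div_pow]
    have e : ‖β i‖ / t = ‖β i / (t : ℂ)‖ := by
      rw [norm_div, Complex.norm_real, Real.norm_of_nonneg ht0.le]
    rw [e]
    generalize β i / (t : ℂ) = b
    have h1 : |‖α i‖ ^ 2 - ‖b‖ ^ 2| = |((α i - b) * star (α i + b)).re| := by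
      congr 1
      rw [Complex.sq_norm, Complex.sq_norm, Complex.normSq_apply, Complex.normSq_apply]
      simp
      ring
    rw [h1]
    refine (Complex.abs_re_le_norm _).trans (le_of_eq ?_)
    rw [norm_mul, norm_mul, norm_star]
  -- Both signs at once: the unit vectors `α` and `β / t` have real inner product `a / t = t`. The
  -- two norms multiply to `4 * (1 - a)`.
  have hexp : ∀ σ : ℝ, σ ^ 2 = 1 → ∑ i ∈ s, ‖α i + σ * (β i / t)‖ ^ 2 = 2 + σ * (2 * t) := by
    intro σ hσ
    have : ∀ i, ‖α i + σ * (β i / t)‖ ^ 2 =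
        ‖α i‖ ^ 2 + ‖β i‖ ^ 2 / a + σ * (2 / t) * (star (α i) * β i).re := by
      intro i
      rw [Complex.sq_norm, Complex.sq_norm, Complex.sq_norm, Complex.normSq_add, Complex.normSq_mul,
        Complex.normSq_div, Complex.normSq_ofReal, Complex.normSq_ofReal, ← sq, ← sq, hσ, hta,
        one_mul]
      congr 1
      have : (α i * (starRingEnd ℂ) (σ * (β i / t))).re = σ / t * (star (α i) * β i).re := by
        rw [show (σ * (β i / t) : ℂ) = ((σ / t : ℝ) : ℂ) * β i by push_cast; ring]
        simp
        ring
      rw [this]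
      ring
    simp only [this]
    rw [Finset.sum_add_distrib, Finset.sum_add_distrib, ← Finset.sum_div, ← Finset.mul_sum, hα, hβ,
      hαβ, div_self ha.ne', ← hta]
    field_simp
    ring
  have h1 := hexp 1 (by norm_num)
  have h2 := hexp (-1) (by norm_num)
  have cs := Finset.sum_mul_sq_le_sq_mul_sq s (fun i => ‖α i - β i / t‖)
    (fun i => ‖α i + β i / t‖)
  have e1 : ∑ i ∈ s, ‖α i + β i / t‖ ^ 2 = 2 + 2 * t := by simpa using h1
  have e2 : ∑ i ∈ s, ‖α i - β i / t‖ ^ 2 = 2 - 2 * t := by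
    simpa [sub_eq_add_neg] using h2
  rw [e1, e2] at cs
  refine (Finset.sum_le_sum fun i _ => hpt i).trans ?_
  have h4 : 2 * √(1 - a) = √(4 * (1 - a)) := by
    rw [Real.sqrt_mul (by norm_num), show (4 : ℝ) = 2 ^ 2 by norm_num,
      Real.sqrt_sq (by norm_num)]
  rw [h4]
  refine Real.le_sqrt_of_sq_le (cs.trans (le_of_eq ?_))
  rw [← hta]
  ring

/-- Reweighted mixtures. -/
theorem sum_abs_mixture_le {ι M : Type*} [Fintype M] (s : Finset ι) (p q : ι → ℝ)
    (φ : M → ι → ℝ) (hφ : ∀ m, ∀ i, 0 ≤ φ m i) (h1 : ∀ i, ∑ m, φ m i = 1) :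
    ∑ m, |∑ i ∈ s, p i * φ m i - ∑ i ∈ s, q i * φ m i| ≤ ∑ i ∈ s, |p i - q i| := by
  calc ∑ m, |∑ i ∈ s, p i * φ m i - ∑ i ∈ s, q i * φ m i|
      ≤ ∑ m, ∑ i ∈ s, |p i - q i| * φ m i := by
        refine Finset.sum_le_sum fun m _ => ?_
        rw [← Finset.sum_sub_distrib]
        refine (Finset.abs_sum_le_sum_abs _ _).trans (le_of_eq ?_)
        refine Finset.sum_congr rfl fun i _ => ?_
        rw [← sub_mul, abs_mul, abs_of_nonneg (hφ m i)]
    _ = ∑ i ∈ s, |p i - q i| := by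
        rw [Finset.sum_comm]
        refine Finset.sum_congr rfl fun i _ => ?_
        rw [← Finset.mul_sum, h1, mul_one]

/-- With `f = (1 - a) ^ R` and `g` the geometric sum, `g * a = 1 - f`. Thus `D'` contains `1 - f`
parts of `E / a` plus a remainder of mass `f`, which is compared with `f` parts of `D`. If `a = 0`
the bound equals the trivial `1`. -/
theorem tv_le_of_mixture {M : Type} [Fintype M] (D D' E : M → ℝ) {a : ℝ} (R : ℕ)
    (hD : ∀ m, 0 ≤ D m) (hD1 : ∑ m, D m = 1) (hD'1 : ∑ m, D' m = 1) (hD' : ∀ m, 0 ≤ D' m)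
    (ha : 0 ≤ a) (ha1 : a ≤ 1) (hE : ∑ m, E m = a)
    (hle : ∀ m, (∑ c ∈ Finset.range R, (1 - a) ^ c) * E m ≤ D' m)
    (hclose : 0 < a → ∑ m, |D m - E m / a| ≤ 2 * √(1 - a)) :
    tv D D' ≤ √(1 - a) + (1 - a) ^ R * (1 - √(1 - a)) := by
  rw [tv]
  rcases ha.eq_or_lt with h0 | h0
  · rw [← h0]
    have : ∑ m, |D m - D' m| ≤ ∑ m, (D m + D' m) :=
      Finset.sum_le_sum fun m _ => (abs_sub _ _).trans (by
        rw [abs_of_nonneg (hD m), abs_of_nonneg (hD' m)])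
    rw [Finset.sum_add_distrib, hD1, hD'1] at this
    simp
    linarith
  · have hg : (∑ c ∈ Finset.range R, (1 - a) ^ c) * a = 1 - (1 - a) ^ R := by
      have := geom_sum_mul_neg (1 - a) R
      rwa [sub_sub_cancel] at this
    set g := ∑ c ∈ Finset.range R, (1 - a) ^ c
    set f := (1 - a) ^ R
    have hf0 : 0 ≤ f := pow_nonneg (by linarith) _
    have hf1 : f ≤ 1 := pow_le_one₀ (by linarith) (by linarith)
    have hpt : ∀ m, |D m - D' m| ≤ (1 - f) * |D m - E m / a| + (f * D m + (D' m - g * E m)) := by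
      intro m
      have e : D m - D' m = (1 - f) * (D m - E m / a) + (f * D m - (D' m - g * E m)) := by
        rw [← hg]
        field_simp
        rw [show f = 1 - g * a by linarith]
        ring
      rw [e]
      refine (abs_add_le _ _).trans (add_le_add ?_ ?_)
      · rw [abs_mul, abs_of_nonneg (by linarith : 0 ≤ 1 - f)]
      · refine (abs_sub _ _).trans ?_
        rw [abs_of_nonneg (mul_nonneg hf0 (hD m)), abs_of_nonneg (sub_nonneg.2 (hle m))]
    have := Finset.sum_le_sum fun m (_ : m ∈ Finset.univ) => hpt m
    rw [Finset.sum_add_distrib, Finset.sum_add_distrib, Finset.sum_sub_distrib, ← Finset.mul_sum,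
      ← Finset.mul_sum, ← Finset.mul_sum, hD1, hD'1, hE, hg] at this
    have h3 := mul_le_mul_of_nonneg_left (hclose h0) (by linarith : 0 ≤ 1 - f)
    nlinarith

/-- From `(1 - a) ^ R ≤ exp (-R * a)` and `x * exp (-x) ≤ 1`. -/
theorem mul_pow_le_inv {a : ℝ} (ha : 0 ≤ a) (ha1 : a ≤ 1) {R : ℕ} (hR : 0 < R) :
    a * (1 - a) ^ R ≤ 1 / R := by
  have h1 : (1 - a) ^ R ≤ Real.exp (-(R * a)) := by
    calc (1 - a) ^ R ≤ Real.exp (-a) ^ R :=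
          pow_le_pow_left₀ (by linarith) (by linarith [Real.add_one_le_exp (-a)]) _
      _ = Real.exp (-(R * a)) := by rw [← Real.exp_nat_mul]; congr 1; ring
  have h2 : Real.exp (-(R * a)) * (R * a) ≤ 1 := by
    rw [Real.exp_neg, inv_mul_le_iff₀ (Real.exp_pos _)]
    linarith [Real.add_one_le_exp (R * a)]
  have hR' : (0 : ℝ) < R := by exact_mod_cast hR
  rw [le_div_iff₀ hR']
  have : 0 ≤ R * a := by positivity
  nlinarith

/-- The first summand on the right is the tangent at `A` to the concave function `√(1 - a)`, so it
averages to `√(1 - A)`. The failure term is absorbed by the gap between the square root and its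
tangent, which is `(s - S) ^ 2 / (2 * S)`, up to an exponentially small error. -/
theorem sqrt_add_le {a A q : ℝ} {l R : ℕ} (ha : 0 ≤ a) (ha1 : a ≤ 1) (hA : A < 1)
    (hq : 1 ≤ q * A) (hq0 : 0 ≤ q) (hR : 32 * q ^ 2 + 4 * q * l ≤ R) :
    √(1 - a) + (1 - a) ^ R * (1 - √(1 - a)) ≤
      ((1 - a) + (1 - A)) / (2 * √(1 - A)) + Real.exp (-l) := by
  have hA0 : 0 < A := by
    by_contra h
    nlinarith
  set s := √(1 - a) with hs
  set S := √(1 - A) with hS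
  have hS0 : 0 < S := Real.sqrt_pos.2 (by linarith)
  have hs2 : s ^ 2 = 1 - a := Real.sq_sqrt (by linarith)
  have hS2 : S ^ 2 = 1 - A := Real.sq_sqrt (by linarith)
  have hs0 : 0 ≤ s := Real.sqrt_nonneg _
  have hs1 : s ≤ 1 := by nlinarith
  have hS1 : S ≤ 1 := by nlinarith
  have hq1 : 1 ≤ q := by nlinarith
  have hRq : 32 * q ^ 2 ≤ R := le_trans (by nlinarith [show (0 : ℝ) ≤ l from Nat.cast_nonneg l]) hR
  have hR0 : (0 : ℝ) < R := by nlinarith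
  set f := (1 - a) ^ R with hf
  have hf0 : 0 ≤ f := pow_nonneg (by linarith) _
  have key : f * (1 - s) ≤ (s - S) ^ 2 / 2 + Real.exp (-l) := by
    -- If `a` is comparable to `A`, then `R * a ≥ 4 * q * l * (A / 4) ≥ l`, and all blocks fail with
    -- probability at most `exp (-l)`.
    rcases le_or_gt (A / 4) a with h | h
    · have h1 : f ≤ Real.exp (-l) := by
        calc f ≤ Real.exp (-a) ^ R :=
              pow_le_pow_left₀ (by linarith) (by linarith [Real.add_one_le_exp (-a)]) _
          _ = Real.exp (-(R * a)) := by rw [← Real.exp_nat_mul]; congr 1; ring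
          _ ≤ Real.exp (-l) := by
            apply Real.exp_le_exp.2
            have h2 : 4 * q * l ≤ R := le_trans (by nlinarith [sq_nonneg q]) hR
            have h3 : 4 * q * l * (A / 4) ≤ R * a :=
              mul_le_mul h2 h (by positivity) hR0.le
            have h4 : (l : ℝ) * 1 ≤ l * (q * A) :=
              mul_le_mul_of_nonneg_left hq (Nat.cast_nonneg l)
            nlinarith
      nlinarith [sq_nonneg (s - S)]
    -- For small `a` the failure term is at most `1 / R ≤ A ^ 2 / 32`. As `s ^ 2 - S ^ 2 = A - a > 3
    -- * A / 4` and `s + S ≤ 2`, the gap is at least `(3 * A / 8) ^ 2 / 2`, which is larger.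
    · have h1 : 1 - s ≤ a := by nlinarith
      have h2 : f * (1 - s) ≤ 1 / R := by
        refine le_trans ?_ (mul_pow_le_inv ha ha1 (by exact_mod_cast hR0))
        rw [mul_comm a]
        exact mul_le_mul_of_nonneg_left h1 hf0
      have h3 : 1 / (R : ℝ) ≤ A ^ 2 / 32 := by
        rw [div_le_iff₀ hR0]
        have : 1 ≤ (q * A) ^ 2 := by nlinarith
        nlinarith [mul_le_mul_of_nonneg_left hRq (sq_nonneg A)]
      have h4 : 3 * A / 8 ≤ s - S := by nlinarith
      have h5 : (3 * A / 8) ^ 2 ≤ (s - S) ^ 2 := pow_le_pow_left₀ (by positivity) h4 2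
      have := Real.exp_pos (-(l : ℝ))
      nlinarith [sq_nonneg A]
  have h6 : s = ((1 - a) + (1 - A)) / (2 * S) - (s - S) ^ 2 / (2 * S) := by
    rw [← hs2, ← hS2]
    field_simp
    ring
  have h7 : (s - S) ^ 2 / 2 ≤ (s - S) ^ 2 / (2 * S) :=
    div_le_div_of_nonneg_left (sq_nonneg _) (by positivity) (by linarith)
  linarith

theorem avg_mono {α : Type} [Fintype α] {f g : α → ℝ} (h : ∀ a, f a ≤ g a) : avg f ≤ avg g :=
  div_le_div_of_nonneg_right (Finset.sum_le_sum fun a _ => h a) (Nat.cast_nonneg _)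

/-- A quantitative Jensen inequality; the tangent bound is linear in `a r` and can be averaged
exactly. -/
theorem avg_sqrt_add_le {α : Type} [Fintype α] [Nonempty α] (a : α → ℝ) (ha : ∀ r, 0 ≤ a r)
    (ha1 : ∀ r, a r ≤ 1) {q : ℝ} {l R : ℕ} (hq : 1 ≤ q * avg a) (hq0 : 0 ≤ q)
    (hR : 32 * q ^ 2 + 4 * q * l ≤ R) (hR0 : 0 < R) :
    avg (fun r => √(1 - a r) + (1 - a r) ^ R * (1 - √(1 - a r))) ≤
      √(1 - avg a) + Real.exp (-l) := by
  have hcard : (0 : ℝ) < Fintype.card α := by exact_mod_cast Fintype.card_pos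
  have hA1 : avg a ≤ 1 := (avg_mono ha1).trans (ETCF.avg_const 1).le
  -- At mean `1` the tangent is vertical, but then every `a r` equals `1`, and `R > 0` makes the
  -- failure power vanish.
  rcases hA1.eq_or_lt with h | h
  · have hall : ∀ r, a r = 1 := by
      have h0 : ∑ r, (1 - a r) = 0 := by
        rw [Finset.sum_sub_distrib]
        rw [avg, div_eq_one_iff_eq hcard.ne'] at h
        simp [h]
      intro r
      have := (Finset.sum_eq_zero_iff_of_nonneg fun r _ => sub_nonneg.2 (ha1 r)).1 h0 r
        (Finset.mem_univ r)
      linarith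
    have : (fun r => √(1 - a r) + (1 - a r) ^ R * (1 - √(1 - a r))) = fun _ => (0 : ℝ) := by
      funext r
      simp [hall r, hR0.ne']
    rw [this, ETCF.avg_const]
    positivity
  · refine (avg_mono fun r => sqrt_add_le (ha r) (ha1 r) h hq hq0 hR).trans (le_of_eq ?_)
    have hS : √(1 - avg a) ≠ 0 := (Real.sqrt_pos.2 (by linarith)).ne'
    have hS2 : √(1 - avg a) ^ 2 = 1 - avg a := Real.sq_sqrt (by linarith)
    have hsum : ∑ r, a r = avg a * Fintype.card α := by
      rw [avg, div_mul_cancel₀ _ hcard.ne']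
    generalize avg a = A at *
    rw [avg, Finset.sum_add_distrib, ← Finset.sum_div, Finset.sum_add_distrib,
      Finset.sum_sub_distrib, hsum]
    simp only [Finset.sum_const, Finset.card_univ, nsmul_eq_mul, mul_one]
    have e : (Fintype.card α - A * Fintype.card α + Fintype.card α * (1 - A)) / (2 * √(1 - A)) =
        Fintype.card α * √(1 - A) := by
      rw [div_eq_iff (mul_ne_zero two_ne_zero hS)]
      linear_combination (-2 * (Fintype.card α : ℝ)) * hS2
    rw [e, ← mul_add, mul_div_cancel_left₀ _ hcard.ne']

theorem negligible_add_exp {ν : ℕ → ℝ} (hν : Negligible ν) :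
    Negligible fun l => ν l + Real.exp (-l) := by
  refine ⟨fun l => add_nonneg (hν.1 l) (Real.exp_pos _).le, hν.2.add fun n => ?_⟩
  exact (Real.tendsto_pow_mul_exp_neg_atTop_nhds_zero n).comp tendsto_natCast_atTop_atTop

/-- A state splits orthogonally into its projection and the rest, so its overlap with the projection
is the squared norm of the latter. -/
theorem State.ip_filter (ψ : State) (p : Basis → Prop) [DecidablePred p] :
    State.ip ψ (ψ.filter p) = (ψ.prob p : ℝ) := by
  have h0 : State.ip (ψ.filter fun z => ¬ p z) (ψ.filter p) = 0 := by
    refine Finset.sum_eq_zero fun z hz => ?_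
    rw [Finsupp.support_filter, Finset.mem_filter] at hz
    have : (ψ.filter fun z => ¬ p z) z = 0 := Finsupp.filter_apply_neg _ _ (not_not.2 hz.2)
    simp [this]
  have h : State.ip ψ (ψ.filter p) =
      State.ip (ψ.filter p + ψ.filter fun z => ¬ p z) (ψ.filter p) :=
    congrArg (fun x => State.ip x (ψ.filter p)) (Finsupp.filter_add_filter_not _ _).symm
  rw [h, State.ip_add_left, h0, add_zero, State.ip_self, State.expect_filter, State.prob]
  congr! 3 with z
  congr

theorem tv_triangle {α : Type} [Fintype α] (p q r : α → ℝ) : tv p r ≤ tv p q + tv q r := by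
  rw [tv, tv, tv, ← mul_add, ← Finset.sum_add_distrib]
  exact mul_le_mul_of_nonneg_left (Finset.sum_le_sum fun a _ => abs_sub_le _ _ _) (by norm_num)

theorem tv_avg_le {α M : Type} [Fintype α] [Fintype M] (p q : α → M → ℝ) :
    tv (fun m => avg fun r => p r m) (fun m => avg fun r => q r m) ≤
      avg fun r => tv (p r) (q r) := by
  simp only [tv, avg, ← sub_div, ← Finset.sum_sub_distrib, abs_div, Nat.abs_cast]
  rw [← Finset.sum_div, ← Finset.mul_sum, ← mul_div_assoc]
  refine div_le_div_of_nonneg_right (mul_le_mul_of_nonneg_left ?_ (by norm_num)) (Nat.cast_nonneg _)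
  rw [Finset.sum_comm]
  exact Finset.sum_le_sum fun m _ => Finset.abs_sum_le_sum_abs _ _

/-- The probability that the verifier stores `m`, given the decoded results. -/
def storedProb {n : ℕ} (m : Bits n) (o : Fin n → Option Bool) : ℝ :=
  ∏ i, if o i = none then (1 / 2 : ℝ) else if o i = some (m i) then 1 else 0

theorem storedProb_nonneg {n : ℕ} (m : Bits n) (o : Fin n → Option Bool) : 0 ≤ storedProb m o :=
  Finset.prod_nonneg fun i _ => by split_ifs <;> norm_num

/-- Distributivity turns the sum over `m` into a product of sums over single bits, each equal to
`1`. -/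
theorem sum_storedProb {n : ℕ} (o : Fin n → Option Bool) : ∑ m, storedProb m o = 1 := by
  have h := Finset.prod_univ_sum (fun _ : Fin n => (Finset.univ : Finset Bool)) fun i b =>
    if o i = none then (1 / 2 : ℝ) else if o i = some b then 1 else 0
  rw [Fintype.piFinset_univ] at h
  refine h.symm.trans (Finset.prod_eq_one fun i _ => ?_)
  rcases o i with _ | _ | _ <;> norm_num

/-! ### Distances for fixed keys, and conditioning on acceptance -/

namespace ETCF

variable {U : Alphabet} (E : ETCF U) (P : Prover) {n : ℕ} (l : ℕ) (h : Bits n)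

theorem keyExpect_one (r : E.Coins l n) : E.keyExpect P l h r (fun _ => 1) = 1 := by
  simp only [keyExpect, run_expect_one]
  refine (sum_committed_expect U P l (E.key h r) [] (by simp) fun _ _ => 1).trans ?_
  rw [run_expect_one, State.expect_ket]

theorem keyExpect_nonneg (r : E.Coins l n) {φ : (Fin n → Option Bool) → ℝ} (hφ : ∀ o, 0 ≤ φ o) :
    0 ≤ E.keyExpect P l h r φ :=
  Finset.sum_nonneg fun _ _ => State.expect_nonneg _ fun _ => hφ _

theorem keyExpect_sum {ι : Type*} (s : Finset ι) (r : E.Coins l n)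
    (φ : ι → (Fin n → Option Bool) → ℝ) :
    E.keyExpect P l h r (fun o => ∑ m ∈ s, φ m o) = ∑ m ∈ s, E.keyExpect P l h r (φ m) := by
  simp only [keyExpect, State.expect_sum]
  exact Finset.sum_comm

theorem undoneExpect_sum {ι : Type*} (s : Finset ι) (r : E.Coins l n)
    (φ : ι → (Fin n → Option Bool) → ℝ) :
    E.undoneExpect P l h r (fun o => ∑ m ∈ s, φ m o) = ∑ m ∈ s, E.undoneExpect P l h r (φ m) := by
  simp only [undoneExpect, State.expect_sum]
  exact Finset.sum_comm

theorem undoneExpect_one (r : E.Coins l n) :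
    E.undoneExpect P l h r (fun _ => 1) = passProb (E.F.chk l) U P l (E.key h r) := by
  simp only [undoneExpect, run_expect_one, passed, State.expect_filter]
  rfl

theorem passProb_nonneg (r : E.Coins l n) : 0 ≤ passProb (E.F.chk l) U P l (E.key h r) :=
  Finset.sum_nonneg fun _ _ => State.expect_nonneg _ fun _ => by split_ifs <;> norm_num

theorem passProb_le_one (r : E.Coins l n) : passProb (E.F.chk l) U P l (E.key h r) ≤ 1 := by
  rw [← keyExpect_one E P l h r]
  refine Finset.sum_le_sum fun y _ => ?_
  rw [run_expect_one, ← run_expect_one U (P.test l)]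
  exact State.expect_mono _ fun z _ => by split_ifs <;> norm_num

/-- Gentle measurement: a test passed with probability `a` and then undone disturbs the committed
state little. The commitments `y` and final basis states are treated jointly as the index of one
amplitude vector; the verifier's decoding is a stochastic map and cannot increase the distance. -/
theorem sum_abs_keyExpect_sub_le (r : E.Coins l n)
    (ha : 0 < passProb (E.F.chk l) U P l (E.key h r)) :
    ∑ m, |E.keyExpect P l h r (storedProb m) -
        E.undoneExpect P l h r (storedProb m) / passProb (E.F.chk l) U P l (E.key h r)| ≤
      2 * √(1 - passProb (E.F.chk l) U P l (E.key h r)) := by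
  set a := passProb (E.F.chk l) U P l (E.key h r) with ha'
  let u : (Fin n → Bits (E.yLen l)) → State := fun y =>
    run U (P.hadamard l) (P.committed U l (E.key h r) y)
  let v : (Fin n → Bits (E.yLen l)) → State := fun y =>
    run U (P.hadamard l) (run U (dagger (P.test l)) (passed (E.F.chk l) U P l (E.key h r) y))
  let T : Finset Basis := Finset.univ.biUnion fun y => (u y).support ∪ (v y).support
  have hu : ∀ y, (u y).support ⊆ T := fun y z hz =>
    Finset.mem_biUnion.2 ⟨y, Finset.mem_univ _, Finset.mem_union_left _ hz⟩
  have hv : ∀ y, (v y).support ⊆ T := fun y z hz =>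
    Finset.mem_biUnion.2 ⟨y, Finset.mem_univ _, Finset.mem_union_right _ hz⟩
  let I : Finset ((Fin n → Bits (E.yLen l)) × Basis) := Finset.univ ×ˢ T
  have hk : ∀ φ, E.keyExpect P l h r φ =
      ∑ x ∈ I, ‖u x.1 x.2‖ ^ 2 * φ (E.decode h r x.1 x.2) := by
    intro φ
    rw [Finset.sum_product]
    exact Finset.sum_congr rfl fun y _ => State.expect_eq_sum (hu y) _
  have hd : ∀ φ, E.undoneExpect P l h r φ =
      ∑ x ∈ I, ‖v x.1 x.2‖ ^ 2 * φ (E.decode h r x.1 x.2) := by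
    intro φ
    rw [Finset.sum_product]
    exact Finset.sum_congr rfl fun y _ => State.expect_eq_sum (hv y) _
  have h1 : ∑ x ∈ I, ‖u x.1 x.2‖ ^ 2 = 1 := by
    rw [← keyExpect_one E P l h r, hk]
    simp
  have h2 : ∑ x ∈ I, ‖v x.1 x.2‖ ^ 2 = a := by
    rw [ha', ← undoneExpect_one E P l h r, hd]
    simp
  have h3 : ∑ x ∈ I, (star (u x.1 x.2) * v x.1 x.2).re = a := by
    rw [Finset.sum_product, ha', passProb]
    refine Finset.sum_congr rfl fun y _ => ?_
    have e : State.ip (u y) (v y) = ∑ z ∈ T, star (u y z) * v y z := by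
      refine Finset.sum_subset (hv y) fun z _ hz => ?_
      rw [Finsupp.notMem_support_iff.1 hz]
      exact mul_zero _
    rw [← Complex.re_sum, ← e]
    simp only [u, v]
    -- The Hadamard circuit cancels from the overlap. Writing the committed state as test followed
    -- by inverse test cancels the inverse as well, leaving the overlap of the tested state with its
    -- passing projection.
    rw [run_ip, ← run_dagger_run U (P.test l) (P.committed U l (E.key h r) y), run_ip,
      run_dagger_run, passed, State.ip_filter, Complex.ofReal_re]
  have := sum_abs_sq_sub_le I (fun x => u x.1 x.2) (fun x => v x.1 x.2) ha h1 h2 h3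
  refine le_trans ?_ this
  refine le_trans (le_of_eq ?_) (sum_abs_mixture_le I (fun x => ‖u x.1 x.2‖ ^ 2)
    (fun x => ‖v x.1 x.2‖ ^ 2 / a) (fun m x => storedProb m (E.decode h r x.1 x.2))
    (fun m x => storedProb_nonneg _ _) (fun x => sum_storedProb _))
  refine Finset.sum_congr rfl fun m _ => ?_
  rw [hk, hd, Finset.sum_div]
  simp only [div_mul_eq_mul_div]

theorem tv_keyExpect_le {n R : ℕ → ℕ} {chk : ℕ → List Gate} (hn : PolyTimeNat n)
    (hR : PolyTimeNat R) (hchk : PolyTimeCircuits chk)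
    (hspec : ∀ l, IsCheck (E.F.chk l) (chk l)) (P : Prover) (l : ℕ) (h : Bits (n l))
    (r : E.Coins l (n l)) :
    tv (fun m => E.keyExpect P l h r (storedProb m)) (fun m => E.keyExpect (newProver hn hR
      E.keyLen_poly E.xLen_poly E.yLen_poly E.F.w_poly hchk E.F.samp_poly P) l h r (storedProb m)) ≤
      √(1 - passProb (E.F.chk l) U P l (E.key h r)) +
        (1 - passProb (E.F.chk l) U P l (E.key h r)) ^ R l *
          (1 - √(1 - passProb (E.F.chk l) U P l (E.key h r))) := by
  refine tv_le_of_mixture _ _ (fun m => E.undoneExpect P l h r (storedProb m)) (R l)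
    (fun m => E.keyExpect_nonneg P l h r (storedProb_nonneg m)) ?_ ?_
    (fun m => E.keyExpect_nonneg _ l h r (storedProb_nonneg m)) (E.passProb_nonneg P l h r)
    (E.passProb_le_one P l h r) ?_
    (fun m => E.undoneExpect_le_newProver hn hR hchk hspec P l h r _ (storedProb_nonneg m))
    (E.sum_abs_keyExpect_sub_le P l h r)
  · rw [← keyExpect_sum]
    simp only [sum_storedProb, keyExpect_one]
  · rw [← keyExpect_sum]
    simp only [sum_storedProb, keyExpect_one]
  · rw [← undoneExpect_sum]
    simp only [sum_storedProb, undoneExpect_one]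

theorem dist_nonneg (m : Bits n) : 0 ≤ E.dist P l h m :=
  div_nonneg (Finset.sum_nonneg fun r _ => E.keyExpect_nonneg P l h r (storedProb_nonneg m))
    (Nat.cast_nonneg _)

theorem hadamardExpect_sum {ι : Type*} (s : Finset ι) (φ : ι → (Fin n → Option Bool) → ℝ) :
    E.hadamardExpect P l h (fun o => ∑ m ∈ s, φ m o) = ∑ m ∈ s, E.hadamardExpect P l h (φ m) := by
  simp only [hadamardExpect_eq, keyExpect_sum, avg]
  rw [Finset.sum_comm, Finset.sum_div]

theorem hadamardExpect_mono {φ φ' : (Fin n → Option Bool) → ℝ} (hφ : ∀ o, φ o ≤ φ' o) :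
    E.hadamardExpect P l h φ ≤ E.hadamardExpect P l h φ' :=
  avg_mono fun _ => Finset.sum_le_sum fun _ _ => State.expect_mono _ fun _ _ => hφ _

theorem hadamardExpect_one : E.hadamardExpect P l h (fun _ => 1) = 1 := by
  simp only [hadamardExpect_eq, keyExpect_one]
  exact avg_const 1

theorem sum_dist : ∑ m, E.dist P l h m = 1 := by
  rw [← hadamardExpect_one E P l h]
  refine (E.hadamardExpect_sum P l h Finset.univ storedProb).symm.trans ?_
  simp only [sum_storedProb]

/-- The accepted part `acc` has mass `A` and lies below both distributions when `A > 0`, so each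
exceeds it by mass `1 - A`. -/
theorem tv_distCond_le : tv (E.distCond P l h) (E.dist P l h) ≤ 1 - E.hadamardAccept P l h := by
  let acc : Bits n → ℝ := fun m =>
    E.hadamardExpect P l h fun o => if ∀ i, o i = some (m i) then 1 else 0
  set A := E.hadamardAccept P l h with hA
  have hacc0 : ∀ m, 0 ≤ acc m := fun m => avg_const (α := E.Coins l n) 0 ▸ avg_mono fun r =>
    E.keyExpect_nonneg P l h r (φ := fun o => if ∀ i, o i = some (m i) then 1 else 0)
      fun o => by split_ifs <;> norm_num
  have hsum : ∑ m, acc m = A := by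
    refine (E.hadamardExpect_sum P l h Finset.univ _).symm.trans ?_
    rw [hA, hadamardAccept]
    congr 1
    funext o
    by_cases ho : ∀ i, o i ≠ none
    · rw [if_pos ho]
      choose m hm using fun i => Option.ne_none_iff_exists'.1 (ho i)
      rw [Finset.sum_eq_single m, if_pos hm]
      · intro m' _ hne
        refine if_neg fun h' => hne (funext fun i => ?_)
        have := (hm i).symm.trans (h' i)
        simpa using this.symm
      · simp
    · rw [if_neg ho]
      refine Finset.sum_eq_zero fun m _ => if_neg fun h' => ho fun i => ?_
      rw [h' i]
      simp
  have hle : ∀ m, acc m ≤ E.dist P l h m := by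
    intro m
    refine E.hadamardExpect_mono P l h fun o => ?_
    split_ifs with ho
    · refine le_of_eq (Finset.prod_eq_one fun i _ => ?_).symm
      simp [ho i]
    · exact storedProb_nonneg m o
  have hcond : ∀ m, E.distCond P l h m = acc m / A := fun m => rfl
  have hA0 : 0 ≤ A := hsum ▸ Finset.sum_nonneg fun m _ => hacc0 m
  have hA1 : A ≤ 1 := by
    rw [← hsum, ← E.sum_dist P l h]
    exact Finset.sum_le_sum fun m _ => hle m
  rw [tv]
  simp only [hcond]
  rcases hA0.eq_or_lt with h0 | h0
  -- If acceptance has probability zero, division makes the conditional function zero, and the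
  -- distance is `1 / 2`.
  · rw [← h0]
    simp only [div_zero, zero_sub, abs_neg, abs_of_nonneg (E.dist_nonneg P l h _), E.sum_dist]
    norm_num
  · have hpt : ∀ m, |acc m / A - E.dist P l h m| ≤
        (acc m / A - acc m) + (E.dist P l h m - acc m) := by
      intro m
      have h1 : acc m ≤ acc m / A := le_div_self (hacc0 m) h0 hA1
      rw [abs_le]
      constructor <;> linarith [hle m]
    have := Finset.sum_le_sum fun m (_ : m ∈ Finset.univ) => hpt m
    rw [Finset.sum_add_distrib, Finset.sum_sub_distrib, Finset.sum_sub_distrib, ← Finset.sum_div,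
      hsum, E.sum_dist, div_self h0.ne'] at this
    linarith

theorem tv_dist_le_one (P' : Prover) : tv (E.dist P l h) (E.dist P' l h) ≤ 1 := by
  have : ∑ m, |E.dist P l h m - E.dist P' l h m| ≤ ∑ m, (E.dist P l h m + E.dist P' l h m) :=
    Finset.sum_le_sum fun m _ => (abs_sub _ _).trans (by
      rw [abs_of_nonneg (E.dist_nonneg P l h m), abs_of_nonneg (E.dist_nonneg P' l h m)])
  rw [Finset.sum_add_distrib, E.sum_dist, E.sum_dist] at this
  rw [tv]
  linarith

end ETCF

namespace ETCF

variable {U : Alphabet} (E : ETCF U) (P : Prover) {n : ℕ} (l : ℕ) (h : Bits n)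

theorem testAccept_nonneg : 0 ≤ E.testAccept P l h := by
  rw [testAccept_eq, ← avg_const (α := E.Coins l n) 0]
  exact avg_mono fun r => E.passProb_nonneg P l h r

theorem testAccept_le_one : E.testAccept P l h ≤ 1 := by
  rw [testAccept_eq, ← avg_const (α := E.Coins l n) 1]
  exact avg_mono fun r => E.passProb_le_one P l h r

end ETCF

end MeasurementProtocol

end

/-! ### Conclusion -/

theorem mainTheorem8 (U : MeasurementProtocol.Alphabet) (E : MeasurementProtocol.ETCF U)
    (n : ℕ → ℕ) (hn : MeasurementProtocol.PolyTimeNat n) (P : MeasurementProtocol.Prover)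
    (q : Polynomial ℕ) (ν : ℕ → ℝ) (hν : MeasurementProtocol.Negligible ν) :
    ∃ P' : MeasurementProtocol.Prover, E.Perfect P' n ∧
      ∃ μ : ℕ → ℝ, MeasurementProtocol.Negligible μ ∧
        ∀ (l : ℕ) (h : MeasurementProtocol.Bits (n l)),
          (E.testAccept P l h ≤ ν l ∨ 1 ≤ ((q.eval l : ℕ) : ℝ) * E.testAccept P l h) →
          MeasurementProtocol.tv (E.distCond P l h) (E.dist P' l h) ≤
            (1 - E.hadamardAccept P l h) + √(1 - E.testAccept P l h) + μ l := by
  open MeasurementProtocol ETCF in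
  obtain ⟨chk, hchk, hspec⟩ := E.exists_check
  -- The first term treats keys with small passing probability, the second makes the failure
  -- probability at most `exp (-l)` for the others, and the `1` keeps `R` positive.
  let R : Polynomial ℕ := 32 * q ^ 2 + 4 * q * Polynomial.X + 1
  have hR : PolyTimeNat fun l => R.eval l := PolyTimeNat.eval R
  let P' := newProver hn hR E.keyLen_poly E.xLen_poly E.yLen_poly E.F.w_poly hchk E.F.samp_poly P
  refine ⟨P', E.perfect_newProver hn hR E.F.w_poly hchk hspec P,
    fun l => ν l + Real.exp (-l), negligible_add_exp hν, fun l h hl => ?_⟩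
  refine (tv_triangle _ (E.dist P l h) _).trans ?_
  rw [add_assoc]
  refine add_le_add (E.tv_distCond_le P l h) ?_
  have hexp := Real.exp_pos (-(l : ℝ))
  rcases hl with hl | hl
  -- For negligible acceptance the right side is at least `1 - ν l + ν l`, and a distance of
  -- distributions is at most `1`.
  · have h1 : 1 - E.testAccept P l h ≤ √(1 - E.testAccept P l h) := by
      refine Real.le_sqrt_of_sq_le ?_
      have h0 : 0 ≤ E.testAccept P l h := E.testAccept_nonneg P l h
      have h1 : E.testAccept P l h ≤ 1 := E.testAccept_le_one P l h
      nlinarith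
    linarith [E.tv_dist_le_one P l h P']
  · rw [testAccept_eq] at hl ⊢
    have key := avg_sqrt_add_le (l := l) (R := R.eval l) _ (fun r => E.passProb_nonneg P l h r)
      (fun r => E.passProb_le_one P l h r) hl (Nat.cast_nonneg _) (by simp [R]) (by simp [R])
    have := (tv_avg_le _ _).trans (avg_mono fun r =>
      E.tv_keyExpect_le hn hR hchk hspec P l h r)
    refine (this.trans key).trans ?_
    linarith [hν.1 l]
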